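/- \textbf{Setting.} Let $\mathbf{dom}$ be a denumerable set of constants with $\mathbb{Q}_{\ge 0}\subseteq\mathbf{dom}$ (and infinitely many non-numbers). There are infinitely many numerical and infinitely many non-numerical variables. Every relation name $R$ has a signature $(n,k,J)$: arity $n$, primary key $\{1,\dots,k\}$ with $0\le k\le n$, numerical positions $J\subseteq\{1,\dots,n\}$. An atom $F=R(u_1,\dots,u_n)$ has variables or constants as arguments, with $u_j$ a numerical variable or a number in $\mathbb{Q}_{\ge 0}$ for $j\in J$; $\mathrm{vars}(F)$ is its set of variables, $\mathrm{key}(F)$ is the set of those at positions of the primary key, and $\mathrm{notkey}(F)=\mathrm{vars}(F)\setminus\mathrm{key}(F)$. A fact is an atom without variables, and a database instance is a finite set of facts. It is consistent if no two distinct facts in it have the same relation name and agree on the primary key; a repair of $\mathbf{db}$ is a $\subseteq$-maximal consistent subset of $\mathbf{db}$. A valuation over a finite set $U$ of variables is a map $\theta:U\to\mathbf{dom}$ sending numerical variables to $\mathbb{Q}_{\ge 0}$. First-order (FOL) formulas are built from atoms and equalities; quantifiers range over $\mathbf{dom}$ (over $\mathbb{Q}_{\ge0}$ for numerical variables). We write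 $(\mathbf{db},\theta)\models\varphi$ if $\theta$ extends to a valuation of the free variables of $\varphi$ as well under which $\varphi$ is true in $\mathbf{db}$, and $(\mathbf{db},\theta)\models_{\mathsf{cqa}}\varphi$ if $(\mathbf{r},\theta)\models\varphi$ for every repair $\mathbf{r}$ of $\mathbf{db}$. A query in $\mathsf{sjfBCQ}$ is $q=\exists\vec u\,(q(\vec u))$, where $q(\vec u)$ is a conjunction of $n\ge0$ atoms with pairwise distinct relation names and $\vec u$ lists its variables; we also write $q$ for the set of its atoms. For $F\in q$, let $F^{+,q}$ be the set of the variables $x$ of $q$ such that the functional dependencies $\mathrm{key}(G)\to\mathrm{vars}(G)$, $G\in q\setminus\{F\}$, logically imply $\mathrm{key}(F)\to x$. The atom $F$ attacks a variable $x$ if there is a sequence $x_1,\dots,x_m=x$ ($m\ge1$) of variables outside $F^{+,q}$ with $x_1\in\mathrm{notkey}(F)$, any two adjacent ones of which occur together in an atom of $q$. The attack graph of $q$ has the atoms of $q$ as vertices and an edge from $F$ to $G\neq F$ if $F$ attacks a variable of $G$. Let the attack graph of $q$ be acyclic, let $(F_1,\dots,F_n)$ be a topological sort of it, and let $\vec u_\ell$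 be the variables of $F_1,\dots,F_\ell$ and $\vec x_\ell$ the variables of $\mathrm{key}(F_\ell)$ not in $\vec u_{\ell-1}$. The $0$-embedding is the empty valuation, and for $\ell\ge1$ an $\ell$-embedding of $q$ in $\mathbf{db}$ is a valuation $\theta$ over $\vec u_\ell$ with $(\mathbf{db},\theta)\models q(\vec u)$. The $0$-embedding is a $0$-$\forall$embedding if every repair of $\mathbf{db}$ satisfies $q$. For $\ell\ge1$, an $\ell$-embedding $\theta$ is an $\ell$-$\forall$embedding if $(\mathbf{db},\theta|_{\vec u_{\ell-1}\vec x_\ell})\models_{\mathsf{cqa}}F_\ell\wedge\dots\wedge F_n$ and $\theta|_{\vec u_{\ell-1}}$ is an $(\ell-1)$-$\forall$embedding. A $\forall$embedding is an $n$-$\forall$embedding. \textbf{Lemma.} There is an algorithm that, given any query $q=\exists\vec u\,(q(\vec u))$ in $\mathsf{sjfBCQ}$ with an acyclic attack graph, constructs in time quadratic in the size of $q$ a FOL formula $\varphi(\vec u)$, with free variables $\vec u$, such that for every topological sort of the attack graph of $q$, for every database instance $\mathbf{db}$ and every valuation $\theta$ over $\vec u$, $$(\mathbf{db},\theta)\models\varphi(\vec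 u)\quad\text{if and only if}\quad\theta\text{ is a }\forall\text{embedding of }q\text{ in }\mathbf{db}\text{ (relative to that topological sort).}$$ Here the size of $q$ is the number of symbols in which it is written (each occurrence of a variable, a constant or a relation name counts for a bounded number of symbols), and time is the number of steps of a unit-cost random access machine with successor and predecessor as its only arithmetic operations, which reads $q$ and prints $\varphi$ symbol by symbol. -/

import Mathlib

namespace CQA

/-! ## Syntax: variables, constants, relation names, atoms, facts -/

/-- The constants `dom`: the non-negative rational numbers, and denumerably many other symbols. -/
inductive Const where
  | num (x : ℚ≥0)
  | sym (s : ℕ)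
  deriving DecidableEq

/-- The constant is a number in `ℚ≥0`. -/
def Const.IsNumber : Const → Prop
  | .num _ => True
  | .sym _ => False

/-- Variables: denumerably many numerical and denumerably many other ones. -/
structure Var where
  numerical : Bool
  idx : ℕ
  deriving DecidableEq

/-- Terms: a variable or a constant. -/
inductive Term where
  | var (x : Var)
  | const (c : Const)
  deriving DecidableEq

/-- The term is a numerical variable or a number. -/
def Term.IsNumerical : Term → Prop
  | .var x => x.numerical = true
  | .const c => c.IsNumber

def Term.vars : Term → Finset Var
  | .var x => {x}
  | .const _ => ∅

def Term.eval (ν : Var → Const) : Term → Const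
  | .var x => ν x
  | .const c => c

/-- A relation name, together with its signature `(n, k, J)`: the arity `n` is the length of
`cols`, the primary key consists of the first `k = keyLen` positions, and `J` is the set of the
positions that carry the flag `true` in `cols` (the numerical columns).  There are denumerably
many relation names of each signature, told apart by `id`. -/
structure RelName where
  id : ℕ
  cols : List Bool
  keyLen : ℕ
  keyLen_le : keyLen ≤ cols.length
  deriving DecidableEq

def RelName.arity (R : RelName) : ℕ := R.cols.length

/-- An atom `R(u₁, …, uₙ)`.  The condition `wf` says that there are as many arguments as
columns, and that each numerical column holds a numerical variable or a number. -/
structure Atom where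
  rel : RelName
  args : List Term
  wf : List.Forall₂ (fun b t => b = true → t.IsNumerical) rel.cols args
  deriving DecidableEq

/-- The variables that occur in a list of terms. -/
def varsOf (l : List Term) : Finset Var := (l.map Term.vars).foldr (· ∪ ·) ∅

def Atom.vars (F : Atom) : Finset Var := varsOf F.args

/-- Variables that occur at a position of the primary key. -/
def Atom.key (F : Atom) : Finset Var := varsOf (F.args.take F.rel.keyLen)

def Atom.notKey (F : Atom) : Finset Var := F.vars \ F.key

/-- The variables that occur in a list of atoms. -/
def atomsVars (l : List Atom) : Finset Var := (l.map Atom.vars).foldr (· ∪ ·) ∅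

/-- A fact: an atom without variables. -/
structure DBFact where
  rel : RelName
  args : List Const
  wf : List.Forall₂ (fun b c => b = true → Const.IsNumber c) rel.cols args
  deriving DecidableEq

def DBFact.KeyEqual (A B : DBFact) : Prop :=
  A.rel = B.rel ∧ A.args.take A.rel.keyLen = B.args.take B.rel.keyLen

/-! ## Database instances and repairs -/

abbrev Database := Finset DBFact

def Consistent (db : Database) : Prop :=
  ∀ A ∈ db, ∀ B ∈ db, A.KeyEqual B → A = B

/-- `r` is a `⊆`-maximal consistent subset of `db`. -/
def IsRepair (db r : Database) : Prop :=
  Maximal (fun s : Database => s ⊆ db ∧ Consistent s) r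

/-! ## First-order logic -/

/-- First-order formulas with equality over the relation names and the constants. -/
inductive Formula where
  | tru
  | rel (F : Atom)
  | eq (s t : Term)
  | not (φ : Formula)
  | and (φ ψ : Formula)
  | or (φ ψ : Formula)
  | imp (φ ψ : Formula)
  | all (x : Var) (φ : Formula)
  | ex (x : Var) (φ : Formula)

def Formula.freeVars : Formula → Finset Var
  | .tru => ∅
  | .rel F => F.vars
  | .eq s t => s.vars ∪ t.vars
  | .not φ => φ.freeVars
  | .and φ ψ => φ.freeVars ∪ ψ.freeVars
  | .or φ ψ => φ.freeVars ∪ ψ.freeVars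
  | .imp φ ψ => φ.freeVars ∪ ψ.freeVars
  | .all x φ => φ.freeVars.erase x
  | .ex x φ => φ.freeVars.erase x

/-- The value `c` may be assigned to `x`: numerical variables take values in `ℚ≥0` only. -/
def Admissible (x : Var) (c : Const) : Prop := x.numerical = true → c.IsNumber

/-- Satisfaction of a formula in a database instance under a total assignment.  Quantifiers range
over all constants, and those over numerical variables range over all numbers in `ℚ≥0`. -/
def Sat (db : Database) : (Var → Const) → Formula → Prop
  | _, .tru => True
  | ν, .rel F => ∃ A ∈ db, A.rel = F.rel ∧ A.args = F.args.map (Term.eval ν)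
  | ν, .eq s t => s.eval ν = t.eval ν
  | ν, .not φ => ¬ Sat db ν φ
  | ν, .and φ ψ => Sat db ν φ ∧ Sat db ν ψ
  | ν, .or φ ψ => Sat db ν φ ∨ Sat db ν ψ
  | ν, .imp φ ψ => Sat db ν φ → Sat db ν ψ
  | ν, .all x φ => ∀ c, Admissible x c → Sat db (Function.update ν x c) φ
  | ν, .ex x φ => ∃ c, Admissible x c ∧ Sat db (Function.update ν x c) φ

/-- The conjunction of a list of atoms (`true` if the list is empty). -/
def conj : List Atom → Formula
  | [] => .tru
  | F :: l => .and (.rel F) (conj l)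

/-! ## Valuations -/

/-- A valuation over the finite set `dom` of variables. -/
structure Valuation where
  dom : Finset Var
  val : {x // x ∈ dom} → Const
  admissible : ∀ x, Admissible x.1 (val x)

/-- The empty valuation. -/
def Valuation.empty : Valuation where
  dom := ∅
  val := fun x => absurd x.2 (Finset.notMem_empty x.1)
  admissible := fun x => absurd x.2 (Finset.notMem_empty x.1)

/-- The restriction of `θ` to (the part in its domain of) `V`. -/
def Valuation.restrict (θ : Valuation) (V : Finset Var) : Valuation where
  dom := θ.dom ∩ V
  val := fun x => θ.val ⟨x.1, (Finset.mem_inter.mp x.2).1⟩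
  admissible := fun x => θ.admissible ⟨x.1, (Finset.mem_inter.mp x.2).1⟩

/-- `(db, θ) ⊨ φ`: the valuation `θ` can be extended (to the free variables of `φ`, which is the
same as to all variables) so that `φ` becomes true in `db`. -/
def Models (db : Database) (θ : Valuation) (φ : Formula) : Prop :=
  ∃ ν : Var → Const, (∀ x, Admissible x (ν x)) ∧ (∀ x, ν x.1 = θ.val x) ∧ Sat db ν φ

/-- `(db, θ) ⊨cqa φ`: `(r, θ) ⊨ φ` for every repair `r` of `db`. -/
def ModelsCqa (db : Database) (θ : Valuation) (φ : Formula) : Prop :=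
  ∀ r, IsRepair db r → Models r θ φ

/-! ## Self-join-free Boolean conjunctive queries and their attack graphs -/

/-- A self-join-free Boolean conjunctive query `∃ u (R₁(u₁) ∧ ⋯ ∧ Rₙ(uₙ))`, given by its body. -/
structure SJFBCQ where
  atoms : List Atom
  selfJoinFree : (atoms.map Atom.rel).Nodup

def SJFBCQ.vars (q : SJFBCQ) : Finset Var := atomsVars q.atoms

/-- A functional dependency `lhs → rhs`. -/
structure FD where
  lhs : Finset Var
  rhs : Finset Var

/-- A relation (a set of tuples whose attributes are the variables) satisfies `fd`. -/
def FD.Holds (fd : FD) (T : Set (Var → Const)) : Prop :=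
  ∀ s ∈ T, ∀ t ∈ T, (∀ x ∈ fd.lhs, s x = t x) → ∀ y ∈ fd.rhs, s y = t y

/-- Logical implication of functional dependencies. -/
def FDImplies (S : Set FD) (fd : FD) : Prop :=
  ∀ T : Set (Var → Const), (∀ f ∈ S, f.Holds T) → fd.Holds T

namespace SJFBCQ

/-- The dependencies `key(G) → vars(G)` of the atoms `G` of `q` other than `F`. -/
def fdsWithout (q : SJFBCQ) (F : Atom) : Set FD :=
  {f | ∃ G ∈ q.atoms, G ≠ F ∧ f = ⟨G.key, G.vars⟩}

/-- The closure of `key(F)` with respect to the dependencies of `q \ {F}`. -/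
def keycl (q : SJFBCQ) (F : Atom) : Set Var :=
  {x | x ∈ q.vars ∧ FDImplies (q.fdsWithout F) ⟨F.key, {x}⟩}

/-- Two variables occur together in some atom of `q`. -/
def Cooccur (q : SJFBCQ) (x y : Var) : Prop := ∃ G ∈ q.atoms, x ∈ G.vars ∧ y ∈ G.vars

/-- The atom `F` attacks the variable `x`; the witnessing sequence of variables is `x₁ :: w`. -/
def AttacksVar (q : SJFBCQ) (F : Atom) (x : Var) : Prop :=
  ∃ (x₁ : Var) (w : List Var), x₁ ∈ F.notKey ∧
    (x₁ :: w).getLast (List.cons_ne_nil x₁ w) = x ∧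
    (∀ y ∈ x₁ :: w, y ∉ q.keycl F) ∧
    List.IsChain q.Cooccur (x₁ :: w)

/-- The edges of the attack graph, a directed graph without loops whose vertices are the atoms. -/
def Attacks (q : SJFBCQ) (F G : Atom) : Prop :=
  F ∈ q.atoms ∧ G ∈ q.atoms ∧ F ≠ G ∧ ∃ x ∈ G.vars, q.AttacksVar F x

/-- The attack graph has no directed cycle. -/
def AcyclicAttackGraph (q : SJFBCQ) : Prop := ∀ F, ¬ Relation.TransGen q.Attacks F F

/-- `l` lists the atoms of `q` in a topological sort of the attack graph. -/
def IsTopologicalSort (q : SJFBCQ) (l : List Atom) : Prop :=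
  l.Perm q.atoms ∧ l.Pairwise (fun F G => ¬ q.Attacks G F)

end SJFBCQ

/-! ## Embeddings and ∀embeddings, relative to an ordering `l = (F₁, …, Fₙ)` of the atoms -/

/-- `u_ℓ`: the variables of `F₁, …, F_ℓ`. -/
def uVars (l : List Atom) (k : ℕ) : Finset Var := atomsVars (l.take k)

/-- The variables of the primary key of `F_{ℓ+1}` that are not in `u_ℓ`. -/
def xVars (l : List Atom) (k : ℕ) : Finset Var :=
  match l[k]? with
  | some F => F.key \ uVars l k
  | none => ∅

/-- `ℓ`-embeddings; the only `0`-embedding is the empty valuation. -/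
def IsLEmbedding (l : List Atom) (db : Database) : ℕ → Valuation → Prop
  | 0, θ => θ.dom = ∅
  | k + 1, θ => θ.dom = uVars l (k + 1) ∧ Models db θ (conj l)

/-- `ℓ`-∀embeddings. -/
def IsLForallEmbedding (l : List Atom) (db : Database) : ℕ → Valuation → Prop
  | 0, θ => IsLEmbedding l db 0 θ ∧ ModelsCqa db Valuation.empty (conj l)
  | k + 1, θ => IsLEmbedding l db (k + 1) θ ∧
      ModelsCqa db (θ.restrict (uVars l k ∪ xVars l k)) (conj (l.drop k)) ∧
      IsLForallEmbedding l db k (θ.restrict (uVars l k))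

/-- ∀embeddings, relative to the topological sort `l`. -/
def IsForallEmbedding (l : List Atom) (db : Database) (θ : Valuation) : Prop :=
  IsLForallEmbedding l db l.length θ

/-! ## Queries and formulas as sequences of symbols

Each occurrence of a name or a number contributes a bounded number of symbols. -/

def Var.encode (x : Var) : List ℕ := [if x.numerical then 1 else 0, x.idx]

def Term.encode : Term → List ℕ
  | .var x => x.encode ++ [0]
  | .const (.sym s) => [2, s, 0]
  | .const (.num a) => [3, a.num, a.den]

/-- The identifier of the relation name, its key length and its arity, followed by one block per
position, which holds the flag of the column and the term. -/
def Atom.encode (F : Atom) : List ℕ :=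
  [F.rel.id, F.rel.keyLen, F.rel.arity] ++
    (List.zip F.rel.cols F.args).flatMap
      (fun p => (if p.1 then 1 else 0) :: p.2.encode)

/-- The number of atoms, followed by the atoms. -/
def SJFBCQ.encode (q : SJFBCQ) : List ℕ := q.atoms.length :: q.atoms.flatMap Atom.encode

/-- The size of `q`: the number of symbols in which it is written. -/
def SJFBCQ.size (q : SJFBCQ) : ℕ := q.encode.length

/-- Formulas in Polish notation. -/
def Formula.encode : Formula → List ℕ
  | .tru => [0]
  | .rel F => 1 :: F.encode
  | .eq s t => 2 :: (s.encode ++ t.encode)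
  | .not φ => 3 :: φ.encode
  | .and φ ψ => 4 :: (φ.encode ++ ψ.encode)
  | .or φ ψ => 5 :: (φ.encode ++ ψ.encode)
  | .imp φ ψ => 6 :: (φ.encode ++ ψ.encode)
  | .all x φ => 7 :: (x.encode ++ φ.encode)
  | .ex x φ => 8 :: (x.encode ++ φ.encode)

/-! ## Random access machines

Programs are structured programs over registers and arrays of natural numbers, with indirect
addressing.  The only arithmetic operations are successor and predecessor, so that `t` steps
increase the largest number that occurs by at most `t`.  Every instruction and every evaluation
of a test takes one step. -/

inductive Instr where
  | skip
  | const (r k : ℕ)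
  | copy (r s : ℕ)
  | succ (r : ℕ)
  | pred (r : ℕ)
  | load (r a i : ℕ)
  | store (a i r : ℕ)
  | print (r : ℕ)

/-- Tests compare the contents of two registers. -/
inductive Test where
  | eq (r s : ℕ)
  | ne (r s : ℕ)
  | lt (r s : ℕ)
  | le (r s : ℕ)

inductive Prog where
  | instr (i : Instr)
  | seq (P Q : Prog)
  | ite (b : Test) (P Q : Prog)
  | loop (b : Test) (P : Prog)

/-- The registers, the arrays, and the symbols printed so far. -/
structure State where
  reg : ℕ → ℕ
  arr : ℕ → ℕ → ℕ
  out : List ℕ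

def State.setReg (σ : State) (r v : ℕ) : State :=
  { σ with reg := Function.update σ.reg r v }

/-- `load r a i` is `r := a[i]` and `store a i r` is `a[i] := r`, where the index is the content
of register `i`. -/
def Instr.exec (σ : State) : Instr → State
  | .skip => σ
  | .const r k => σ.setReg r k
  | .copy r s => σ.setReg r (σ.reg s)
  | .succ r => σ.setReg r (σ.reg r + 1)
  | .pred r => σ.setReg r (σ.reg r - 1)
  | .load r a i => σ.setReg r (σ.arr a (σ.reg i))
  | .store a i r =>
      { σ with arr := Function.update σ.arr a (Function.update (σ.arr a) (σ.reg i) (σ.reg r)) }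
  | .print r => { σ with out := σ.out ++ [σ.reg r] }

def Test.Holds (σ : State) : Test → Prop
  | .eq r s => σ.reg r = σ.reg s
  | .ne r s => σ.reg r ≠ σ.reg s
  | .lt r s => σ.reg r < σ.reg s
  | .le r s => σ.reg r ≤ σ.reg s

/-- `Exec P σ t τ`: started in the state `σ`, the program `P` halts after exactly `t` steps in the
state `τ`. -/
inductive Exec : Prog → State → ℕ → State → Prop
  | instr (i : Instr) (σ : State) : Exec (.instr i) σ 1 (i.exec σ)
  | seq {P Q : Prog} {σ τ υ : State} {s t : ℕ} :
      Exec P σ s τ → Exec Q τ t υ → Exec (.seq P Q) σ (s + t) υ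
  | iteTrue {b : Test} {P Q : Prog} {σ τ : State} {t : ℕ} :
      b.Holds σ → Exec P σ t τ → Exec (.ite b P Q) σ (t + 1) τ
  | iteFalse {b : Test} {P Q : Prog} {σ τ : State} {t : ℕ} :
      ¬ b.Holds σ → Exec Q σ t τ → Exec (.ite b P Q) σ (t + 1) τ
  | loopTrue {b : Test} {P : Prog} {σ τ υ : State} {s t : ℕ} :
      b.Holds σ → Exec P σ s τ → Exec (.loop b P) τ t υ → Exec (.loop b P) σ (s + t + 1) υ
  | loopFalse {b : Test} {P : Prog} {σ : State} :
      ¬ b.Holds σ → Exec (.loop b P) σ 1 σ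

/-- The start: the input is in array `0`, everything else is `0`, nothing has been printed. -/
def State.init (input : List ℕ) : State where
  reg := fun _ => 0
  arr := fun a i => if a = 0 then input.getD i 0 else 0
  out := []

/-- On the given input, `P` halts after exactly `t` steps, having printed `output`. -/
def Prog.Computes (P : Prog) (input output : List ℕ) (t : ℕ) : Prop :=
  ∃ τ, Exec P (State.init input) t τ ∧ τ.out = output

end CQA

namespace CQA

/-! ## Variables and matching -/

/-! Fix an assignment `ν` and a topological sort. Being a ∀embedding means that `ν` embeds the query
in the database and that, at each position, the remaining atoms are certain once the variables of
the earlier atoms and the key of the current atom are fixed (`CertainAlong`,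
`isForallEmbedding_iff`).

Everything rests on an exchange argument, `exists_embeds_of_swapFact`. Let `α` embed the atoms in a
repair `r` with `F` mapped to `A`, and let `β` embed them after `A` has been replaced by a key-equal
fact. If `β` uses the new fact, take `α` on the variables that `F` attacks and `β` elsewhere: the
two agree on the closure of `key(F)`, and an atom with an attacked variable has its unattacked ones
in that closure, so no atom is torn apart and the mixture embeds in `r`. Hence variables that no
atom attacks can take the same value in all repairs (`exists_certain_of_not_attacksVar`): start from
a repair that admits as few values as possible and walk to any other one, fact by fact.

The key of the first atom `F` of a topological sort is unattacked, so it may be quantified outside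
the certainty. Once it is fixed, certainty says that every fact of the block matches `F` and leaves
the other atoms certain, which is first-order (`sat_blockFormula`). Recursion gives
`certainFormula`, and one such condition per position gives `alongFormula`. The exchange argument
also moves an unattacked atom to the front of the certainty conditions (`CertainAlong.move_front`),
so these do not depend on the topological sort, and a formula built from one sort serves all.

It remains to find a sort and to print the formula in quadratic time. If `F` attacks `G` in an
acyclic attack graph, then `G` attacks a proper subset of the variables that `F` attacks
(`attacked_ssubset`), so it suffices to sort by decreasing number of attacked variables. For one
atom this number takes linear time: the closure of the key by the counting algorithm for functional
dependencies, then a search that avoids the closure; both are instances of `run_propagate`. The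
formula has quadratic length, and in Polish notation two nested loops over the sorted atoms print it
(`prints_rewriting`). -/

theorem mem_varsOf {x : Var} {l : List Term} : x ∈ varsOf l ↔ ∃ t ∈ l, x ∈ t.vars := by
  induction l with
  | nil => simp [varsOf]
  | cons a l ih => simp_all [varsOf]

theorem mem_atomsVars {x : Var} {l : List Atom} : x ∈ atomsVars l ↔ ∃ F ∈ l, x ∈ F.vars := by
  induction l with
  | nil => simp [atomsVars]
  | cons a l ih => simp_all [atomsVars]

theorem atomsVars_cons (F : Atom) (l : List Atom) : atomsVars (F :: l) = F.vars ∪ atomsVars l := rfl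

theorem Atom.key_subset_vars (F : Atom) : F.key ⊆ F.vars := by
  intro x hx
  obtain ⟨t, ht, h⟩ := mem_varsOf.1 hx
  exact mem_varsOf.2 ⟨t, List.mem_of_mem_take ht, h⟩

theorem map_eval_congr {l : List Term} {μ ν : Var → Const} (h : ∀ x ∈ varsOf l, μ x = ν x) :
    l.map (Term.eval μ) = l.map (Term.eval ν) := by
  refine List.map_congr_left fun t ht => ?_
  cases t with
  | var x => exact h x (mem_varsOf.2 ⟨_, ht, by simp [Term.vars]⟩)
  | const c => rfl

theorem agree_of_map_eval {l : List Term} {μ ν : Var → Const}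
    (h : l.map (Term.eval μ) = l.map (Term.eval ν)) : ∀ x ∈ varsOf l, μ x = ν x := by
  intro x hx
  obtain ⟨t, ht, hxt⟩ := mem_varsOf.1 hx
  have := List.map_inj_left.1 h t ht
  cases t with
  | var y =>
    simp only [Term.vars, Finset.mem_singleton] at hxt
    subst hxt
    exact this
  | const c => simp [Term.vars] at hxt

/-- All values of the assignment are admissible. -/
def AdmAssign (μ : Var → Const) : Prop := ∀ x, Admissible x (μ x)

theorem AdmAssign.update {μ : Var → Const} (h : AdmAssign μ) {x : Var} {c : Const}
    (hc : Admissible x c) : AdmAssign (Function.update μ x c) := by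
  intro y
  by_cases e : y = x
  · subst e; simpa using hc
  · simpa [e] using h y

/-- The fact `A` is the image of the atom `F` under `μ`. -/
def Matches (A : DBFact) (μ : Var → Const) (F : Atom) : Prop :=
  A.rel = F.rel ∧ A.args = F.args.map (Term.eval μ)

theorem Matches.congr {A : DBFact} {μ ν : Var → Const} {F : Atom} (h : Matches A μ F)
    (e : ∀ x ∈ F.vars, μ x = ν x) : Matches A ν F :=
  ⟨h.1, h.2.trans (map_eval_congr e)⟩

theorem Matches.agree {A : DBFact} {μ ν : Var → Const} {F : Atom} (h : Matches A μ F)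
    (h' : Matches A ν F) : ∀ x ∈ F.vars, μ x = ν x :=
  agree_of_map_eval (h.2.symm.trans h'.2)

theorem Matches.keyEqual {A B : DBFact} {μ ν : Var → Const} {F : Atom} (h : Matches A μ F)
    (h' : Matches B ν F) (e : ∀ x ∈ F.key, μ x = ν x) : A.KeyEqual B := by
  refine ⟨h.1.trans h'.1.symm, ?_⟩
  rw [h.1, h'.1, h.2, h'.2, ← List.map_take, ← List.map_take]
  exact map_eval_congr e

theorem Matches.agree_key {A B : DBFact} {μ ν : Var → Const} {F : Atom} (h : Matches A μ F)
    (h' : Matches B ν F) (e : A.KeyEqual B) : ∀ x ∈ F.key, μ x = ν x := by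
  have := e.2
  rw [h.1, h'.1, h.2, h'.2, ← List.map_take, ← List.map_take] at this
  exact agree_of_map_eval this

theorem DBFact.KeyEqual.refl (A : DBFact) : A.KeyEqual A := ⟨rfl, rfl⟩

theorem DBFact.KeyEqual.symm {A B : DBFact} (h : A.KeyEqual B) : B.KeyEqual A :=
  ⟨h.1.symm, h.2.symm⟩

theorem DBFact.KeyEqual.trans {A B C : DBFact} (h : A.KeyEqual B) (h' : B.KeyEqual C) :
    A.KeyEqual C :=
  ⟨h.1.trans h'.1, h.2.trans h'.2⟩

/-! ## Repairs -/

/-- Maximality amounts to meeting every block: a fact of `db` that is key-equal to no fact of `r`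
could be added without losing consistency. -/
theorem isRepair_iff {db r : Database} :
    IsRepair db r ↔ r ⊆ db ∧ Consistent r ∧ ∀ A ∈ db, ∃ B ∈ r, A.KeyEqual B := by
  constructor
  · intro h
    refine ⟨h.prop.1, h.prop.2, fun A hA => ?_⟩
    by_contra! hn
    have hc : Consistent (insert A r) := by
      intro C hC D hD e
      rw [Finset.mem_insert] at hC hD
      rcases hC with rfl | hC <;> rcases hD with rfl | hD
      · rfl
      · exact absurd e (hn D hD)
      · exact absurd e.symm (hn C hC)
      · exact h.prop.2 C hC D hD e
    have := h.le_of_ge (y := insert A r)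
      ⟨Finset.insert_subset hA h.prop.1, hc⟩ (Finset.subset_insert A r)
    exact hn A (this (Finset.mem_insert_self A r)) (DBFact.KeyEqual.refl A)
  · rintro ⟨h1, h2, h3⟩
    refine ⟨⟨h1, h2⟩, fun s hs hrs A hA => ?_⟩
    obtain ⟨B, hB, e⟩ := h3 A (hs.1 hA)
    rwa [hs.2 A hA B (hrs hB) e]

open Classical in
theorem exists_isRepair (db : Database) : ∃ r, IsRepair db r := by
  have hfin : {s : Database | s ⊆ db ∧ Consistent s}.Finite :=
    (db.powerset.finite_toSet).subset fun s hs => by simpa using hs.1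
  obtain ⟨r, hr⟩ := hfin.exists_maximal ⟨∅, by simp, by intro A hA; simp at hA⟩
  exact ⟨r, hr⟩

open Classical in
/-- The repair `r` with the fact key-equal to `A` replaced by `A`. -/
noncomputable def swapFact (r : Database) (A : DBFact) : Database :=
  insert A (r.filter fun B => ¬ A.KeyEqual B)

theorem mem_swapFact {r : Database} {A B : DBFact} :
    B ∈ swapFact r A ↔ B = A ∨ (B ∈ r ∧ ¬ A.KeyEqual B) := by
  simp [swapFact]

theorem IsRepair.swapFact {db r : Database} (h : IsRepair db r) {A : DBFact} (hA : A ∈ db) :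
    IsRepair db (swapFact r A) := by
  rw [isRepair_iff] at *
  obtain ⟨h1, h2, h3⟩ := h
  refine ⟨fun B hB => ?_, fun C hC D hD e => ?_, fun C hC => ?_⟩
  · rcases mem_swapFact.1 hB with rfl | hB
    exacts [hA, h1 hB.1]
  · rcases mem_swapFact.1 hC with rfl | hC <;> rcases mem_swapFact.1 hD with rfl | hD
    · rfl
    · exact absurd e hD.2
    · exact absurd e.symm hC.2
    · exact h2 C hC.1 D hD.1 e
  · by_cases e : A.KeyEqual C
    · exact ⟨A, mem_swapFact.2 (Or.inl rfl), e.symm⟩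
    · obtain ⟨B, hB, e'⟩ := h3 C hC
      exact ⟨B, mem_swapFact.2 (Or.inr ⟨hB, fun e'' => e (e''.trans e'.symm)⟩), e'⟩

/-! ## Embeddings of lists of atoms and certainty -/

/-- `μ` maps every atom of `l` into `s`. -/
def Embeds (s : Database) (μ : Var → Const) (l : List Atom) : Prop :=
  ∀ F ∈ l, ∃ A ∈ s, Matches A μ F

theorem sat_conj {db : Database} {ν : Var → Const} {l : List Atom} :
    Sat db ν (conj l) ↔ Embeds db ν l := by
  induction l with
  | nil => simp [conj, Sat, Embeds]
  | cons F l ih =>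
    rw [conj, Sat, ih, Sat]
    simp [Embeds, Matches]

theorem Embeds.congr {s : Database} {μ ν : Var → Const} {l : List Atom} (h : Embeds s μ l)
    (e : ∀ x ∈ atomsVars l, μ x = ν x) : Embeds s ν l := by
  intro F hF
  obtain ⟨A, hA, hm⟩ := h F hF
  exact ⟨A, hA, hm.congr fun x hx => e x (mem_atomsVars.2 ⟨F, hF, hx⟩)⟩

/-- Every repair embeds `l` by an assignment that agrees with `ν` on `V`. -/
def Certain (db : Database) (l : List Atom) (V : Set Var) (ν : Var → Const) : Prop :=
  ∀ r, IsRepair db r → ∃ μ, AdmAssign μ ∧ (∀ x ∈ V, μ x = ν x) ∧ Embeds r μ l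

theorem Certain.mono {db : Database} {l l' : List Atom} {V W : Set Var} {ν : Var → Const}
    (h : Certain db l V ν) (hl : ∀ F ∈ l', F ∈ l) (hW : W ⊆ V) : Certain db l' W ν := by
  intro r hr
  obtain ⟨μ, h1, h2, h3⟩ := h r hr
  exact ⟨μ, h1, fun x hx => h2 x (hW hx), fun F hF => h3 F (hl F hF)⟩

theorem Certain.congr {db : Database} {l : List Atom} {V : Set Var} {μ ν : Var → Const}
    (h : Certain db l V ν) (e : ∀ x ∈ V, ν x = μ x) : Certain db l V μ := by
  intro r hr
  obtain ⟨κ, h1, h2, h3⟩ := h r hr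
  exact ⟨κ, h1, fun x hx => (h2 x hx).trans (e x hx), h3⟩

/-! ## Attacks -/

namespace SJFBCQ

/-- Reachability replaces the witnessing lists, so that attacks can be extended by one step and
handled by induction along paths. -/
theorem attacksVar_iff {q : SJFBCQ} {F : Atom} {x : Var} :
    q.AttacksVar F x ↔ ∃ x₁ ∈ F.notKey, x₁ ∉ q.keycl F ∧
      Relation.ReflTransGen (fun y z => q.Cooccur y z ∧ z ∉ q.keycl F) x₁ x := by
  constructor
  · rintro ⟨x₁, w, h1, h2, h3, h4⟩
    refine ⟨x₁, h1, h3 _ (by simp), ?_⟩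
    induction w generalizing x₁ with
    | nil => simp at h2; rw [h2]
    | cons y w ih =>
      rw [List.isChain_cons_cons] at h4
      refine Relation.ReflTransGen.head ⟨h4.1, h3 y (by simp)⟩ ?_
      clear h1
      -- The outer induction hypothesis asks for a start in `F.notKey`, which only the first
      -- variable of the path provides; hence a second induction without that demand.
      have : ∀ (x₁ : Var), (x₁ :: w).getLast (by simp) = x → (∀ y ∈ x₁ :: w, y ∉ q.keycl F) →
          List.IsChain q.Cooccur (x₁ :: w) →
          Relation.ReflTransGen (fun y z => q.Cooccur y z ∧ z ∉ q.keycl F) x₁ x := by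
        clear ih h2 h3 h4
        induction w with
        | nil => intro x₁ h2 _ _; simp at h2; rw [h2]
        | cons y w ih =>
          intro x₁ h2 h3 h4
          rw [List.isChain_cons_cons] at h4
          exact .head ⟨h4.1, h3 y (by simp)⟩
            (ih y (by simpa using h2) (fun z hz => h3 z (List.mem_cons_of_mem _ hz)) h4.2)
      exact this y (by simpa using h2) (fun z hz => h3 z (List.mem_cons_of_mem _ hz)) h4.2
  · rintro ⟨x₁, h1, h2, h3⟩
    suffices ∃ w : List Var, (x₁ :: w).getLast (List.cons_ne_nil x₁ w) = x ∧
        (∀ y ∈ x₁ :: w, y ∉ q.keycl F) ∧ List.IsChain q.Cooccur (x₁ :: w) by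
      obtain ⟨w, hw⟩ := this
      exact ⟨x₁, w, h1, hw⟩
    clear h1
    induction h3 using Relation.ReflTransGen.head_induction_on with
    | refl => exact ⟨[], by simp, by simpa using h2, by simp⟩
    | head hab _ ih =>
      obtain ⟨w, e1, e2, e3⟩ := ih hab.2
      refine ⟨_ :: w, by simpa using e1, ?_, List.isChain_cons_cons.2 ⟨hab.1, e3⟩⟩
      intro y hy
      rcases List.mem_cons.1 hy with rfl | hy
      exacts [h2, e2 y hy]

theorem AttacksVar.notMem_keycl {q : SJFBCQ} {F : Atom} {x : Var} (h : q.AttacksVar F x) :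
    x ∉ q.keycl F := by
  obtain ⟨x₁, w, -, h2, h3, -⟩ := h
  rw [← h2]
  exact h3 _ (List.getLast_mem _)

theorem AttacksVar.step {q : SJFBCQ} {F : Atom} {x y : Var} (h : q.AttacksVar F x)
    (hc : q.Cooccur x y) (hy : y ∉ q.keycl F) : q.AttacksVar F y := by
  rw [attacksVar_iff] at *
  obtain ⟨x₁, h1, h2, h3⟩ := h
  exact ⟨x₁, h1, h2, h3.tail ⟨hc, hy⟩⟩

theorem attacksVar_of_notKey {q : SJFBCQ} {F : Atom} {x : Var} (h : x ∈ F.notKey)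
    (hx : x ∉ q.keycl F) : q.AttacksVar F x :=
  attacksVar_iff.2 ⟨x, h, hx, .refl⟩

theorem mem_vars_of_mem {q : SJFBCQ} {G : Atom} (hG : G ∈ q.atoms) {x : Var} (hx : x ∈ G.vars) :
    x ∈ q.vars := mem_atomsVars.2 ⟨G, hG, hx⟩

theorem key_subset_keycl {q : SJFBCQ} {F : Atom} (hF : F ∈ q.atoms) {x : Var} (hx : x ∈ F.key) :
    x ∈ q.keycl F :=
  ⟨mem_vars_of_mem hF (F.key_subset_vars hx), fun _ _ s hs t ht h y hy => by
    simp only [Finset.mem_singleton] at hy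
    subst hy
    exact h y hx⟩

theorem atoms_nodup (q : SJFBCQ) : q.atoms.Nodup := List.Nodup.of_map _ q.selfJoinFree

theorem eq_of_rel_eq {q : SJFBCQ} {F G : Atom} (hF : F ∈ q.atoms) (hG : G ∈ q.atoms)
    (h : F.rel = G.rel) : F = G :=
  List.inj_on_of_nodup_map q.selfJoinFree hF hG h

/-- If `l` is a set of atoms of `q` such that `V` contains the variables of the other atoms, two
embeddings of `l` without `F` in a consistent set that agree on `V` and on `key F` agree on the
closure of `key F`. -/
theorem agree_on_keycl {q : SJFBCQ} {l : List Atom} {V : Set Var}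
    (hV : ∀ G ∈ q.atoms, G ∉ l → ∀ x ∈ G.vars, x ∈ V) {F : Atom} {s : Database}
    (hs : Consistent s) {α β : Var → Const} (hαβ : ∀ x ∈ V, α x = β x)
    (hα : ∀ G ∈ l, G ≠ F → ∃ A ∈ s, Matches A α G) (hβ : ∀ G ∈ l, G ≠ F → ∃ A ∈ s, Matches A β G)
    (hkey : ∀ x ∈ F.key, α x = β x) : ∀ x ∈ q.keycl F, α x = β x := by
  intro x hx
  have key : ∀ G ∈ q.atoms, G ≠ F → (∀ x ∈ G.key, α x = β x) → ∀ x ∈ G.vars, α x = β x := by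
    intro G hG hGF hk y hy
    by_cases hl : G ∈ l
    · obtain ⟨A, hA, hmA⟩ := hα G hl hGF
      obtain ⟨B, hB, hmB⟩ := hβ G hl hGF
      obtain rfl := hs A hA B hB (hmA.keyEqual hmB hk)
      exact hmA.agree hmB y hy
    -- An atom outside `l` satisfies its dependency trivially, as all its variables lie in `V`.
    · exact hαβ y (hV G hG hl y hy)
  -- Logical implication is applied to the relation consisting of the two tuples `α` and `β`.
  refine hx.2 {α, β} ?_ α (by simp) β (by simp) hkey x (by simp)
  rintro f ⟨G, hG, hGF, rfl⟩ a ha b hb hab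
  rcases ha with rfl | rfl <;> rcases hb with rfl | rfl
  · exact fun _ _ => rfl
  · exact key G hG hGF hab
  · exact fun y hy => (key G hG hGF (fun z hz => (hab z hz).symm) y hy).symm
  · exact fun _ _ => rfl

/-- The exchange lemma. What `β` does on the variables that `F` does not attack can be imitated in
`r` itself. The attacks are those of the whole query even when `l` is only a part of it; this is
legitimate because `α` and `β` agree on the variables of the missing atoms. -/
theorem exists_embeds_of_swapFact {q : SJFBCQ} {l : List Atom} (hl : ∀ G ∈ l, G ∈ q.atoms)
    {V : Set Var} (hV : ∀ G ∈ q.atoms, G ∉ l → ∀ x ∈ G.vars, x ∈ V) {F : Atom} (hF : F ∈ l)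
    {r : Database} (hr : Consistent r) {A B : DBFact} (hAB : A.KeyEqual B)
    {α β : Var → Const} (hα : AdmAssign α) (hβ : AdmAssign β) (hαβ : ∀ x ∈ V, α x = β x)
    (hA : Matches A α F) (hαl : Embeds r α l) (hβl : Embeds (swapFact r B) β l) :
    ∃ γ, AdmAssign γ ∧ (∀ x ∈ V, γ x = α x) ∧ (∀ x, ¬ q.AttacksVar F x → γ x = β x) ∧
      Embeds r γ l := by
  classical
  have hβr : ∀ G ∈ l, G ≠ F → ∃ A ∈ r, Matches A β G := by
    intro G hG hGF
    obtain ⟨C, hC, hm⟩ := hβl G hG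
    rcases mem_swapFact.1 hC with rfl | hC
    · exact absurd (eq_of_rel_eq (hl G hG) (hl F hF) (by rw [← hm.1, ← hAB.1, hA.1])) hGF
    · exact ⟨C, hC.1, hm⟩
  obtain ⟨C, hC, hm⟩ := hβl F hF
  rcases mem_swapFact.1 hC with rfl | hC
  · have hcl := agree_on_keycl hV hr hαβ (F := F) (fun G hG _ => hαl G hG) hβr
      (hA.agree_key hm hAB)
    -- Glue along the closure of `key(F)`, where `α` and `β` agree by `hcl`.
    refine ⟨fun x => if q.AttacksVar F x then α x else β x, ?_, ?_, ?_, ?_⟩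
    · intro x
      dsimp only
      split_ifs
      exacts [hα x, hβ x]
    · intro x hx
      dsimp only
      split_ifs
      exacts [rfl, (hαβ x hx).symm]
    · intro x hx
      simp [hx]
    · intro G hG
      by_cases h : (∃ y ∈ G.vars, q.AttacksVar F y) ∨ G = F
      · obtain ⟨D, hD, hmD⟩ := hαl G hG
        refine ⟨D, hD, hmD.congr fun x hx => ?_⟩
        split_ifs with hxa
        · rfl
        · apply hcl
          by_contra hxc
          rcases h with ⟨y, hy, hya⟩ | rfl
          · exact hxa (hya.step ⟨G, hl G hG, hy, hx⟩ hxc)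
          · by_cases hk : x ∈ G.key
            · exact hxc (key_subset_keycl (hl _ hG) hk)
            · exact hxa (attacksVar_of_notKey (Finset.mem_sdiff.2 ⟨hx, hk⟩) hxc)
      · push Not at h
        obtain ⟨D, hD, hmD⟩ := hβr G hG h.2
        refine ⟨D, hD, hmD.congr fun x hx => ?_⟩
        simp [h.1 x hx]
  -- If `β` does not map `F` to the new fact, it uses facts of `r` only.
  · refine ⟨β, hβ, fun x hx => (hαβ x hx).symm, fun _ _ => rfl, fun G hG => ?_⟩
    by_cases hGF : G = F
    · subst hGF
      exact ⟨C, hC.1, hm⟩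
    · exact hβr G hG hGF

/-- Variables that no atom attacks can be instantiated uniformly over all repairs. -/
theorem exists_certain_of_not_attacksVar {q : SJFBCQ} {l : List Atom} (hl : ∀ G ∈ l, G ∈ q.atoms)
    {V : Set Var} (hV : ∀ G ∈ q.atoms, G ∉ l → ∀ x ∈ G.vars, x ∈ V) {Y : Set Var}
    (hY : ∀ F ∈ l, ∀ x ∈ Y, ¬ q.AttacksVar F x) {db : Database} {ν : Var → Const}
    (h : Certain db l V ν) :
    ∃ μ, AdmAssign μ ∧ (∀ x ∈ V, μ x = ν x) ∧ Certain db l (V ∪ Y) μ := by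
  classical
  -- The assignments whose values on `Y` can be realised in `r` with `V` fixed. There are finitely
  -- many repairs, so one of them has a minimal set, and its values turn out to be realised in every
  -- repair.
  let S : Database → Set (Var → Const) := fun r =>
    {g | AdmAssign g ∧ (∀ x ∈ V, g x = ν x) ∧
      ∃ γ, AdmAssign γ ∧ (∀ x ∈ V, γ x = ν x) ∧ (∀ x ∈ Y, γ x = g x) ∧ Embeds r γ l}
  have hfin : {r : Database | IsRepair db r}.Finite :=
    (db.powerset.finite_toSet).subset fun s hs => by
      simpa using (show IsRepair db s from hs).prop.1
  obtain ⟨r, hr, hmin⟩ := hfin.exists_minimalFor S _ (exists_isRepair db)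
  have main : ∀ k, ∀ r, IsRepair db r → (∀ r', IsRepair db r' → S r' ⊆ S r → S r ⊆ S r') →
      ∀ s, IsRepair db s → (s \ r).card = k → S r ⊆ S s := by
    intro k
    induction k using Nat.strong_induction_on with
    | _ k ih =>
      rintro r hr hmin s hs hk g ⟨hg, hgV, γ, hγ, hγV, hγY, hγl⟩
      by_cases hsl : Embeds s γ l
      · exact ⟨hg, hgV, γ, hγ, hγV, hγY, hsl⟩
      · unfold Embeds at hsl
        push Not at hsl
        obtain ⟨F, hF, hFs⟩ := hsl
        obtain ⟨A, hA, hmA⟩ := hγl F hF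
        have hAs : A ∉ s := fun hAs => hFs A hAs hmA
        rw [isRepair_iff] at hs
        have hrr := hr
        rw [isRepair_iff] at hrr
        obtain ⟨B, hB, hAB⟩ := hs.2.2 A (hrr.1 hA)
        have hBr : B ∉ r := fun hBr => by
          obtain rfl := hrr.2.1 A hA B hBr hAB
          exact hAs hB
        have hr' := hr.swapFact (hs.1 hB)
        -- Exchange: since `F` attacks nothing in `Y`, values realised after the swap were already
        -- realised before it.
        have hsub : S (swapFact r B) ⊆ S r := by
          rintro f ⟨hf, hfV, δ, hδ, hδV, hδY, hδl⟩
          obtain ⟨ε, h1, h2, h3, h4⟩ := exists_embeds_of_swapFact hl hV hF hrr.2.1 hAB hγ hδ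
            (fun x hx => (hγV x hx).trans (hδV x hx).symm) hmA hγl hδl
          exact ⟨hf, hfV, ε, h1, fun x hx => (h2 x hx).trans (hγV x hx),
            fun x hx => (h3 x (hY F hF x hx)).trans (hδY x hx), h4⟩
        have hsup := hmin _ hr' hsub
        have hcard : (s \ swapFact r B).card < k := by
          rw [← hk]
          refine Finset.card_lt_card ⟨fun C hC => ?_, fun hss => ?_⟩
          · rw [Finset.mem_sdiff] at *
            refine ⟨hC.1, fun hCr => hC.2 (mem_swapFact.2 (Or.inr ⟨hCr, fun e => ?_⟩))⟩
            obtain rfl := hs.2.1 B hB C hC.1 e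
            exact hBr hCr
          · have := hss (Finset.mem_sdiff.2 ⟨hB, hBr⟩)
            exact (Finset.mem_sdiff.1 this).2 (mem_swapFact.2 (Or.inl rfl))
        -- The swapped repair is closer to `s`, and it is again minimal, because minimality of `r`
        -- turns the inclusion into an equality.
        exact ih _ hcard _ hr'
          (fun r'' hr'' h'' => hsub.trans (hmin r'' hr'' (h''.trans hsub))) s
          (isRepair_iff.2 hs) rfl (hsup ⟨hg, hgV, γ, hγ, hγV, hγY, hγl⟩)
  obtain ⟨μ, h1, h2, h3⟩ := h r hr
  refine ⟨μ, h1, h2, fun s hs => ?_⟩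
  obtain ⟨-, -, γ, e1, e2, e3, e4⟩ := main _ r hr (fun r' hr' h' => hmin hr' h') s hs rfl
    ⟨h1, h2, μ, h1, h2, fun _ _ => rfl, h3⟩
  refine ⟨γ, e1, ?_, e4⟩
  rintro x (hx | hx)
  exacts [(e2 x hx).trans (h2 x hx).symm, e3 x hx]

end SJFBCQ

/-! ## Removing an atom whose image is known -/

/-- Put the image `A` of `G` into the given repair. With the key of `G` fixed, an embedding must
then map `G` to `A`, which fixes all of `G.vars`; the other atoms have other relation names and do
not notice the swap. -/
theorem Certain.of_cons {q : SJFBCQ} {G : Atom} {l : List Atom}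
    (hl : ∀ F ∈ G :: l, F ∈ q.atoms) (hGl : G ∉ l) {W : Set Var} {db : Database}
    {ν : Var → Const} (hG : ∃ A ∈ db, Matches A ν G) (h : Certain db (G :: l) (W ∪ ↑G.key) ν) :
    Certain db l (W ∪ ↑G.vars) ν := by
  intro r hr
  obtain ⟨A, hA, hmA⟩ := hG
  obtain ⟨μ, h1, h2, h3⟩ := h _ (hr.swapFact hA)
  obtain ⟨B, hB, hmB⟩ := h3 G (by simp)
  have e : A.KeyEqual B := hmA.keyEqual hmB fun x hx => (h2 x (Or.inr hx)).symm
  obtain rfl : B = A := by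
    rcases mem_swapFact.1 hB with h | h
    exacts [h, absurd e h.2]
  refine ⟨μ, h1, ?_, fun F hF => ?_⟩
  · rintro x (hx | hx)
    exacts [h2 x (Or.inl hx), hmB.agree hmA x hx]
  · obtain ⟨C, hC, hmC⟩ := h3 F (by simp [hF])
    rcases mem_swapFact.1 hC with rfl | hC
    · have := SJFBCQ.eq_of_rel_eq (hl F (by simp [hF])) (hl G (by simp)) (hmC.1.symm.trans hmA.1)
      exact absurd (this ▸ hF) hGl
    · exact ⟨C, hC.1, hmC⟩

/-- The values on `Y` are known to be possible only when the block of `F` contributes the fact `A`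
chosen by `ν`. As `F` does not attack `Y`, the exchange lemma carries them over to repairs that
choose another fact of the block. -/
theorem Certain.cons {q : SJFBCQ} {F : Atom} {l : List Atom} (hl : ∀ G ∈ F :: l, G ∈ q.atoms)
    {V : Set Var} (hV : ∀ G ∈ q.atoms, G ∉ F :: l → ∀ x ∈ G.vars, x ∈ V) {Y : Set Var}
    (hY : ∀ x ∈ Y, ¬ q.AttacksVar F x) {db : Database} {ν : Var → Const}
    (hF : ∃ A ∈ db, Matches A ν F) (h : Certain db (F :: l) (V ∪ ↑F.key) ν)
    (h' : Certain db l (V ∪ ↑F.vars ∪ Y) ν) : Certain db (F :: l) (V ∪ ↑F.key ∪ Y) ν := by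
  intro r hr
  obtain ⟨A, hA, hmA⟩ := hF
  obtain ⟨α, h1, h2, h3⟩ := h r hr
  obtain ⟨β, e1, e2, e3⟩ := h' _ (hr.swapFact hA)
  obtain ⟨B, hB, hmB⟩ := h3 F (by simp)
  have hβF : Matches A β F :=
    hmA.congr fun x hx => (e2 x (Or.inl (Or.inr hx))).symm
  have hβl : Embeds (swapFact r A) β (F :: l) := by
    intro G hG
    rcases List.mem_cons.1 hG with rfl | hG
    · exact ⟨A, mem_swapFact.2 (Or.inl rfl), hβF⟩
    · exact e3 G hG
  have hBA : B.KeyEqual A := hmB.keyEqual hmA fun x hx => h2 x (Or.inr hx)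
  have hk : ∀ x ∈ F.key, ¬ q.AttacksVar F x := fun x hx ha =>
    ha.notMem_keycl (SJFBCQ.key_subset_keycl (hl F (by simp)) hx)
  obtain ⟨γ, g1, g2, g3, g4⟩ := SJFBCQ.exists_embeds_of_swapFact hl hV (by simp)
    hr.prop.2 hBA h1 e1 (fun x hx => (h2 x (Or.inl hx)).trans
      (e2 x (Or.inl (Or.inl hx))).symm) hmB h3 hβl
  refine ⟨γ, g1, ?_, g4⟩
  rintro x ((hx | hx) | hx)
  · exact (g2 x hx).trans (h2 x (Or.inl hx))
  · exact (g3 x (hk x hx)).trans (e2 x (Or.inl (Or.inr (F.key_subset_vars hx))))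
  · exact (g3 x (hY x hx)).trans (e2 x (Or.inr hx))

/-! ## The certainty conditions of ∀embeddings, and their independence of the order -/

/-- The certainty conditions along `l`, where the variables in `V` have been fixed before. -/
def CertainAlong (db : Database) (ν : Var → Const) : List Atom → Set Var → Prop
  | [], _ => True
  | F :: l, V => Certain db (F :: l) (V ∪ ↑F.key) ν ∧ CertainAlong db ν l (V ∪ ↑F.vars)

/-- An unattacked atom `G` is brought to the front by passing one predecessor `F` at a time. Both
conditions for the order `G, F` follow from a single statement, in which the keys of `F` and `G` are
fixed together. -/
theorem CertainAlong.move_front {q : SJFBCQ} {db : Database} {ν : Var → Const} {G : Atom} :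
    ∀ {l : List Atom} {V : Set Var}, (∀ F ∈ l, F ∈ q.atoms) → l.Nodup →
      (∀ F ∈ q.atoms, F ∉ l → ∀ x ∈ F.vars, x ∈ V) → Embeds db ν l → G ∈ l →
      (∀ F ∈ l, ¬ q.Attacks F G) → CertainAlong db ν l V → CertainAlong db ν (G :: l.erase G) V
  | [], _, _, _, _, _, hG, _, _ => by simp at hG
  | F :: l, V, hl, hnd, hV, hemb, hG, hatt, h => by
    by_cases hFG : F = G
    · subst hFG
      simpa using h
    have hGl : G ∈ l := by
      rcases List.mem_cons.1 hG with h | h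
      exacts [absurd h.symm hFG, h]
    rw [List.nodup_cons] at hnd
    have hV' : ∀ H ∈ q.atoms, H ∉ l → ∀ x ∈ H.vars, x ∈ V ∪ (F.vars : Set Var) := by
      intro H hH hHl x hx
      by_cases e : H = F
      · subst e
        exact Or.inr hx
      · exact Or.inl (hV H hH (by simp [e, hHl]) x hx)
    have ih := CertainAlong.move_front (fun H hH => hl H (by simp [hH])) hnd.2 hV'
      (fun H hH => hemb H (by simp [hH])) hGl (fun H hH => hatt H (by simp [hH])) h.2
    obtain ⟨ih1, ih2⟩ := ih
    have hp : (G :: l.erase G).Perm l := (List.perm_cons_erase hGl).symm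
    have hna : ∀ x ∈ (G.key : Set Var), ¬ q.AttacksVar F x := fun x hx ha =>
      hatt F (by simp) ⟨hl F (by simp), hl G hG, hFG, x, G.key_subset_vars hx, ha⟩
    -- The induction hypothesis fixes the key of `G` after `F`; since `F` does not attack that key,
    -- it can be fixed before `F` as well.
    have c1 : Certain db (F :: l) (V ∪ ↑F.key ∪ ↑G.key) ν :=
      Certain.cons hl hV hna (hemb F (by simp)) h.1
        (ih1.mono (fun H hH => hp.mem_iff.2 hH) subset_rfl)
    have herase : (F :: l).erase G = F :: l.erase G := by
      rw [List.erase_cons_tail (by simpa using hFG)]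
    rw [herase]
    have hperm : (G :: F :: l.erase G).Perm (F :: l) :=
      (List.Perm.swap _ _ _).trans (hp.cons F)
    refine ⟨c1.mono (fun H hH => hperm.mem_iff.1 hH) ?_, ?_, ?_⟩
    · rintro x (hx | hx)
      exacts [Or.inl (Or.inl hx), Or.inr hx]
    · have hnd' : (G :: F :: l.erase G).Nodup := hperm.nodup_iff.2 (List.nodup_cons.2 hnd)
      have := Certain.of_cons (q := q) (G := G) (l := F :: l.erase G) (W := V ∪ ↑F.key)
        (fun H hH => hl H (hperm.mem_iff.1 hH)) (List.nodup_cons.1 hnd').1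
        (hemb G hG) (c1.mono (fun H hH => hperm.mem_iff.1 hH) subset_rfl)
      refine this.mono (fun _ h => h) ?_
      rintro x ((hx | hx) | hx)
      exacts [Or.inl (Or.inl hx), Or.inr hx, Or.inl (Or.inr hx)]
    · rwa [Set.union_right_comm]

/-- Selection sort: nothing in `l` attacks the head of `l'`, so it moves to the front, and the tails
are compared recursively with the variables of the head added to `V`. -/
theorem CertainAlong.of_perm {q : SJFBCQ} {db : Database} {ν : Var → Const} :
    ∀ {l' l : List Atom} {V : Set Var}, l'.Perm l → (∀ F ∈ l, F ∈ q.atoms) → l.Nodup →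
      (∀ F ∈ q.atoms, F ∉ l → ∀ x ∈ F.vars, x ∈ V) → Embeds db ν l →
      l'.Pairwise (fun F G => ¬ q.Attacks G F) → CertainAlong db ν l V → CertainAlong db ν l' V
  | [], _, _, _, _, _, _, _, _, _ => trivial
  | G :: l', l, V, hp, hl, hnd, hV, hemb, hpw, h => by
    have hG : G ∈ l := hp.mem_iff.1 (by simp)
    have hatt : ∀ F ∈ l, ¬ q.Attacks F G := by
      intro F hF ha
      rcases List.mem_cons.1 (hp.mem_iff.2 hF) with rfl | hF'
      · exact ha.2.2.1 rfl
      · exact (List.pairwise_cons.1 hpw).1 F hF' ha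
    obtain ⟨h1, h2⟩ := h.move_front hl hnd hV hemb hG hatt
    have hp' : l'.Perm (l.erase G) := by
      have := hp.erase G
      simpa using this
    refine ⟨h1.mono (fun F hF => ?_) subset_rfl, ?_⟩
    · exact ((List.Perm.cons G hp').mem_iff).1 hF
    · refine CertainAlong.of_perm hp' (fun F hF => hl F (List.mem_of_mem_erase hF))
        (hnd.erase G) ?_ (fun F hF => hemb F (List.mem_of_mem_erase hF))
        (List.pairwise_cons.1 hpw).2 h2
      intro F hF hFl x hx
      by_cases e : F = G
      · subst e
        exact Or.inr hx
      · refine Or.inl (hV F hF (fun hFl' => hFl ?_) x hx)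
        exact (List.mem_erase_of_ne e).2 hFl'

/-! ## ∀embeddings in terms of assignments -/

theorem Valuation.modelsCqa_iff {db : Database} {θ : Valuation} {l : List Atom} {ν : Var → Const}
    {V : Set Var} (hV : ∀ x, x ∈ θ.dom ↔ x ∈ V) (hν : ∀ x, ν x.1 = θ.val x) :
    ModelsCqa db θ (conj l) ↔ Certain db l V ν := by
  refine forall₂_congr fun r _ => exists_congr fun μ => and_congr Iff.rfl ?_
  rw [sat_conj]
  refine and_congr ⟨fun h x hx => ?_, fun h x => ?_⟩ Iff.rfl
  · rw [h ⟨x, (hV x).2 hx⟩, ← hν ⟨x, (hV x).2 hx⟩]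
  · rw [h _ ((hV _).1 x.2), hν]

theorem certainAlong_iff {db : Database} {ν : Var → Const} : ∀ {l : List Atom} {V : Set Var},
    CertainAlong db ν l V ↔ ∀ k, k < l.length →
      Certain db (l.drop k) (V ∪ ↑(uVars l k ∪ xVars l k)) ν
  | [], V => by simp [CertainAlong]
  | F :: l, V => by
    rw [CertainAlong, certainAlong_iff]
    have h0 : (V ∪ ↑(uVars (F :: l) 0 ∪ xVars (F :: l) 0) : Set Var) = V ∪ ↑F.key := by
      simp [uVars, xVars, atomsVars]
    have hs : ∀ k, (V ∪ ↑(uVars (F :: l) (k + 1) ∪ xVars (F :: l) (k + 1)) : Set Var)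
        = V ∪ ↑F.vars ∪ ↑(uVars l k ∪ xVars l k) := by
      intro k
      have e : uVars (F :: l) (k + 1) = F.vars ∪ uVars l k := by
        simp [uVars, atomsVars_cons]
      have e' : uVars (F :: l) (k + 1) ∪ xVars (F :: l) (k + 1)
          = F.vars ∪ (uVars l k ∪ xVars l k) := by
        rw [e]
        unfold xVars
        rw [List.getElem?_cons_succ]
        cases l[k]? with
        | none => simp
        | some G =>
          ext x
          simp only [Finset.mem_union, Finset.mem_sdiff, e]
          tauto
      rw [e', Finset.coe_union, Set.union_assoc]
    constructor
    · rintro ⟨h1, h2⟩ k hk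
      cases k with
      | zero => rw [h0]; exact h1
      | succ k => rw [hs]; exact h2 k (by simpa using hk)
    · intro h
      refine ⟨?_, fun k hk => ?_⟩
      · have := h 0 (by simp)
        rwa [h0] at this
      · have := h (k + 1) (by simpa using hk)
        rwa [hs] at this

theorem uVars_subset_succ (l : List Atom) (k : ℕ) : uVars l k ⊆ uVars l (k + 1) := by
  intro x hx
  obtain ⟨F, hF, h⟩ := mem_atomsVars.1 hx
  exact mem_atomsVars.2 ⟨F, List.take_subset_take_left l (Nat.le_succ k) hF, h⟩

theorem xVars_subset (l : List Atom) (k : ℕ) : xVars l k ⊆ uVars l (k + 1) := by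
  unfold xVars
  cases h : l[k]? with
  | none => simp
  | some F =>
    intro x hx
    refine mem_atomsVars.2 ⟨F, ?_, F.key_subset_vars (Finset.mem_sdiff.1 hx).1⟩
    rw [List.mem_iff_getElem?]
    exact ⟨k, by rw [List.getElem?_take]; simpa using h⟩

/-- Unfolds the recursion on levels. When `ν` embeds all atoms, the embedding requirements at the
intermediate levels hold by themselves, and only the certainty conditions remain; the summand with
`∅` comes from level `0`. -/
theorem isLForallEmbedding_iff {l : List Atom} {db : Database} {ν : Var → Const}
    (hadm : AdmAssign ν) (hemb : Embeds db ν l) : ∀ {k : ℕ} {θ : Valuation},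
    θ.dom = uVars l k → (∀ x, ν x.1 = θ.val x) →
    (IsLForallEmbedding l db k θ ↔ Certain db l ∅ ν ∧
      ∀ j, j < k → Certain db (l.drop j) ↑(uVars l j ∪ xVars l j) ν)
  | 0, θ, hdom, hν => by
    have h : θ.dom = ∅ := by simpa [uVars, atomsVars] using hdom
    rw [IsLForallEmbedding, Valuation.modelsCqa_iff (V := ∅) (ν := ν) (by simp [Valuation.empty])]
    · simp [IsLEmbedding, h]
    · rintro ⟨x, hx⟩
      simp [Valuation.empty] at hx
  | k + 1, θ, hdom, hν => by
    have hsub := uVars_subset_succ l k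
    have hsub' : uVars l k ∪ xVars l k ⊆ uVars l (k + 1) :=
      Finset.union_subset hsub (xVars_subset l k)
    rw [IsLForallEmbedding, isLForallEmbedding_iff hadm hemb (θ := θ.restrict (uVars l k))
      (by simp [Valuation.restrict, hdom, hsub]) (fun x => hν ⟨x.1, _⟩),
      Valuation.modelsCqa_iff (θ := θ.restrict (uVars l k ∪ xVars l k))
        (V := ↑(uVars l k ∪ xVars l k)) (ν := ν) _ (fun x => hν ⟨x.1, _⟩)]
    · constructor
      · rintro ⟨-, h1, h2, h3⟩
        refine ⟨h2, fun j hj => ?_⟩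
        rcases Nat.lt_succ_iff_lt_or_eq.1 hj with h | rfl
        exacts [h3 j h, h1]
      · rintro ⟨h1, h2⟩
        exact ⟨⟨hdom, ν, hadm, hν, sat_conj.2 hemb⟩, h2 k (by simp), h1,
          fun j hj => h2 j (by omega)⟩
    · intro x
      simp only [Valuation.restrict, hdom, Finset.inter_eq_right.2 hsub', Finset.mem_coe]

theorem isForallEmbedding_iff {l : List Atom} {db : Database} {θ : Valuation}
    (hdom : θ.dom = atomsVars l) {ν : Var → Const} (hadm : AdmAssign ν)
    (hν : ∀ x, ν x.1 = θ.val x) :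
    IsForallEmbedding l db θ ↔ Embeds db ν l ∧ CertainAlong db ν l ∅ := by
  have hu : θ.dom = uVars l l.length := by simp [uVars, hdom]
  constructor
  · intro h
    have hemb : Embeds db ν l := by
      cases hl : l with
      | nil => simp [Embeds]
      | cons F l' =>
        have : ∃ k, l.length = k + 1 := ⟨l'.length, by simp [hl]⟩
        obtain ⟨k, hk⟩ := this
        rw [← hl]
        rw [IsForallEmbedding, hk] at h
        obtain ⟨μ, -, h2, h3⟩ := h.1.2
        refine (sat_conj.1 h3).congr fun x hx => ?_
        rw [h2 ⟨x, hdom ▸ hx⟩, ← hν]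
    refine ⟨hemb, certainAlong_iff.2 fun k hk => ?_⟩
    rw [Set.empty_union]
    exact ((isLForallEmbedding_iff hadm hemb hu hν).1 h).2 k hk
  · rintro ⟨hemb, h⟩
    refine (isLForallEmbedding_iff hadm hemb hu hν).2 ⟨?_, fun k hk => ?_⟩
    -- The level-`0` condition is redundant: it is trivial for the empty query and otherwise weaker
    -- than the first certainty condition.
    · cases l with
      | nil => exact fun r _ => ⟨ν, hadm, fun _ _ => rfl, by simp [Embeds]⟩
      | cons F l => exact h.1.mono (fun _ h => h) (Set.empty_subset _)
    · have := certainAlong_iff.1 h k hk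
      rwa [Set.empty_union] at this

/-! ## The rewriting -/

/-- Fresh variables for columns with the given flags. -/
def freshVars : ℕ → List Bool → List Var
  | _, [] => []
  | m, b :: bs => ⟨b, m⟩ :: freshVars (m + 1) bs

theorem freshVars_length : ∀ (m : ℕ) (bs : List Bool), (freshVars m bs).length = bs.length
  | _, [] => rfl
  | m, _ :: bs => by simp [freshVars, freshVars_length (m + 1) bs]

theorem le_of_mem_freshVars {x : Var} : ∀ {m : ℕ} {bs : List Bool}, x ∈ freshVars m bs → m ≤ x.idx
  | _, [], h => by simp [freshVars] at h
  | m, b :: bs, h => by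
    rcases List.mem_cons.1 h with rfl | h
    · exact le_rfl
    · exact (Nat.le_succ m).trans (le_of_mem_freshVars h)

theorem forall₂_freshVars : ∀ (m : ℕ) (bs : List Bool),
    List.Forall₂ (fun b t => b = true → t.IsNumerical) bs ((freshVars m bs).map Term.var)
  | _, [] => .nil
  | m, _ :: bs => .cons id (forall₂_freshVars (m + 1) bs)

/-- Fresh variables copy the flags of the columns, so any well-formed tuple of values is admissible
for them; increasing indices keep them distinct. -/
theorem exists_assign_freshVars {ν : Var → Const} (hν : AdmAssign ν) :
    ∀ (m : ℕ) {bs : List Bool} {cs : List Const},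
    List.Forall₂ (fun b c => b = true → Const.IsNumber c) bs cs →
    ∃ μ, AdmAssign μ ∧ (∀ x, x ∉ freshVars m bs → μ x = ν x) ∧ (freshVars m bs).map μ = cs
  | _, [], [], .nil => ⟨ν, hν, fun _ _ => rfl, rfl⟩
  | m, b :: bs, c :: cs, .cons h hs => by
    obtain ⟨μ, h1, h2, h3⟩ := exists_assign_freshVars hν (m + 1) hs
    refine ⟨Function.update μ ⟨b, m⟩ c, h1.update h, fun x hx => ?_, ?_⟩
    · rw [freshVars, List.mem_cons, not_or] at hx
      rw [Function.update_of_ne hx.1, h2 x hx.2]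
    · rw [freshVars, List.map_cons, Function.update_self]
      congr 1
      rw [← h3]
      refine List.map_congr_left fun x hx => Function.update_of_ne ?_ _ _
      rintro rfl
      exact absurd (le_of_mem_freshVars hx) (by simp)

/-- The variables of a list of terms that are not in `V`, in the order of their first occurrence. -/
def newVars : Finset Var → List Term → List Var
  | _, [] => []
  | V, .var x :: l => if x ∈ V then newVars V l else x :: newVars (insert x V) l
  | V, .const _ :: l => newVars V l

theorem mem_newVars {x : Var} : ∀ {V : Finset Var} {l : List Term},
    x ∈ newVars V l ↔ x ∈ varsOf l ∧ x ∉ V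
  | V, [] => by simp [newVars, varsOf]
  | V, .const c :: l => by
    rw [newVars, mem_newVars]
    simp [varsOf, Term.vars]
  | V, .var y :: l => by
    have e : varsOf (.var y :: l) = insert y (varsOf l) := by
      simp [varsOf, Term.vars]
    rw [newVars, e]
    split_ifs with h
    · rw [mem_newVars, Finset.mem_insert]
      constructor
      · tauto
      · rintro ⟨rfl | h', h''⟩
        exacts [absurd h h'', ⟨h', h''⟩]
    · rw [List.mem_cons, mem_newVars, Finset.mem_insert, Finset.mem_insert]
      by_cases hxy : x = y
      · subst hxy
        simp [h]
      · simp [hxy]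

def exs : List Var → Formula → Formula
  | [], φ => φ
  | x :: l, φ => .ex x (exs l φ)

def alls : List Var → Formula → Formula
  | [], φ => φ
  | x :: l, φ => .all x (alls l φ)

/-- The equalities of corresponding entries, in conjunction with `φ`. -/
def eqs : List Var → List Term → Formula → Formula
  | z :: zs, t :: ts, φ => .and (.eq (.var z) t) (eqs zs ts φ)
  | _, _, φ => φ

theorem sat_exs {db : Database} {φ : Formula} : ∀ {l : List Var} {ν : Var → Const},
    AdmAssign ν → (Sat db ν (exs l φ) ↔
      ∃ μ, AdmAssign μ ∧ (∀ x, x ∉ l → μ x = ν x) ∧ Sat db μ φ)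
  | [], ν, hν => by
    refine ⟨fun h => ⟨ν, hν, fun _ _ => rfl, h⟩, ?_⟩
    rintro ⟨μ, -, h2, h3⟩
    obtain rfl : μ = ν := funext fun x => h2 x (by simp)
    exact h3
  | y :: l, ν, hν => by
    rw [exs, Sat]
    constructor
    · rintro ⟨c, hc, h⟩
      obtain ⟨μ, h1, h2, h3⟩ := (sat_exs (hν.update hc)).1 h
      refine ⟨μ, h1, fun x hx => ?_, h3⟩
      rw [List.mem_cons, not_or] at hx
      rw [h2 x hx.2, Function.update_of_ne hx.1]
    · rintro ⟨μ, h1, h2, h3⟩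
      refine ⟨μ y, h1 y, (sat_exs (hν.update (h1 y))).2 ⟨μ, h1, fun x hx => ?_, h3⟩⟩
      by_cases hxy : x = y
      · subst hxy
        simp
      · rw [Function.update_of_ne hxy, h2 x (by simp [hxy, hx])]

theorem sat_alls {db : Database} {φ : Formula} : ∀ {l : List Var} {ν : Var → Const},
    AdmAssign ν → (Sat db ν (alls l φ) ↔
      ∀ μ, AdmAssign μ → (∀ x, x ∉ l → μ x = ν x) → Sat db μ φ)
  | [], ν, hν => by
    refine ⟨fun h μ _ h2 => ?_, fun h => h ν hν fun _ _ => rfl⟩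
    obtain rfl : μ = ν := funext fun x => h2 x (by simp)
    exact h
  | y :: l, ν, hν => by
    rw [alls, Sat]
    constructor
    · intro h μ h1 h2
      refine (sat_alls (hν.update (h1 y))).1 (h (μ y) (h1 y)) μ h1 fun x hx => ?_
      by_cases hxy : x = y
      · subst hxy
        simp
      · rw [Function.update_of_ne hxy, h2 x (by simp [hxy, hx])]
    · intro h c hc
      refine (sat_alls (hν.update hc)).2 fun μ h1 h2 => h μ h1 fun x hx => ?_
      rw [List.mem_cons, not_or] at hx
      rw [h2 x hx.2, Function.update_of_ne hx.1]

theorem sat_eqs {db : Database} {φ : Formula} {ν : Var → Const} :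
    ∀ {zs : List Var} {ts : List Term}, zs.length = ts.length →
    (Sat db ν (eqs zs ts φ) ↔ zs.map ν = ts.map (Term.eval ν) ∧ Sat db ν φ)
  | [], [], _ => by simp [eqs]
  | z :: zs, t :: ts, h => by
    rw [eqs, Sat, Sat, sat_eqs (by simpa using h)]
    simp [Term.eval, and_assoc]

/-- The atom `F` with fresh variables outside the primary key. -/
def blockAtom (m : ℕ) (F : Atom) : Atom where
  rel := F.rel
  args := F.args.take F.rel.keyLen ++
    (freshVars (m + F.rel.keyLen) (F.rel.cols.drop F.rel.keyLen)).map Term.var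
  wf := by
    have h : List.Forall₂ (fun b t => b = true → t.IsNumerical)
        (F.rel.cols.take F.rel.keyLen ++ F.rel.cols.drop F.rel.keyLen)
        (F.args.take F.rel.keyLen ++
          (freshVars (m + F.rel.keyLen) (F.rel.cols.drop F.rel.keyLen)).map Term.var) :=
      List.rel_append (List.forall₂_take _ F.wf) (forall₂_freshVars _ _)
    rwa [List.take_append_drop] at h

/-- The formula `F ∧ ∀ z (R(s, z) → ∃ w (z = t ∧ χ))`, where `F = R(s, t)` and `w` are the variables
of `t` outside `V` and `s`. -/
def blockFormula (m : ℕ) (V : Finset Var) (F : Atom) (χ : Formula) : Formula :=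
  .and (.rel F)
    (alls (freshVars (m + F.rel.keyLen) (F.rel.cols.drop F.rel.keyLen))
      (.imp (.rel (blockAtom m F))
        (exs (newVars (V ∪ F.key) (F.args.drop F.rel.keyLen))
          (eqs (freshVars (m + F.rel.keyLen) (F.rel.cols.drop F.rel.keyLen))
            (F.args.drop F.rel.keyLen) χ))))

/-- The rewriting of "`l` is certain" with free variables in `V`. -/
def certainFormula (m : ℕ) : Finset Var → List Atom → Formula
  | _, [] => .tru
  | V, F :: l => exs (newVars V F.args) (blockFormula m V F (certainFormula m (V ∪ F.vars) l))

/-- The conjunction of the certainty conditions along `l`. -/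
def alongFormula (m : ℕ) : Finset Var → List Atom → Formula
  | _, [] => .tru
  | V, F :: l => .and (blockFormula m V F (certainFormula m (V ∪ F.vars) l))
      (alongFormula m (V ∪ F.vars) l)

theorem Atom.args_length (F : Atom) : F.args.length = F.rel.cols.length := F.wf.length_eq.symm

theorem Atom.vars_eq (F : Atom) : ∀ x, x ∈ F.vars ↔
    x ∈ F.key ∨ x ∈ varsOf (F.args.drop F.rel.keyLen) := by
  intro x
  unfold Atom.vars Atom.key
  simp only [mem_varsOf]
  conv_lhs => rw [← List.take_append_drop F.rel.keyLen F.args]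
  simp only [List.mem_append, or_and_right, exists_or]

/-! ### Semantic correctness of the rewriting. -/

/-- A repair may choose any fact of the block given by the key of `F`, so certainty means that each
fact of the block matches `F`, compatibly with `V`, and that the other atoms are certain after this
choice. The fresh variables may be reused by nested blocks: `χ` is equivalent to a condition on the
values of `V ∪ F.vars` only, and fresh indices start above those of `q`. -/
theorem sat_blockFormula {q : SJFBCQ} {F : Atom} {l : List Atom}
    (hl : ∀ G ∈ F :: l, G ∈ q.atoms) (hFl : F ∉ l) {m : ℕ} (hm : ∀ x ∈ q.vars, x.idx < m)
    {V : Finset Var} (hV : V ⊆ q.vars) {db : Database} {χ : Formula}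
    (hχ : ∀ ν, AdmAssign ν → (Sat db ν χ ↔ Certain db l ↑(V ∪ F.vars) ν)) {ν : Var → Const}
    (hν : AdmAssign ν) :
    Sat db ν (blockFormula m V F χ) ↔
      (∃ A ∈ db, Matches A ν F) ∧ Certain db (F :: l) (↑V ∪ ↑F.key) ν := by
  set zs := freshVars (m + F.rel.keyLen) (F.rel.cols.drop F.rel.keyLen) with hzs
  have hFq := hl F (by simp)
  have hzF : ∀ x ∈ F.vars, x ∉ zs := fun x hx hxz => by
    have := le_of_mem_freshVars hxz
    have := hm x (SJFBCQ.mem_vars_of_mem hFq hx)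
    omega
  have hzV : ∀ x ∈ V, x ∉ zs := fun x hx hxz => by
    have := le_of_mem_freshVars hxz
    have := hm x (hV hx)
    omega
  have hlen : zs.length = (F.args.drop F.rel.keyLen).length := by
    rw [hzs, freshVars_length, List.length_drop, List.length_drop, F.args_length]
  rw [blockFormula, Sat, Sat, ← hzs, sat_alls hν]
  constructor
  · rintro ⟨hF, h⟩
    refine ⟨hF, fun r hr => ?_⟩
    obtain ⟨A, hA, hmA⟩ := hF
    have hrr := isRepair_iff.1 hr
    -- `B` is the choice of `r` in the block; the universal quantifiers will be instantiated with
    -- its non-key values.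
    obtain ⟨B, hB, hAB⟩ := hrr.2.2 A hA
    have hBF : B.rel = F.rel := hAB.1.symm.trans hmA.1
    have hBwf : List.Forall₂ (fun b c => b = true → Const.IsNumber c)
        (F.rel.cols.drop F.rel.keyLen) (B.args.drop F.rel.keyLen) :=
      List.forall₂_drop _ (hBF ▸ B.wf)
    obtain ⟨μ, h1, h2, h3⟩ := exists_assign_freshVars hν (m + F.rel.keyLen) hBwf
    have hBμ : B.args.take F.rel.keyLen = (F.args.take F.rel.keyLen).map (Term.eval μ) := by
      have e := hAB.2
      rw [hmA.1, hBF, hmA.2, ← List.map_take] at e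
      rw [← e]
      exact (map_eval_congr fun x hx => h2 x (hzF x (F.key_subset_vars hx))).symm
    obtain ⟨κ, k1, k2, k3⟩ := (sat_exs h1).1 (h μ h1 h2 ⟨B, hrr.1 hB, hBF, by
      rw [← List.take_append_drop F.rel.keyLen B.args, hBμ]
      simp only [blockAtom, List.map_append, List.map_map]
      congr 1
      rw [← h3]
      rfl⟩)
    rw [sat_eqs hlen] at k3
    have hκμ : ∀ x, x ∈ V ∪ F.key ∨ x ∈ zs → κ x = μ x := by
      intro x hx
      refine k2 x fun hn => ?_
      rw [mem_newVars] at hn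
      rcases hx with hx | hx
      · exact hn.2 hx
      · exact hzF x ((F.vars_eq x).2 (Or.inr hn.1)) hx
    have hκν : ∀ x, x ∈ V ∪ F.key → κ x = ν x := by
      intro x hx
      rw [hκμ x (Or.inl hx)]
      refine h2 x ?_
      rcases Finset.mem_union.1 hx with hx | hx
      exacts [hzV x hx, hzF x (F.key_subset_vars hx)]
    have hBκ : Matches B κ F := by
      refine ⟨hBF, ?_⟩
      conv_lhs => rw [← List.take_append_drop F.rel.keyLen B.args, hBμ]
      conv_rhs => rw [← List.take_append_drop F.rel.keyLen F.args, List.map_append]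
      congr 1
      · exact map_eval_congr fun x hx => (hκμ x (Or.inl (Finset.mem_union_right _ hx))).symm
      · rw [← k3.1, ← h3]
        exact List.map_congr_left fun x hx => (hκμ x (Or.inr hx)).symm
    obtain ⟨δ, d1, d2, d3⟩ := (hχ κ k1).1 k3.2 r hr
    refine ⟨δ, d1, ?_, fun G hG => ?_⟩
    · intro x hx
      have hx' : x ∈ V ∪ F.key := by simpa using hx
      rw [← hκν x hx']
      exact d2 x (Finset.union_subset_union_right F.key_subset_vars hx')
    · rcases List.mem_cons.1 hG with rfl | hG
      · exact ⟨B, hB, hBκ.congr fun x hx => (d2 x (Finset.mem_union_right _ hx)).symm⟩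
      · exact d3 G hG
  · rintro ⟨hF, h⟩
    refine ⟨hF, fun μ hμ hμν hA => ?_⟩
    obtain ⟨A₀, hA₀, hmA₀⟩ := hF
    obtain ⟨A, hA, hAF, hAargs⟩ := hA
    simp only [blockAtom, List.map_append, List.map_map] at hAF hAargs
    have hlen' : ((F.args.take F.rel.keyLen).map (Term.eval μ)).length = F.rel.keyLen := by
      rw [List.length_map, List.length_take, F.args_length]
      exact min_eq_left F.rel.keyLen_le
    have hAtake : A.args.take F.rel.keyLen = (F.args.take F.rel.keyLen).map (Term.eval μ) := by
      rw [hAargs]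
      exact List.take_left' hlen'
    have hAdrop : A.args.drop F.rel.keyLen = zs.map μ := by
      rw [hAargs]
      exact List.drop_left' hlen'
    obtain ⟨r, hr⟩ := exists_isRepair db
    -- A repair that chooses the given fact `A` of the block; certainty in it forces `A` to match
    -- `F`.
    have hr := hr.swapFact hA
    obtain ⟨κ₀, k1, k2, k3⟩ := h _ hr
    obtain ⟨C, hC, hmC⟩ := k3 F (by simp)
    have hkey : ∀ x ∈ F.key, κ₀ x = μ x := fun x hx =>
      (k2 x (Or.inr hx)).trans (hμν x (hzF x (F.key_subset_vars hx))).symm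
    have hCA : C.KeyEqual A := by
      refine ⟨hmC.1.trans hAF.symm, ?_⟩
      rw [hmC.1, hAF, hAtake, hmC.2, ← List.map_take]
      exact map_eval_congr hkey
    obtain rfl : C = A := by
      rcases mem_swapFact.1 hC with h | h
      exacts [h, absurd hCA.symm h.2]
    -- Only the quantified variables take their values from the embedding `κ₀`; everything else, in
    -- particular the fresh variables, keeps its value under `μ`.
    refine (sat_exs hμ).2 ⟨fun x => if x ∈ newVars (V ∪ F.key) (F.args.drop F.rel.keyLen)
      then κ₀ x else μ x, fun x => ?_, fun x hx => by simp [hx], ?_⟩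
    · dsimp only
      split_ifs
      exacts [k1 x, hμ x]
    set κ : Var → Const := fun x => if x ∈ newVars (V ∪ F.key) (F.args.drop F.rel.keyLen)
      then κ₀ x else μ x with hκ
    have hκadm : AdmAssign κ := fun x => by
      rw [hκ]
      dsimp only
      split_ifs
      exacts [k1 x, hμ x]
    have hκκ₀ : ∀ x, x ∈ V ∪ F.vars → κ x = κ₀ x := by
      intro x hx
      rw [hκ]
      dsimp only
      split_ifs with hn
      · rfl
      · have hx' : x ∈ V ∪ F.key := by
          by_contra hx'
          refine hn (mem_newVars.2 ⟨?_, hx'⟩)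
          rw [Finset.mem_union, not_or] at hx'
          rcases Finset.mem_union.1 hx with h | h
          · exact absurd h hx'.1
          · exact ((F.vars_eq x).1 h).resolve_left hx'.2
        rcases Finset.mem_union.1 hx' with h | h
        · rw [hμν x (hzV x h)]
          exact (k2 x (Or.inl h)).symm
        · exact (hkey x h).symm
    have hmκ : Matches C κ F :=
      hmC.congr fun x hx => (hκκ₀ x (Finset.mem_union_right _ hx)).symm
    rw [sat_eqs hlen, hχ κ hκadm]
    constructor
    · have e1 : zs.map κ = zs.map μ := List.map_congr_left fun x hx => by
        rw [hκ]
        refine if_neg fun hn => ?_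
        exact hzF x ((F.vars_eq x).2 (Or.inr (mem_newVars.1 hn).1)) hx
      rw [e1, ← hAdrop, hmκ.2, List.map_drop]
    · have := Certain.of_cons hl hFl (W := ↑V) (db := db) (ν := κ) ⟨C, hA, hmκ⟩
        (h.congr fun x hx => ?_)
      · simpa using this
      · rw [hκκ₀ x]
        · exact (k2 x hx).symm
        · rcases hx with hx | hx
          exacts [Finset.mem_union_left _ hx, Finset.mem_union_right _ (F.key_subset_vars hx)]

theorem complement_cons {q : SJFBCQ} {F : Atom} {l : List Atom} {V : Finset Var}
    (hV : ∀ G ∈ q.atoms, G ∉ F :: l → ∀ x ∈ G.vars, x ∈ V) :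
    ∀ G ∈ q.atoms, G ∉ l → ∀ x ∈ G.vars, x ∈ V ∪ F.vars := by
  intro G hG hGl x hx
  by_cases e : G = F
  · subst e
    exact Finset.mem_union_right _ hx
  · exact Finset.mem_union_left _ (hV G hG (by simp [e, hGl]) x hx)

theorem SJFBCQ.vars_subset {q : SJFBCQ} {F : Atom} (hF : F ∈ q.atoms) : F.vars ⊆ q.vars :=
  fun _ hx => SJFBCQ.mem_vars_of_mem hF hx

/-- The quantifiers over the variables of `F` stand outside the certainty. For its key this is
justified because no atom of `F :: l` attacks it; the non-key variables merely have to witness that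
the block is not empty. -/
theorem sat_certainFormula {q : SJFBCQ} {m : ℕ} (hm : ∀ x ∈ q.vars, x.idx < m) {db : Database} :
    ∀ {l : List Atom} {V : Finset Var}, (∀ G ∈ l, G ∈ q.atoms) → l.Nodup →
      (∀ G ∈ q.atoms, G ∉ l → ∀ x ∈ G.vars, x ∈ V) → V ⊆ q.vars →
      l.Pairwise (fun F G => ¬ q.Attacks G F) → ∀ ν, AdmAssign ν →
      (Sat db ν (certainFormula m V l) ↔ Certain db l ↑V ν)
  | [], V, _, _, _, _, _, ν, hν => by
    simp only [certainFormula, Sat, true_iff]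
    exact fun r _ => ⟨ν, hν, fun _ _ => rfl, by simp [Embeds]⟩
  | F :: l, V, hl, hnd, hV, hVq, hpw, ν, hν => by
    have hFq := hl F (by simp)
    rw [List.nodup_cons] at hnd
    rw [List.pairwise_cons] at hpw
    have hblock : ∀ ν, AdmAssign ν → _ := fun ν hν =>
      sat_blockFormula hl hnd.1 hm hVq (db := db)
        (fun κ hκ => sat_certainFormula hm (fun G hG => hl G (by simp [hG])) hnd.2
          (complement_cons hV) (Finset.union_subset hVq (SJFBCQ.vars_subset hFq)) hpw.2 κ hκ) hν
    rw [certainFormula, sat_exs hν]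
    constructor
    · rintro ⟨μ, h1, h2, h3⟩
      refine (((hblock μ h1).1 h3).2.mono (fun _ h => h) Set.subset_union_left).congr
        fun x hx => h2 x fun hn => ?_
      exact (mem_newVars.1 hn).2 hx
    · intro h
      -- Later atoms do not attack `F` by the topological sort, and `F` does not attack its own key,
      -- which lies in its closure.
      obtain ⟨μ, h1, h2, h3⟩ := SJFBCQ.exists_certain_of_not_attacksVar hl hV (Y := ↑F.key) (by
        intro G hG x hx ha
        by_cases e : G = F
        · subst e
          exact ha.notMem_keycl (SJFBCQ.key_subset_keycl hFq hx)
        · exact hpw.1 G ((List.mem_cons.1 hG).resolve_left e)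
            ⟨hl G hG, hFq, e, x, F.key_subset_vars hx, ha⟩) h
      -- Any repair supplies values for the non-key variables of `F`.
      obtain ⟨r, hr⟩ := exists_isRepair db
      obtain ⟨κ, k1, k2, k3⟩ := h3 r hr
      obtain ⟨A, hA, hmA⟩ := k3 F (by simp)
      have hag : ∀ x, x ∈ V ∪ F.vars → (if x ∈ newVars V F.args then κ x else ν x) = κ x := by
        intro x hx
        split_ifs with hn
        · rfl
        · have hxV : x ∈ V := by
            by_contra hxV
            exact hn (mem_newVars.2 ⟨(Finset.mem_union.1 hx).resolve_left hxV, hxV⟩)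
          rw [k2 x (Or.inl hxV), h2 x hxV]
      have hadm : AdmAssign fun x => if x ∈ newVars V F.args then κ x else ν x := fun x => by
        dsimp only
        split_ifs
        exacts [k1 x, hν x]
      refine ⟨_, hadm, fun x hx => by simp [hx], (hblock _ hadm).2 ⟨⟨A, hr.prop.1 hA, ?_⟩, ?_⟩⟩
      · exact hmA.congr fun x hx => (hag x (Finset.mem_union_right _ hx)).symm
      · refine h3.congr fun x hx => ?_
        rw [hag x, k2 x hx]
        rcases hx with hx | hx
        exacts [Finset.mem_union_left _ hx, Finset.mem_union_right _ (F.key_subset_vars hx)]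

theorem sat_alongFormula {q : SJFBCQ} {m : ℕ} (hm : ∀ x ∈ q.vars, x.idx < m) {db : Database} :
    ∀ {l : List Atom} {V : Finset Var}, (∀ G ∈ l, G ∈ q.atoms) → l.Nodup →
      (∀ G ∈ q.atoms, G ∉ l → ∀ x ∈ G.vars, x ∈ V) → V ⊆ q.vars →
      l.Pairwise (fun F G => ¬ q.Attacks G F) → ∀ ν, AdmAssign ν →
      (Sat db ν (alongFormula m V l) ↔ Embeds db ν l ∧ CertainAlong db ν l ↑V)
  | [], V, _, _, _, _, _, ν, hν => by simp [alongFormula, Sat, Embeds, CertainAlong]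
  | F :: l, V, hl, hnd, hV, hVq, hpw, ν, hν => by
    have hFq := hl F (by simp)
    rw [List.nodup_cons] at hnd
    rw [List.pairwise_cons] at hpw
    have hl' : ∀ G ∈ l, G ∈ q.atoms := fun G hG => hl G (by simp [hG])
    have hV' := complement_cons hV
    have hVq' := Finset.union_subset hVq (SJFBCQ.vars_subset hFq)
    rw [alongFormula, Sat, sat_blockFormula hl hnd.1 hm hVq
      (fun κ hκ => sat_certainFormula hm hl' hnd.2 hV' hVq' hpw.2 κ hκ) hν,
      sat_alongFormula hm hl' hnd.2 hV' hVq' hpw.2 ν hν, CertainAlong, Finset.coe_union]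
    simp only [Embeds, List.forall_mem_cons]
    tauto

/-! ## Free variables -/

theorem freeVars_exs (l : List Var) (φ : Formula) (x : Var) :
    x ∈ (exs l φ).freeVars ↔ x ∈ φ.freeVars ∧ x ∉ l := by
  induction l with
  | nil => simp [exs]
  | cons y l ih => simp [exs, Formula.freeVars, ih]; tauto

theorem freeVars_alls (l : List Var) (φ : Formula) (x : Var) :
    x ∈ (alls l φ).freeVars ↔ x ∈ φ.freeVars ∧ x ∉ l := by
  induction l with
  | nil => simp [alls]
  | cons y l ih => simp [alls, Formula.freeVars, ih]; tauto

theorem freeVars_eqs {x : Var} : ∀ {zs : List Var} {ts : List Term} {φ : Formula},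
    x ∈ (eqs zs ts φ).freeVars → x ∈ zs ∨ x ∈ varsOf ts ∨ x ∈ φ.freeVars
  | [], ts, φ, h => by cases ts <;> simp_all [eqs]
  | z :: zs, [], φ, h => by simp_all [eqs]
  | z :: zs, t :: ts, φ, h => by
    have e : varsOf (t :: ts) = t.vars ∪ varsOf ts := rfl
    simp only [eqs, Formula.freeVars, Finset.mem_union, Term.vars, Finset.mem_singleton] at h
    rw [e, Finset.mem_union, List.mem_cons]
    rcases h with (h | h) | h
    · exact Or.inl (Or.inl h)
    · exact Or.inr (Or.inl (Or.inl h))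
    · rcases freeVars_eqs h with h | h | h
      · exact Or.inl (Or.inr h)
      · exact Or.inr (Or.inl (Or.inr h))
      · exact Or.inr (Or.inr h)

theorem freeVars_blockFormula {m : ℕ} {V : Finset Var} {F : Atom} {χ : Formula}
    (hχ : χ.freeVars ⊆ V ∪ F.vars) : (blockFormula m V F χ).freeVars ⊆ V ∪ F.vars := by
  intro x hx
  simp only [blockFormula, Formula.freeVars, Finset.mem_union, freeVars_alls, freeVars_exs] at hx
  rw [Finset.mem_union]
  rcases hx with hx | ⟨hx | ⟨hx, hn⟩, hz⟩
  · exact Or.inr hx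
  · obtain ⟨t, ht, hxt⟩ := mem_varsOf.1 hx
    rcases List.mem_append.1 ht with ht | ht
    · exact Or.inr (F.key_subset_vars (mem_varsOf.2 ⟨t, ht, hxt⟩))
    · obtain ⟨z, hz', rfl⟩ := List.mem_map.1 ht
      simp only [Term.vars, Finset.mem_singleton] at hxt
      exact absurd (hxt ▸ hz') hz
  · rcases freeVars_eqs hx with h | h | h
    · exact absurd h hz
    · exact Or.inr ((F.vars_eq x).2 (Or.inr h))
    · exact Finset.mem_union.1 (hχ h)

theorem freeVars_certainFormula {m : ℕ} : ∀ {l : List Atom} {V : Finset Var},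
    (certainFormula m V l).freeVars ⊆ V
  | [], V => by simp [certainFormula, Formula.freeVars]
  | F :: l, V => by
    intro x hx
    rw [certainFormula, freeVars_exs, mem_newVars] at hx
    have := freeVars_blockFormula freeVars_certainFormula hx.1
    by_contra hxV
    exact hx.2 ⟨(Finset.mem_union.1 this).resolve_left hxV, hxV⟩

theorem freeVars_alongFormula_subset {m : ℕ} : ∀ {l : List Atom} {V : Finset Var},
    (alongFormula m V l).freeVars ⊆ V ∪ atomsVars l
  | [], V => by simp [alongFormula, Formula.freeVars]
  | F :: l, V => by
    rw [alongFormula, Formula.freeVars, atomsVars_cons, ← Finset.union_assoc]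
    exact Finset.union_subset ((freeVars_blockFormula freeVars_certainFormula).trans
      Finset.subset_union_left) freeVars_alongFormula_subset

/-- Each conjunct begins with its atom `F` outside the scope of any quantifier, so no variable of
the query is lost. -/
theorem subset_freeVars_alongFormula {m : ℕ} : ∀ {l : List Atom} {V : Finset Var},
    atomsVars l ⊆ (alongFormula m V l).freeVars
  | [], V => by simp [atomsVars]
  | F :: l, V => by
    rw [alongFormula, Formula.freeVars, atomsVars_cons]
    refine Finset.union_subset_union ?_ subset_freeVars_alongFormula
    rw [blockFormula, Formula.freeVars, Formula.freeVars]
    exact Finset.subset_union_left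

theorem atomsVars_perm {l l' : List Atom} (h : l.Perm l') : atomsVars l = atomsVars l' := by
  ext x
  simp only [mem_atomsVars, h.mem_iff]

/-- The rewriting obtained from one topological sort is correct for every topological sort. -/
theorem alongFormula_correct {q : SJFBCQ} {m : ℕ} (hm : ∀ x ∈ q.vars, x.idx < m) {l₀ : List Atom}
    (h₀ : q.IsTopologicalSort l₀) :
    (alongFormula m ∅ l₀).freeVars = q.vars ∧
    ∀ l : List Atom, q.IsTopologicalSort l →
      ∀ (db : Database) (θ : Valuation), θ.dom = q.vars →
        (Models db θ (alongFormula m ∅ l₀) ↔ IsForallEmbedding l db θ) := by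
  constructor
  · rw [SJFBCQ.vars, ← atomsVars_perm h₀.1]
    refine subset_antisymm ?_ subset_freeVars_alongFormula
    simpa using freeVars_alongFormula_subset (m := m) (l := l₀) (V := ∅)
  · intro l hl db θ hθ
    have hq : ∀ {l : List Atom}, q.IsTopologicalSort l → (∀ F ∈ l, F ∈ q.atoms) ∧ l.Nodup ∧
        ∀ F ∈ q.atoms, F ∉ l → ∀ x ∈ F.vars, x ∈ (∅ : Finset Var) := fun h =>
      ⟨fun F hF => h.1.mem_iff.1 hF, h.1.nodup_iff.2 q.atoms_nodup,
        fun F hF hFl => absurd (h.1.mem_iff.2 hF) hFl⟩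
    have key : ∀ ν, AdmAssign ν → (∀ x, ν x.1 = θ.val x) →
        (Sat db ν (alongFormula m ∅ l₀) ↔ IsForallEmbedding l db θ) := by
      intro ν hν hνθ
      rw [sat_alongFormula hm (hq h₀).1 (hq h₀).2.1 (hq h₀).2.2 (by simp) h₀.2 ν hν,
        isForallEmbedding_iff (hθ.trans (atomsVars_perm hl.1).symm) hν hνθ, Finset.coe_empty]
      have hp : l.Perm l₀ := hl.1.trans h₀.1.symm
      have hcomp : ∀ {l : List Atom}, q.IsTopologicalSort l →
          ∀ F ∈ q.atoms, F ∉ l → ∀ x ∈ F.vars, x ∈ (∅ : Set Var) := fun h F hF hFl x hx => by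
        simpa using (hq h).2.2 F hF hFl x hx
      constructor
      · rintro ⟨h1, h2⟩
        exact ⟨fun F hF => h1 F (hp.mem_iff.1 hF), h2.of_perm hp (hq h₀).1 (hq h₀).2.1
          (hcomp h₀) h1 hl.2⟩
      · rintro ⟨h1, h2⟩
        exact ⟨fun F hF => h1 F (hp.mem_iff.2 hF), h2.of_perm hp.symm (hq hl).1 (hq hl).2.1
          (hcomp hl) h1 h₀.2⟩
    constructor
    · rintro ⟨ν, h1, h2, h3⟩
      exact (key ν h1 h2).1 h3
    · intro h
      classical
      -- The default value `0` is admissible for both sorts of variables.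
      let ν : Var → Const := fun x => if hx : x ∈ θ.dom then θ.val ⟨x, hx⟩ else .num 0
      have h1 : AdmAssign ν := fun x => by
        dsimp only [ν]
        split_ifs with hx
        · exact θ.admissible ⟨x, hx⟩
        · exact fun _ => trivial
      have h2 : ∀ x, ν x.1 = θ.val x := fun x => by simp [ν]
      exact ⟨ν, h1, h2, (key ν h1 h2).2 h⟩

namespace SJFBCQ

/-! ## Attacked variables along the edges of an acyclic attack graph -/

/-- The closure as the least set closed under the dependencies, tested by two tuples. -/
theorem mem_of_mem_keycl {q : SJFBCQ} {F : Atom} {S : Set Var} (hk : ∀ x ∈ F.key, x ∈ S)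
    (hS : ∀ G ∈ q.atoms, G ≠ F → (∀ x ∈ G.key, x ∈ S) → ∀ x ∈ G.vars, x ∈ S) {x : Var}
    (hx : x ∈ q.keycl F) : x ∈ S := by
  classical
  let s : Var → Const := fun _ => .sym 0
  let t : Var → Const := fun y => if y ∈ S then .sym 0 else .sym 1
  have hst : ∀ y, s y = t y ↔ y ∈ S := by
    intro y
    by_cases hy : y ∈ S <;> simp [s, t, hy]
  refine (hst x).1 (hx.2 {s, t} ?_ s (by simp) t (by simp) (fun y hy => (hst y).2 (hk y hy)) x
    (by simp))
  rintro f ⟨G, hG, hGF, rfl⟩ a ha b hb hab y hy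
  rcases ha with rfl | rfl <;> rcases hb with rfl | rfl
  · rfl
  · exact (hst y).2 (hS G hG hGF (fun z hz => (hst z).1 (hab z hz)) y hy)
  · exact ((hst y).2 (hS G hG hGF (fun z hz => (hst z).1 (hab z hz).symm) y hy)).symm
  · rfl

theorem keycl_closed {q : SJFBCQ} {F G : Atom} (hG : G ∈ q.atoms) (hGF : G ≠ F)
    (h : ∀ x ∈ G.key, x ∈ q.keycl F) : ∀ x ∈ G.vars, x ∈ q.keycl F := by
  refine fun x hx => ⟨mem_vars_of_mem hG hx, fun T hT s hs t ht hst y hy => ?_⟩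
  rw [Finset.mem_singleton] at hy
  subst hy
  exact hT ⟨G.key, G.vars⟩ ⟨G, hG, hGF, rfl⟩ s hs t ht
    (fun z hz => (h z hz).2 T hT s hs t ht hst z (by simp)) y hx

/-- The variables that `F` attacks. -/
def attacked (q : SJFBCQ) (F : Atom) : Set Var := {x | q.AttacksVar F x}

/-- The variables in the closure of `key(F)` that `G` does not attack include `key(F)` and are
closed under the dependencies, so they are the whole closure. Indeed, the dependency of `G` cannot
apply, for it would put the attacked variable `x` into the closure. If the dependency of another
atom `H` led to a variable attacked by `G`, then the unattacked key of `H` would lie in the closure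
of `key(G)`, and that variable with it. -/
theorem notMem_keycl_of_attacks {q : SJFBCQ} {F G : Atom} (hFG : q.Attacks F G)
    (hGF : ¬ q.Attacks G F) {y : Var} (hy : q.AttacksVar G y) : y ∉ q.keycl F := by
  obtain ⟨hF, hG, hne, x, hxG, hx⟩ := hFG
  intro hyF
  have hk : ∀ z ∈ F.key, ¬ q.AttacksVar G z := fun z hz ha =>
    hGF ⟨hG, hF, hne.symm, z, F.key_subset_vars hz, ha⟩
  have := mem_of_mem_keycl (S := {z | z ∈ q.keycl F ∧ ¬ q.AttacksVar G z})
    (fun z hz => ⟨key_subset_keycl hF hz, hk z hz⟩) (fun H hH hHF hkey z hz => ?_) hyF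
  · exact this.2 hy
  · have hcl := keycl_closed hH hHF fun w hw => (hkey w hw).1
    refine ⟨hcl z hz, fun hza => ?_⟩
    by_cases hHG : H = G
    · subst hHG
      exact hx.notMem_keycl (hcl x hxG)
    · refine hza.notMem_keycl (keycl_closed hH hHG (fun w hw => ?_) z hz)
      by_contra hwG
      exact (hkey w hw).2 (hza.step ⟨H, hH, hz, H.key_subset_vars hw⟩ hwG)

/-- An attack path of `F` into `G` can be prolonged by any attack path of `G`, which avoids the
closure of `key(F)`. The inclusion is proper because `F` attacks one of its own non-key variables,
and `G` does not. -/
theorem attacked_ssubset {q : SJFBCQ} {F G : Atom} (hFG : q.Attacks F G)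
    (hGF : ¬ q.Attacks G F) : q.attacked G ⊂ q.attacked F := by
  have hcl := fun y => notMem_keycl_of_attacks hFG hGF (y := y)
  obtain ⟨hF, hG, hne, x, hxG, hx⟩ := hFG
  refine ⟨fun y hy => ?_, fun hsub => ?_⟩
  · obtain ⟨y₁, h1, h2, h3⟩ := attacksVar_iff.1 hy
    have h0 : q.AttacksVar F y₁ := hx.step ⟨G, hG, hxG, (Finset.mem_sdiff.1 h1).1⟩
      (hcl _ (attacksVar_of_notKey h1 h2))
    clear hy
    induction h3 with
    | refl => exact h0
    | tail hab hbc ih =>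
      refine SJFBCQ.AttacksVar.step (F := F) ih hbc.1 (hcl _ ?_)
      exact attacksVar_iff.2 ⟨y₁, h1, h2, hab.tail hbc⟩
  · obtain ⟨x₁, h1, h2, -⟩ := attacksVar_iff.1 hx
    exact hGF ⟨hG, hF, hne.symm, x₁, (Finset.mem_sdiff.1 h1).1,
      hsub (attacksVar_of_notKey h1 h2)⟩

theorem AcyclicAttackGraph.asymm {q : SJFBCQ} (h : q.AcyclicAttackGraph) {F G : Atom}
    (hFG : q.Attacks F G) : ¬ q.Attacks G F := fun hGF =>
  h F (.tail (.single hFG) hGF)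

end SJFBCQ

/-! ## Running programs -/

/-- `P`, started in `σ`, halts, and `Q` holds for the number of steps and the final state. -/
def Run (P : Prog) (σ : State) (Q : ℕ → State → Prop) : Prop := ∃ t τ, Exec P σ t τ ∧ Q t τ

theorem Run.mono {P : Prog} {σ : State} {Q R : ℕ → State → Prop} (h : Run P σ Q)
    (hQR : ∀ t τ, Q t τ → R t τ) : Run P σ R := by
  obtain ⟨t, τ, h1, h2⟩ := h
  exact ⟨t, τ, h1, hQR t τ h2⟩

theorem Run.seq {P R : Prog} {σ : State} {Q : ℕ → State → Prop}
    (h : Run P σ fun s τ => Run R τ fun t υ => Q (s + t) υ) : Run (.seq P R) σ Q := by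
  obtain ⟨s, τ, h1, t, υ, h2, h3⟩ := h
  exact ⟨s + t, υ, .seq h1 h2, h3⟩

/-- Run `P` with a known specification, then `R`. -/
theorem Run.comp {P R : Prog} {σ : State} {S Q : ℕ → State → Prop} (h : Run P σ S)
    (h' : ∀ s τ, S s τ → Run R τ fun t υ => Q (s + t) υ) : Run (.seq P R) σ Q :=
  Run.seq (h.mono h')

theorem Run.ite {b : Test} {P R : Prog} {σ : State} {Q : ℕ → State → Prop}
    (h : b.Holds σ → Run P σ fun t τ => Q (t + 1) τ)
    (h' : ¬ b.Holds σ → Run R σ fun t τ => Q (t + 1) τ) : Run (.ite b P R) σ Q := by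
  by_cases hb : b.Holds σ
  · obtain ⟨t, τ, h1, h2⟩ := h hb
    exact ⟨t + 1, τ, .iteTrue hb h1, h2⟩
  · obtain ⟨t, τ, h1, h2⟩ := h' hb
    exact ⟨t + 1, τ, .iteFalse hb h1, h2⟩

/-- A sequence of instructions. -/
def block : List Instr → Prog
  | [] => .instr .skip
  | i :: l => .seq (.instr i) (block l)

theorem Run.block {l : List Instr} {σ : State} {Q : ℕ → State → Prop}
    (h : Q (l.length + 1) (l.foldl Instr.exec σ)) : Run (block l) σ Q := by
  induction l generalizing σ Q with
  | nil => exact ⟨1, σ, .instr .skip σ, h⟩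
  | cons i l ih =>
    refine Run.seq ⟨1, _, .instr i σ, ih ?_⟩
    rw [List.length_cons] at h
    rwa [Nat.add_comm 1]

/-- `σ` with entry `i` of array `a` replaced by `v`. -/
def State.setArr (σ : State) (a i v : ℕ) : State :=
  { σ with arr := fun x y => if x = a ∧ y = i then v else σ.arr x y }

/-- `σ` after printing `v`. -/
def State.emit (σ : State) (v : ℕ) : State := { σ with out := σ.out ++ [v] }

section StateLemmas

variable (σ : State) (r s a i v x y : ℕ)

@[simp] theorem exec_const : Instr.exec σ (.const r v) = σ.setReg r v := rfl

@[simp] theorem exec_copy : Instr.exec σ (.copy r s) = σ.setReg r (σ.reg s) := rfl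

@[simp] theorem exec_succ : Instr.exec σ (.succ r) = σ.setReg r (σ.reg r + 1) := rfl

@[simp] theorem exec_pred : Instr.exec σ (.pred r) = σ.setReg r (σ.reg r - 1) := rfl

@[simp] theorem exec_load : Instr.exec σ (.load r a i) = σ.setReg r (σ.arr a (σ.reg i)) := rfl

@[simp] theorem exec_print : Instr.exec σ (.print r) = σ.emit (σ.reg r) := rfl

@[simp] theorem exec_store :
    Instr.exec σ (.store a i r) = σ.setArr a (σ.reg i) (σ.reg r) := by
  simp only [Instr.exec, State.setArr, State.mk.injEq, true_and, and_true]
  funext x y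
  simp only [Function.update_apply]
  split_ifs <;> simp_all

@[simp] theorem setReg_reg : (σ.setReg r v).reg s = if s = r then v else σ.reg s := by
  simp [State.setReg, Function.update_apply]

@[simp] theorem setReg_arr : (σ.setReg r v).arr = σ.arr := rfl

@[simp] theorem setReg_out : (σ.setReg r v).out = σ.out := rfl

@[simp] theorem setArr_reg : (σ.setArr a i v).reg = σ.reg := rfl

@[simp] theorem setArr_arr :
    (σ.setArr a i v).arr x y = if x = a ∧ y = i then v else σ.arr x y := rfl

@[simp] theorem setArr_out : (σ.setArr a i v).out = σ.out := rfl

@[simp] theorem emit_reg : (σ.emit v).reg = σ.reg := rfl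

@[simp] theorem emit_arr : (σ.emit v).arr = σ.arr := rfl

@[simp] theorem emit_out : (σ.emit v).out = σ.out ++ [v] := rfl

end StateLemmas

/-- Loops: `I k σ` says that the invariant holds and that `k` more steps suffice. -/
theorem Run.loop {b : Test} {P : Prog} (I : ℕ → State → Prop)
    (h : ∀ k σ, I k σ → b.Holds σ → Run P σ fun t τ => ∃ k', I k' τ ∧ k' + t + 1 ≤ k) {k : ℕ}
    {σ : State} (hσ : I k σ) :
    Run (.loop b P) σ fun t τ => ∃ k', I k' τ ∧ ¬ b.Holds τ ∧ t + k' ≤ k + 1 := by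
  induction k using Nat.strong_induction_on generalizing σ with
  | _ k ih =>
    by_cases hb : b.Holds σ
    · obtain ⟨s, τ, h1, k', h2, h3⟩ := h k σ hσ hb
      obtain ⟨t, υ, e1, k'', e2, e3, e4⟩ := ih k' (by omega) h2
      exact ⟨s + t + 1, υ, .loopTrue hb h1 e1, k'', e2, e3, by omega⟩
    · exact ⟨1, σ, .loopFalse hb, k, hσ, hb, by omega⟩

/-- Counting loops, with a bound `c i` on the number of steps of the `i`-th iteration. -/
theorem Run.for {P : Prog} {x y : ℕ} (I : ℕ → State → Prop) (e : ℕ) (c : ℕ → ℕ)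
    (hI : ∀ i σ, I i σ → σ.reg x = i ∧ σ.reg y = e) {s : ℕ}
    (h : ∀ i σ, s ≤ i → i < e → I i σ → Run P σ fun t τ => I (i + 1) τ ∧ t ≤ c i) (hs : s ≤ e)
    {σ : State} (hσ : I s σ) : Run (.loop (.lt x y) P) σ fun t τ => I e τ ∧
      t ≤ ∑ i ∈ Finset.Ico s e, (c i + 1) + 1 := by
  induction hk : e - s generalizing s σ with
  | zero =>
    obtain rfl : s = e := by omega
    have := hI _ _ hσ
    refine ⟨1, σ, .loopFalse ?_, hσ, by omega⟩
    simp [Test.Holds, this.1, this.2]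
  | succ k ih =>
    have hse : s < e := by omega
    have := hI _ _ hσ
    obtain ⟨t₁, τ, h1, h2, h3⟩ := h s σ le_rfl hse hσ
    obtain ⟨t₂, υ, e1, e2, e3⟩ := ih (fun i σ hi => h i σ (by omega)) (show s + 1 ≤ e by omega) h2
      (by omega)
    refine ⟨t₁ + t₂ + 1, υ, .loopTrue ?_ h1 e1, e2, ?_⟩
    · simpa [Test.Holds, this.1, this.2] using hse
    · rw [Finset.sum_eq_sum_Ico_succ_bot hse]
      omega

theorem Run.for_const {P : Prog} {x y : ℕ} (I : ℕ → State → Prop) (e c : ℕ)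
    (hI : ∀ i σ, I i σ → σ.reg x = i ∧ σ.reg y = e) {s : ℕ}
    (h : ∀ i σ, s ≤ i → i < e → I i σ → Run P σ fun t τ => I (i + 1) τ ∧ t ≤ c) (hs : s ≤ e)
    {σ : State} (hσ : I s σ) : Run (.loop (.lt x y) P) σ fun t τ => I e τ ∧
      t ≤ (c + 1) * (e - s) + 1 := by
  refine (Run.for I e (fun _ => c) hI h hs hσ).mono fun t τ ht => ⟨ht.1, ht.2.trans ?_⟩
  simp [mul_comm]

/-! ## The flat representation of a query in memory -/

/-- The three symbols of a term. -/
def Term.tag : Term → ℕ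
  | .var x => if x.numerical then 1 else 0
  | .const (.sym _) => 2
  | .const (.num _) => 3

def Term.fst : Term → ℕ
  | .var x => x.idx
  | .const (.sym s) => s
  | .const (.num a) => a.num

def Term.snd : Term → ℕ
  | .var _ => 0
  | .const (.sym _) => 0
  | .const (.num a) => a.den

theorem Term.encode_eq (t : Term) : t.encode = [t.tag, t.fst, t.snd] := by
  rcases t with x | (a | s) <;> simp [Term.encode, Var.encode, Term.tag, Term.fst, Term.snd]

def flagNat (b : Bool) : ℕ := if b then 1 else 0

def encArg (p : Bool × Term) : List ℕ := [flagNat p.1, p.2.tag, p.2.fst, p.2.snd]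

/-- The columns of an atom together with its arguments. -/
def Atom.cells (F : Atom) : List (Bool × Term) := List.zip F.rel.cols F.args

theorem Atom.cells_length (F : Atom) : F.cells.length = F.args.length := by
  simp [Atom.cells, F.args_length]

theorem Atom.encode_eq (F : Atom) :
    F.encode = F.rel.id :: F.rel.keyLen :: F.rel.arity :: F.cells.flatMap encArg := by
  unfold Atom.encode Atom.cells
  simp only [List.cons_append, List.nil_append]
  congr 3
  refine List.flatMap_congr fun p _ => ?_
  rw [Term.encode_eq]
  rfl

/-- The first address used for the atom with number `a`. -/
def start (l : List Atom) (a : ℕ) : ℕ := 1 + ((l.take a).map fun F => 1 + F.args.length).sum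

theorem start_zero (l : List Atom) : start l 0 = 1 := by simp [start]

theorem start_succ {l : List Atom} {a : ℕ} {F : Atom} (h : l[a]? = some F) :
    start l (a + 1) = start l a + 1 + F.args.length := by
  obtain ⟨ha, rfl⟩ := List.getElem?_eq_some_iff.1 h
  simp only [start, List.take_add_one, h, Option.toList_some, List.map_append, List.map_cons,
    List.map_nil, List.sum_append, List.sum_cons, List.sum_nil]
  omega

/-- The cell `p` with key flag `k` of atom number `a` is stored at address `o`. -/
def CellAt (A : ℕ → ℕ → ℕ) (o a k : ℕ) (p : Bool × Term) : Prop :=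
  A 1 o = flagNat p.1 ∧ A 2 o = p.2.tag ∧ A 3 o = p.2.fst ∧ A 4 o = p.2.snd ∧ A 5 o = a ∧ A 6 o = k

/-- Address `o` holds a head cell, which poses as a constant (tag `2`) in the key. Thus every atom
has a key cell even when its primary key is empty, and every atom contains an address without a
variable. -/
structure AtomAt (A : ℕ → ℕ → ℕ) (a o : ℕ) (F : Atom) : Prop where
  id : A 7 a = F.rel.id
  keyLen : A 8 a = F.rel.keyLen
  arity : A 9 a = F.rel.arity
  beg : A 10 a = o
  keyEnd : A 11 a = o + 1 + F.rel.keyLen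
  fin : A 12 a = o + 1 + F.args.length
  headTag : A 2 o = 2
  headAtom : A 5 o = a
  headKey : A 6 o = 1
  cell : ∀ j p, F.cells[j]? = some p → CellAt A (o + 1 + j) a (if j < F.rel.keyLen then 1 else 0) p

/-- The atoms of the list are stored one after the other. -/
def Layout (l : List Atom) (A : ℕ → ℕ → ℕ) : Prop :=
  ∀ a F, l[a]? = some F → AtomAt A a (start l a) F

/-! ## Reading the input -/

/-- Register 14 ends up with the middle symbol of the term, the index if it is a variable; register
3 collects the maximum, above which indices are fresh. -/
def parseCell (key : ℕ) : Prog :=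
  .seq (block [.load 14 0 10, .store 1 2 14, .succ 10, .load 14 0 10, .store 2 2 14, .succ 10,
    .load 14 0 10, .store 3 2 14, .succ 10, .load 15 0 10, .store 4 2 15, .succ 10,
    .const 15 key, .store 6 2 15, .store 5 2 4, .succ 2, .succ 11])
    (.ite (.lt 3 14) (block [.copy 3 14]) (block []))

def parseAtom : Prog :=
  .seq (block [.load 14 0 10, .store 7 4 14, .succ 10, .load 12 0 10, .store 8 4 12, .succ 10,
    .load 13 0 10, .store 9 4 13, .succ 10, .store 10 4 2, .store 5 2 4, .const 14 2,
    .store 2 2 14, .const 14 1, .store 6 2 14, .succ 2, .const 11 0])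
  (.seq (.loop (.lt 11 12) (parseCell 1))
  (.seq (block [.store 11 4 2])
  (.seq (.loop (.lt 11 13) (parseCell 0))
    (block [.store 12 4 2, .succ 4]))))

/-- Register 1 receives the number of atoms, 2 is the next free address, 4 the current atom and 10
the position in the input. Addresses start at `1`, which leaves `0` free to mean "none"; register 0
keeps the constant `0` throughout. -/
def parse : Prog :=
  .seq (block [.load 1 0 0, .const 10 1, .const 2 1]) (.loop (.lt 4 1) parseAtom)

theorem getD_of_drop {l rest : List ℕ} {p x : ℕ} (h : l.drop p = x :: rest) :
    l.getD p 0 = x ∧ l.drop (p + 1) = rest := by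
  constructor
  · have : l[p]? = some x := by
      rw [← List.head?_drop, h]
      rfl
    simp [List.getD, this]
  · rw [← List.drop_drop, h]
    rfl

/-- The state inside the loops over the cells `ps` of atom number `a` stored from address `o` on. -/
structure ParseCells (inp rest : List ℕ) (a o : ℕ) (ps : List (Bool × Term)) (key : ℕ → ℕ)
    (σ₀ : State) (i : ℕ) (σ : State) : Prop where
  input : ∀ y, σ.arr 0 y = inp.getD y 0
  drop : inp.drop (σ.reg 10) = (ps.drop i).flatMap encArg ++ rest
  out : σ.out = σ₀.out
  pos : σ.reg 2 = o + i
  idx : σ.reg 11 = i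
  atom : σ.reg 4 = a
  regs : ∀ r, r < 14 → r ≠ 10 → r ≠ 2 → r ≠ 11 → r ≠ 3 → σ.reg r = σ₀.reg r
  max : σ₀.reg 3 ≤ σ.reg 3
  fst_le : ∀ j p, j < i → ps[j]? = some p → p.2.fst ≤ σ.reg 3
  cell : ∀ j p, j < i → ps[j]? = some p → CellAt σ.arr (o + j) a (key j) p
  frame : ∀ x y, ¬ (1 ≤ x ∧ x ≤ 6 ∧ o ≤ y) → σ.arr x y = σ₀.arr x y

theorem run_parseCell {inp rest : List ℕ} {a o : ℕ} {ps : List (Bool × Term)} {key : ℕ → ℕ}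
    {σ₀ σ : State} {i : ℕ} (hi : i < ps.length) (h : ParseCells inp rest a o ps key σ₀ i σ) :
    Run (parseCell (key i)) σ fun t τ => ParseCells inp rest a o ps key σ₀ (i + 1) τ ∧ t ≤ 25 := by
  have hdrop := h.drop
  rw [List.drop_eq_getElem_cons hi, List.flatMap_cons, encArg] at hdrop
  simp only [List.cons_append, List.nil_append] at hdrop
  obtain ⟨e1, hdrop⟩ := getD_of_drop hdrop
  obtain ⟨e2, hdrop⟩ := getD_of_drop hdrop
  obtain ⟨e3, hdrop⟩ := getD_of_drop hdrop
  obtain ⟨e4, hdrop⟩ := getD_of_drop hdrop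
  rw [← h.input] at e1 e2 e3 e4
  have hps : ps[i]? = some ps[i] := List.getElem?_eq_getElem hi
  have h2 := h.pos
  have h4 := h.atom
  have h11 := h.idx
  refine Run.seq (Run.block ?_)
  have hfst : ∀ m, σ.reg 3 ≤ m → ps[i].2.fst ≤ m →
      ∀ j p, j < i + 1 → ps[j]? = some p → p.2.fst ≤ m := by
    intro m h1 h2 j p hj hp
    rcases Nat.lt_succ_iff_lt_or_eq.1 hj with hj | rfl
    · exact (h.fst_le j p hj hp).trans h1
    · rw [hps, Option.some.injEq] at hp
      exact hp ▸ h2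
  refine Run.ite (fun hb => Run.block ?_) (fun hb => Run.block ?_) <;>
  · simp [Test.Holds, h2, h4, h11, e1, e2, e3, e4] at hb ⊢
    constructor
    · simp [h.input]
    · simpa using hdrop
    · simpa using h.out
    · simp; omega
    · simp
    · simpa using h4
    · intro r h1 h2 h3 h4 h5
      rw [← h.regs r h1 h2 h3 h4 h5]
      have : r ≠ 14 := by omega
      have : r ≠ 15 := by omega
      simp [*]
    · have := h.max
      simp
      omega
    · apply hfst <;> simp <;> omega
    · intro j p hj hp
      rcases Nat.lt_succ_iff_lt_or_eq.1 hj with hj | rfl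
      · have e : j ≠ i := by omega
        simpa [CellAt, e] using h.cell j p hj hp
      · rw [hps, Option.some.injEq] at hp
        subst hp
        simp [CellAt]
    · intro x y hxy
      rw [← h.frame x y hxy]
      simp
      iterate 6 rw [if_neg (by omega)]

/-- The state between two atoms, when `a` of the atoms of `l` have been stored. -/
structure ParseAtoms (inp : List ℕ) (l : List Atom) (σ₀ : State) (a : ℕ) (σ : State) :
    Prop where
  input : ∀ y, σ.arr 0 y = inp.getD y 0
  drop : inp.drop (σ.reg 10) = (l.drop a).flatMap Atom.encode
  out : σ.out = σ₀.out
  zero : σ.reg 0 = σ₀.reg 0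
  len : σ.reg 1 = l.length
  pos : σ.reg 2 = start l a
  idx : σ.reg 4 = a
  fst_le : ∀ b F, b < a → l[b]? = some F → ∀ p ∈ F.cells, p.2.fst ≤ σ.reg 3
  atomAt : ∀ b F, b < a → l[b]? = some F → AtomAt σ.arr b (start l b) F
  frame : ∀ x y, 12 < x → σ.arr x y = σ₀.arr x y

theorem start_mono (l : List Atom) {a b : ℕ} (h : a ≤ b) : start l a ≤ start l b := by
  unfold start
  refine Nat.add_le_add_left ?_ _
  exact ((List.take_sublist_take_left h).map _).sum_le_sum (fun _ _ => Nat.zero_le _)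

theorem AtomAt.congr {A B : ℕ → ℕ → ℕ} {a o : ℕ} {F : Atom} (h : AtomAt A a o F)
    (h1 : ∀ x, 1 ≤ x → x ≤ 6 → ∀ y, o ≤ y → y < o + 1 + F.args.length → B x y = A x y)
    (h2 : ∀ x, 7 ≤ x → x ≤ 12 → B x a = A x a) : AtomAt B a o F := by
  have hk : ∀ j p, F.cells[j]? = some p → j < F.args.length := fun j p hp => by
    rw [← F.cells_length]
    exact (List.getElem?_eq_some_iff.1 hp).1
  constructor
  · rw [h2 _ (by omega) (by omega), h.id]
  · rw [h2 _ (by omega) (by omega), h.keyLen]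
  · rw [h2 _ (by omega) (by omega), h.arity]
  · rw [h2 _ (by omega) (by omega), h.beg]
  · rw [h2 _ (by omega) (by omega), h.keyEnd]
  · rw [h2 _ (by omega) (by omega), h.fin]
  · rw [h1 _ (by omega) (by omega) _ (by omega) (by omega), h.headTag]
  · rw [h1 _ (by omega) (by omega) _ (by omega) (by omega), h.headAtom]
  · rw [h1 _ (by omega) (by omega) _ (by omega) (by omega), h.headKey]
  · intro j p hp
    have hj := hk j p hp
    obtain ⟨c1, c2, c3, c4, c5, c6⟩ := h.cell j p hp
    refine ⟨?_, ?_, ?_, ?_, ?_, ?_⟩ <;>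
      rwa [h1 _ (by omega) (by omega) _ (by omega) (by omega)]

theorem Layout.congr {l : List Atom} {A B : ℕ → ℕ → ℕ} (h : Layout l A)
    (hAB : ∀ x y, 1 ≤ x → x ≤ 12 → B x y = A x y) : Layout l B := fun a F hF =>
  (h a F hF).congr (fun _ h1 h2 _ _ _ => hAB _ _ h1 (by omega))
    (fun _ h1 h2 => hAB _ _ (by omega) h2)

theorem run_parseAtom {inp : List ℕ} {l : List Atom} {σ₀ σ : State} {a : ℕ} {F : Atom}
    (hF : l[a]? = some F) (h : ParseAtoms inp l σ₀ a σ) :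
    Run parseAtom σ fun t τ => ParseAtoms inp l σ₀ (a + 1) τ ∧ t ≤ 26 * F.args.length + 30 := by
  obtain ⟨ha, hFa⟩ := List.getElem?_eq_some_iff.1 hF
  have hdrop := h.drop
  rw [List.drop_eq_getElem_cons ha, List.flatMap_cons, hFa, Atom.encode_eq] at hdrop
  simp only [List.cons_append] at hdrop
  obtain ⟨e1, hdrop⟩ := getD_of_drop hdrop
  obtain ⟨e2, hdrop⟩ := getD_of_drop hdrop
  obtain ⟨e3, hdrop⟩ := getD_of_drop hdrop
  rw [← h.input] at e1 e2 e3
  have h2 := h.pos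
  have h4 := h.idx
  have hk : F.rel.keyLen ≤ F.args.length := F.args_length ▸ F.rel.keyLen_le
  have hcl := F.cells_length
  refine Run.seq (Run.block ?_)
  set σ₁ := List.foldl Instr.exec σ _ with hσ₁
  simp [h2, h4, e1, e2, e3] at hσ₁
  have inv : ParseCells inp ((l.drop (a + 1)).flatMap Atom.encode) a (start l a + 1) F.cells
      (fun j => if j < F.rel.keyLen then 1 else 0) σ₁ 0 σ₁ := by
    constructor
    · simp [hσ₁, h.input]
    · simpa [hσ₁] using hdrop
    · rfl
    · simp [hσ₁]
    · simp [hσ₁]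
    · simp [hσ₁, h4]
    · exact fun _ _ _ _ _ _ => rfl
    · exact le_rfl
    · simp
    · simp
    · exact fun _ _ _ => rfl
  refine Run.comp (Run.for_const (ParseCells inp ((l.drop (a + 1)).flatMap Atom.encode) a
    (start l a + 1) F.cells (fun j => if j < F.rel.keyLen then 1 else 0) σ₁) F.rel.keyLen 25
    (fun i σ hi => ⟨hi.idx, ?_⟩) (fun i σ _ hi hσ => ?_) (Nat.zero_le _) inv) ?_
  · rw [hi.regs 12 (by omega) (by omega) (by omega) (by omega) (by omega)]
    simp [hσ₁]
  · simpa [hi] using run_parseCell (by omega) hσ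
  rintro s τ ⟨hτ, hs⟩
  refine Run.seq (Run.block ?_)
  set σ₂ := List.foldl Instr.exec τ _ with hσ₂
  simp [hτ.pos, hτ.atom] at hσ₂
  have inv₂ : ParseCells inp ((l.drop (a + 1)).flatMap Atom.encode) a (start l a + 1) F.cells
      (fun j => if j < F.rel.keyLen then 1 else 0) σ₂ F.rel.keyLen σ₂ := by
    constructor
    · simp [hσ₂, hτ.input]
    · simpa [hσ₂] using hτ.drop
    · rfl
    · simpa [hσ₂] using hτ.pos
    · simpa [hσ₂] using hτ.idx
    · simpa [hσ₂] using hτ.atom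
    · exact fun _ _ _ _ _ _ => rfl
    · exact le_rfl
    · simpa [hσ₂] using hτ.fst_le
    · simpa [hσ₂, CellAt] using hτ.cell
    · exact fun _ _ _ => rfl
  have hreg₂ : ∀ r, r < 14 → r ≠ 10 → r ≠ 2 → r ≠ 11 → r ≠ 3 → σ₂.reg r = σ₁.reg r := by
    intro r h1 h2 h3 h4 h5
    rw [hσ₂, setArr_reg, hτ.regs r h1 h2 h3 h4 h5]
  refine Run.comp (Run.for_const (ParseCells inp ((l.drop (a + 1)).flatMap Atom.encode) a
    (start l a + 1) F.cells (fun j => if j < F.rel.keyLen then 1 else 0) σ₂) F.args.length 25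
    (fun i σ hi => ⟨hi.idx, ?_⟩) (fun i σ hi' hi hσ => ?_) hk inv₂) ?_
  · rw [hi.regs 13 (by omega) (by omega) (by omega) (by omega) (by omega), hreg₂ 13 (by omega)
      (by omega) (by omega) (by omega) (by omega)]
    simp [hσ₁, F.args_length, RelName.arity]
  · have := run_parseCell (by omega) hσ
    rwa [if_neg (by omega)] at this
  rintro s' υ ⟨hυ, hs'⟩
  refine Run.block ?_
  simp [hυ.pos, hυ.atom]
  have hreg : ∀ r, r < 14 → r ≠ 10 → r ≠ 2 → r ≠ 11 → r ≠ 3 → υ.reg r = σ₁.reg r := by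
    intro r h1 h2 h3 h4 h5
    rw [hυ.regs r h1 h2 h3 h4 h5, hreg₂ r h1 h2 h3 h4 h5]
  have hmax : σ.reg 3 ≤ υ.reg 3 := by
    have h1 := hτ.max
    have h2 := hυ.max
    simp [hσ₁] at h1
    simp [hσ₂] at h2
    omega
  have hfr : ∀ x y, ¬ (1 ≤ x ∧ x ≤ 6 ∧ start l a + 1 ≤ y) → ¬ (x = 11 ∧ y = a) →
      υ.arr x y = σ₁.arr x y := by
    intro x y h1 h2
    rw [hυ.frame x y h1, ← hτ.frame x y h1, hσ₂, setArr_arr, if_neg h2]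
  have hst := start_succ hF
  refine ⟨?_, by omega⟩
  constructor
  · simp [hυ.input]
  · have := hυ.drop
    rw [← hcl, List.drop_length] at this
    simpa using this
  · simp [hυ.out, hσ₂, hτ.out, hσ₁, h.out]
  · simp [hreg, hσ₁, h.zero]
  · simp [hreg, hσ₁, h.len]
  · simp [hυ.pos, hst]
  · simp
  · intro b G hb hG p hp
    simp
    rcases Nat.lt_succ_iff_lt_or_eq.1 hb with hb | rfl
    · exact (h.fst_le b G hb hG p hp).trans hmax
    · obtain rfl : F = G := by simpa [hF] using hG
      obtain ⟨j, hj, rfl⟩ := List.getElem_of_mem hp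
      exact hυ.fst_le j _ (by omega) (List.getElem?_eq_getElem hj)
  · intro b G hb hG
    rcases Nat.lt_succ_iff_lt_or_eq.1 hb with hb | rfl
    · have hsb := start_succ hG
      have hsm := start_mono l (show b + 1 ≤ a by omega)
      refine (h.atomAt b G hb hG).congr (fun x h1 h2 y h3 h4 => ?_) fun x h1 h2 => ?_
      · rw [setReg_arr, setArr_arr, if_neg (by omega), hfr x y (by omega) (by omega), hσ₁]
        simp
        repeat rw [if_neg (by omega)]
      · rw [setReg_arr, setArr_arr, if_neg (by omega), hfr x b (by omega) (by omega), hσ₁]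
        simp
        repeat rw [if_neg (by omega)]
    · obtain rfl : F = G := by simpa [hF] using hG
      constructor
      · simp [hfr, hσ₁]
      · simp [hfr, hσ₁]
      · simp [hfr, hσ₁]
      · simp [hfr, hσ₁]
      · rw [setReg_arr, setArr_arr, if_neg (by omega), hυ.frame _ _ (by omega)]
        simp [hσ₂]
      · simp
      · simp [hfr, hσ₁]
      · simp [hfr, hσ₁]
      · simp [hfr, hσ₁]
      · intro j p hp
        have hj : j < F.args.length := by
          rw [← hcl]
          exact (List.getElem?_eq_some_iff.1 hp).1
        simpa [CellAt] using hυ.cell j p hj hp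
  · intro x y hx
    rw [← h.frame x y hx, setReg_arr, setArr_arr, if_neg (by omega),
      hfr x y (by omega) (by omega), hσ₁]
    simp
    repeat rw [if_neg (by omega)]

/-- Telescoping: bounds proportional to the number of cells of each atom add up to a linear bound.
-/
theorem sum_start (l : List Atom) (c d : ℕ) (n : ℕ) :
    ∑ a ∈ Finset.Ico 0 n, (c * (start l (a + 1) - start l a) + d) = c * (start l n - 1) + d * n := by
  induction n with
  | zero => simp [start_zero]
  | succ n ih =>
    rw [Finset.sum_Ico_succ_top (Nat.zero_le n), ih]
    have h1 := start_mono l (Nat.zero_le n)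
    have h2 := start_mono l (Nat.le_succ n)
    rw [start_zero] at h1
    obtain ⟨u, hu⟩ := Nat.exists_eq_add_of_le h1
    obtain ⟨v, hv⟩ := Nat.exists_eq_add_of_le h2
    rw [hv, hu]
    simp only [Nat.add_sub_cancel_left]
    rw [show 1 + u + v - 1 = u + v by omega]
    ring

theorem length_lt_start (l : List Atom) : l.length < start l l.length := by
  have : ∀ n, n ≤ l.length → n < start l n := by
    intro n hn
    induction n with
    | zero => simp [start_zero]
    | succ n ih =>
      have := start_succ (List.getElem?_eq_getElem (show n < l.length by omega))
      have := ih (by omega)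
      omega
  exact this _ le_rfl

/-- The encoding spends three symbols on an atom and four on each argument, the memory only one
address for the head and one per argument. Time bounds can therefore be stated in terms of the
number of addresses. -/
theorem start_le_size (q : SJFBCQ) : start q.atoms q.atoms.length ≤ q.size := by
  rw [start, List.take_length, SJFBCQ.size, SJFBCQ.encode, List.length_cons, List.length_flatMap,
    add_comm 1]
  refine Nat.add_le_add_right (List.sum_le_sum fun F _ => ?_) 1
  rw [Atom.encode_eq]
  simp only [List.length_cons, List.length_flatMap, encArg, List.length_nil, List.map_const',
    List.sum_replicate, F.cells_length, smul_eq_mul]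
  omega

/-- The state after reading the input. -/
structure Parsed (l : List Atom) (σ : State) : Prop where
  out : σ.out = []
  zero : σ.reg 0 = 0
  len : σ.reg 1 = l.length
  pos : σ.reg 2 = start l l.length
  fst_le : ∀ F ∈ l, ∀ p ∈ F.cells, p.2.fst ≤ σ.reg 3
  layout : Layout l σ.arr

theorem run_parse (q : SJFBCQ) : Run parse (State.init q.encode) fun t τ =>
    Parsed q.atoms τ ∧ (∀ x y, 12 < x → τ.arr x y = 0) ∧
      t ≤ 40 * start q.atoms q.atoms.length := by
  have hn := length_lt_start q.atoms
  refine Run.seq (Run.block ?_)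
  set σ₀ := List.foldl Instr.exec (State.init q.encode) _ with hσ₀
  have e0 : (State.init q.encode).arr 0 ((State.init q.encode).reg 0) = q.atoms.length := rfl
  simp [e0] at hσ₀
  have inv : ParseAtoms q.encode q.atoms σ₀ 0 σ₀ := by
    constructor
    · intro y
      rw [hσ₀]
      rfl
    · simp [hσ₀, SJFBCQ.encode]
    · rfl
    · rfl
    · simp [hσ₀]
    · simp [hσ₀, start_zero]
    · simp [hσ₀, State.init]
    · intro b F hb
      omega
    · intro b F hb
      omega
    · exact fun _ _ _ => rfl
  refine (Run.for (ParseAtoms q.encode q.atoms σ₀) q.atoms.length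
    -- An atom occupies one address more than it has arguments, so `30` per address covers `26` per
    -- argument plus `30`.
    (fun a => 30 * (start q.atoms (a + 1) - start q.atoms a)) (fun a σ h => ⟨h.idx, h.len⟩)
    (fun a σ _ ha h => ?_) (Nat.zero_le _) inv).mono fun t τ ⟨h, ht⟩ => ⟨?_, ?_, ?_⟩
  · have hF := List.getElem?_eq_getElem ha
    have := start_succ hF
    refine (run_parseAtom hF h).mono fun t τ ⟨h1, h2⟩ => ⟨h1, ?_⟩
    omega
  · refine ⟨by rw [h.out, hσ₀]; rfl, by rw [h.zero, hσ₀]; rfl, h.len, h.pos, ?_, ?_⟩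
    · intro F hF p hp
      obtain ⟨b, hb, rfl⟩ := List.getElem_of_mem hF
      exact h.fst_le b _ hb (List.getElem?_eq_getElem hb) p hp
    · exact fun a F hF => h.atomAt a F (List.getElem?_eq_some_iff.1 hF).1 hF
  · intro x y hx
    rw [h.frame x y hx, hσ₀]
    simp only [setReg_arr, State.init]
    rw [if_neg (by omega)]
  · rw [sum_start] at ht
    simp only [List.length_cons, List.length_nil]
    omega

/-! ## Numbering the variables -/

/-- The variable stored at address `o`, if any. -/
def varAt (A : ℕ → ℕ → ℕ) (o : ℕ) : Option Var :=
  if A 2 o = 0 then some ⟨false, A 3 o⟩ else if A 2 o = 1 then some ⟨true, A 3 o⟩ else none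

/-- The first address before `o` that holds the variable `x`, or `0`. -/
def firstOcc (A : ℕ → ℕ → ℕ) (x : Var) : ℕ → ℕ
  | 0 => 0
  | o + 1 => if firstOcc A x o = 0 ∧ varAt A o = some x then o else firstOcc A x o

/-- The number of the variable at address `o`, or `0` if there is none. -/
def vid (A : ℕ → ℕ → ℕ) (o : ℕ) : ℕ :=
  match varAt A o with
  | none => 0
  | some x => firstOcc A x (o + 1)

theorem varAt_firstOcc {A : ℕ → ℕ → ℕ} {x : Var} {o : ℕ} (h : firstOcc A x o ≠ 0) :
    varAt A (firstOcc A x o) = some x := by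
  induction o with
  | zero => exact absurd rfl h
  | succ o ih =>
    rw [firstOcc] at h ⊢
    split_ifs at h ⊢ with hc
    · exact hc.2
    · exact ih h

theorem firstOcc_lt {A : ℕ → ℕ → ℕ} {x : Var} {o : ℕ} (h : 0 < o) : firstOcc A x o < o := by
  induction o with
  | zero => omega
  | succ o ih =>
    rw [firstOcc]
    split_ifs
    · omega
    · rcases Nat.eq_zero_or_pos o with rfl | ho
      · simp [firstOcc]
      · have := ih ho
        omega

theorem firstOcc_stable {A : ℕ → ℕ → ℕ} {x : Var} {o o' : ℕ} (hoo : o ≤ o')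
    (h : firstOcc A x o ≠ 0) : firstOcc A x o' = firstOcc A x o := by
  induction o', hoo using Nat.le_induction with
  | base => rfl
  | succ k _ ih => rw [firstOcc, if_neg (by simp [ih, h]), ih]

theorem firstOcc_ne_zero {A : ℕ → ℕ → ℕ} {x : Var} {o : ℕ} (ho : o ≠ 0)
    (h : varAt A o = some x) : firstOcc A x (o + 1) ≠ 0 := by
  rw [firstOcc]
  split_ifs with hc
  · exact ho
  · tauto

theorem vid_lt {A : ℕ → ℕ → ℕ} {o n : ℕ} (h : o < n) : vid A o < n := by
  unfold vid
  split
  · omega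
  · exact (firstOcc_lt (by omega)).trans_le h

/-- Once found, a first occurrence never changes, and it determines the variable. All addresses
without a variable share the number `0`, which is no address in use. -/
theorem vid_eq_iff {A : ℕ → ℕ → ℕ} {o o' : ℕ} (ho : o ≠ 0) (ho' : o' ≠ 0) :
    vid A o = vid A o' ↔ varAt A o = varAt A o' := by
  unfold vid
  cases h : varAt A o with
  | none =>
    cases h' : varAt A o' with
    | none => simp
    | some y => simpa using (firstOcc_ne_zero ho' h').symm
  | some x =>
    have hx := firstOcc_ne_zero ho h
    cases h' : varAt A o' with
    | none => simpa using hx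
    | some y =>
      have hy := firstOcc_ne_zero ho' h'
      simp only [Option.some.injEq]
      constructor
      · intro e
        have h1 := varAt_firstOcc hx
        rw [e, varAt_firstOcc hy] at h1
        exact (Option.some.inj h1).symm
      · rintro rfl
        rcases le_total (o + 1) (o' + 1) with hl | hl
        · exact (firstOcc_stable hl hx).symm
        · exact firstOcc_stable hl hy

theorem vid_eq_zero_iff {A : ℕ → ℕ → ℕ} {o : ℕ} (ho : o ≠ 0) : vid A o = 0 ↔ varAt A o = none := by
  unfold vid
  cases h : varAt A o with
  | none => simp
  | some x => simpa using firstOcc_ne_zero ho h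

theorem varAt_congr {A B : ℕ → ℕ → ℕ} (h : ∀ x y, 1 ≤ x → x ≤ 12 → B x y = A x y) :
    varAt B = varAt A := by
  funext o
  simp [varAt, h]

theorem firstOcc_congr {A B : ℕ → ℕ → ℕ} (h : varAt B = varAt A) : firstOcc B = firstOcc A := by
  funext x o
  induction o with
  | zero => rfl
  | succ o ih => rw [firstOcc, firstOcc, ih, h]

theorem vid_congr {A B : ℕ → ℕ → ℕ} (h : ∀ x y, 1 ≤ x → x ≤ 12 → B x y = A x y) :
    vid B = vid A := by
  funext o
  rw [vid, vid, firstOcc_congr (varAt_congr h), varAt_congr h]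

def lookVar (ar : ℕ) : Prog :=
  .seq (block [.load 14 ar 13])
    (.ite (.eq 14 0) (block [.store ar 13 10, .copy 14 10]) (block []))

/-- Arrays 13 and 14, one for each sort, are addressed by the index of the variable itself, so that
a lookup takes constant time however large the index is. Array 15 receives the numbers. -/
def numberVars : Prog :=
  .seq (block [.const 10 1, .const 11 1])
    (.loop (.lt 10 2)
      (.seq (block [.load 12 2 10, .load 13 3 10])
      (.seq (.ite (.eq 12 0) (lookVar 13)
          (.ite (.eq 12 11) (lookVar 14) (block [.const 14 0])))
        (block [.store 15 10 14, .succ 10]))))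

structure NumberVars (A : ℕ → ℕ → ℕ) (σ₀ : State) (o : ℕ) (σ : State) : Prop where
  out : σ.out = σ₀.out
  regs : ∀ r, r < 10 → σ.reg r = σ₀.reg r
  idx : σ.reg 10 = o
  one : σ.reg 11 = 1
  frame : ∀ x y, x < 13 ∨ 15 < x → σ.arr x y = A x y
  first : ∀ i, σ.arr 13 i = firstOcc A ⟨false, i⟩ o
  first' : ∀ i, σ.arr 14 i = firstOcc A ⟨true, i⟩ o
  num : ∀ o', 1 ≤ o' → o' < o → σ.arr 15 o' = vid A o'

theorem run_numberVars {σ : State} (h0 : σ.reg 0 = 0) (h2 : 1 ≤ σ.reg 2)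
    (hz : ∀ x y, 12 < x → σ.arr x y = 0) :
    Run numberVars σ fun t τ => NumberVars σ.arr σ (σ.reg 2) τ ∧ t ≤ 20 * σ.reg 2 := by
  refine Run.seq (Run.block ?_)
  refine (Run.for_const (NumberVars σ.arr σ) (σ.reg 2) 18 (fun o τ h => ⟨h.idx, h.regs 2 (by omega)⟩)
    (fun o τ ho1 ho h => ?_) h2 ?_).mono fun t τ ⟨h, ht⟩ => ⟨h, ?_⟩
  · have hr0 : τ.reg 0 = 0 := (h.regs 0 (by omega)).trans h0
    have e2 : τ.arr 2 o = σ.arr 2 o := h.frame _ _ (by omega)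
    have e3 : τ.arr 3 o = σ.arr 3 o := h.frame _ _ (by omega)
    refine Run.seq (Run.block ?_)
    refine Run.seq (Run.ite (fun hb => ?_) fun hb => Run.ite (fun hb' => ?_) fun hb' => ?_)
    · simp [Test.Holds, h.idx, hr0, e2, e3] at hb ⊢
      have hv : varAt σ.arr o = some ⟨false, σ.arr 3 o⟩ := by simp [varAt, hb]
      refine Run.seq (Run.block (Run.ite (fun hc => Run.block (Run.block ?_))
        fun hc => Run.block (Run.block ?_)))
      · simp [Test.Holds, h.idx, hr0, h.first] at hc ⊢
        constructor
        · simp [h.out]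
        · intro r hr
          rw [← h.regs r hr]
          simp
          iterate 5 rw [if_neg (by omega)]
        · simp
        · simp [h.one]
        · intro x y hxy
          rw [← h.frame x y hxy]
          simp
          iterate 2 rw [if_neg (by omega)]
        · intro i
          simp [firstOcc, hv, h.first]
          by_cases e : i = σ.arr 3 o
          · simp [e, hc]
          · simp [e, Ne.symm e]
        · intro i
          simp [firstOcc, hv, h.first']
        · intro o' h1 h2
          by_cases e : o' = o
          · subst e
            simp [vid, hv, firstOcc, hc]
          · simp [e, h.num o' h1 (by omega)]
      · simp [Test.Holds, h.idx, hr0, h.first] at hc ⊢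
        constructor
        · simp [h.out]
        · intro r hr
          rw [← h.regs r hr]
          simp
          iterate 4 rw [if_neg (by omega)]
        · simp
        · simp [h.one]
        · intro x y hxy
          rw [← h.frame x y hxy]
          simp
          intro e
          omega
        · intro i
          simp [firstOcc, hv, h.first]
          intro h1 h2
          rw [← h2] at h1
          exact absurd h1 hc
        · intro i
          simp [firstOcc, hv, h.first']
        · intro o' h1 h2
          by_cases e : o' = o
          · subst e
            simp [vid, hv, firstOcc, hc]
          · simp [e, h.num o' h1 (by omega)]
    · simp [Test.Holds, h.idx, h.one, hr0, e2, e3] at hb hb' ⊢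
      have hv : varAt σ.arr o = some ⟨true, σ.arr 3 o⟩ := by simp [varAt, hb']
      refine Run.seq (Run.block (Run.ite (fun hc => Run.block (Run.block ?_))
        fun hc => Run.block (Run.block ?_)))
      · simp [Test.Holds, h.idx, hr0, h.first'] at hc ⊢
        constructor
        · simp [h.out]
        · intro r hr
          rw [← h.regs r hr]
          simp
          iterate 5 rw [if_neg (by omega)]
        · simp
        · simp [h.one]
        · intro x y hxy
          rw [← h.frame x y hxy]
          simp
          iterate 2 rw [if_neg (by omega)]
        · intro i
          simp [firstOcc, hv, h.first]
        · intro i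
          simp [firstOcc, hv, h.first']
          by_cases e : i = σ.arr 3 o
          · simp [e, hc]
          · simp [e, Ne.symm e]
        · intro o' h1 h2
          by_cases e : o' = o
          · subst e
            simp [vid, hv, firstOcc, hc]
          · simp [e, h.num o' h1 (by omega)]
      · simp [Test.Holds, h.idx, hr0, h.first'] at hc ⊢
        constructor
        · simp [h.out]
        · intro r hr
          rw [← h.regs r hr]
          simp
          iterate 4 rw [if_neg (by omega)]
        · simp
        · simp [h.one]
        · intro x y hxy
          rw [← h.frame x y hxy]
          simp
          intro e
          omega
        · intro i
          simp [firstOcc, hv, h.first]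
        · intro i
          simp [firstOcc, hv, h.first']
          intro h1 h2
          rw [← h2] at h1
          exact absurd h1 hc
        · intro o' h1 h2
          by_cases e : o' = o
          · subst e
            simp [vid, hv, firstOcc, hc]
          · simp [e, h.num o' h1 (by omega)]
    · refine Run.block (Run.block ?_)
      simp [Test.Holds, h.idx, h.one, hr0, e2, e3] at hb hb' ⊢
      have hv : varAt σ.arr o = none := by simp [varAt, hb, hb']
      constructor
      · simp [h.out]
      · intro r hr
        rw [← h.regs r hr]
        simp
        iterate 4 rw [if_neg (by omega)]
      · simp
      · simp [h.one]
      · intro x y hxy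
        rw [← h.frame x y hxy]
        simp
        intro e
        omega
      · intro i
        simp [firstOcc, hv, h.first]
      · intro i
        simp [firstOcc, hv, h.first']
      · intro o' h1 h2
        by_cases e : o' = o
        · subst e
          simp [vid, hv]
        · simp [e, h.num o' h1 (by omega)]
  · constructor
    · rfl
    · intro r hr
      simp
      iterate 2 rw [if_neg (by omega)]
    · simp
    · simp
    · exact fun _ _ _ => rfl
    · intro i
      simp [firstOcc, hz]
    · intro i
      simp [firstOcc, hz]
    · intro o' h1 h2
      omega
  · simp
    omega

/-! ## Lists of the occurrences of each variable -/

/-- The last address before `o` that has the property `P`, or `0`. -/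
def prevOcc (P : ℕ → Prop) [DecidablePred P] : ℕ → ℕ
  | 0 => 0
  | o + 1 => if o ≠ 0 ∧ P o then o else prevOcc P o

/-- Links the addresses whose key flag is at least `thr` and that hold the same variable. -/
def linkOccs (hd nx thr : ℕ) : Prog :=
  .seq (block [.const 10 1, .const 14 thr])
    (.loop (.lt 10 2)
      (.seq (block [.load 12 15 10, .load 13 6 10])
      (.seq (.ite (.le 14 13) (block [.load 15 hd 12, .store nx 10 15, .store hd 12 10]) (block []))
        (block [.succ 10]))))

structure LinkOccs (hd nx thr : ℕ) (σ₀ : State) (o : ℕ) (σ : State) : Prop where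
  out : σ.out = σ₀.out
  regs : ∀ r, r < 10 → σ.reg r = σ₀.reg r
  idx : σ.reg 10 = o
  bound : σ.reg 14 = thr
  frame : ∀ x y, x ≠ hd → x ≠ nx → σ.arr x y = σ₀.arr x y
  head : ∀ v, σ.arr hd v = prevOcc (fun o => thr ≤ σ₀.arr 6 o ∧ σ₀.arr 15 o = v) o
  next : ∀ o', 1 ≤ o' → o' < o → thr ≤ σ₀.arr 6 o' →
    σ.arr nx o' = prevOcc (fun o => thr ≤ σ₀.arr 6 o ∧ σ₀.arr 15 o = σ₀.arr 15 o') o'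

theorem run_linkOccs {hd nx thr : ℕ} (hhd : 15 < hd) (hnx : 15 < nx) (hne : hd ≠ nx) {σ : State}
    (h2 : 1 ≤ σ.reg 2) (hz : ∀ y, σ.arr hd y = 0) :
    Run (linkOccs hd nx thr) σ fun t τ => LinkOccs hd nx thr σ (σ.reg 2) τ ∧ t ≤ 13 * σ.reg 2 := by
  refine Run.seq (Run.block ?_)
  refine (Run.for_const (LinkOccs hd nx thr σ) (σ.reg 2) 11
    (fun o τ h => ⟨h.idx, h.regs 2 (by omega)⟩)
    (fun o τ ho1 ho h => ?_) h2 ?_).mono fun t τ ⟨h, ht⟩ => ⟨h, ?_⟩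
  · have e6 : τ.arr 6 o = σ.arr 6 o := h.frame _ _ (by omega) (by omega)
    have e15 : τ.arr 15 o = σ.arr 15 o := h.frame _ _ (by omega) (by omega)
    refine Run.seq (Run.block ?_)
    refine Run.seq (Run.ite (fun hb => Run.block (Run.block ?_)) fun hb => Run.block (Run.block ?_))
    · simp [Test.Holds, h.idx, h.bound, e6, e15, h.head] at hb ⊢
      constructor
      · simp [h.out]
      · intro r hr
        rw [← h.regs r hr]
        simp
        iterate 4 rw [if_neg (by omega)]
      · simp
      · simp [h.bound]
      · intro x y h1 h2
        rw [← h.frame x y h1 h2]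
        simp [h1, h2]
      · intro v
        by_cases e : v = σ.arr 15 o
        · subst e
          simp [prevOcc, hb]
          omega
        · simp [prevOcc, hb, hne, e, Ne.symm e, h.head]
      · intro o' h1 h2 h3
        by_cases e : o' = o
        · subst e
          simp [hne.symm]
        · simp [e, hne.symm, h.next o' h1 (by omega) h3]
    · simp [Test.Holds, h.idx, h.bound, e6, e15] at hb ⊢
      constructor
      · simp [h.out]
      · intro r hr
        rw [← h.regs r hr]
        simp
        iterate 3 rw [if_neg (by omega)]
      · simp
      · simp [h.bound]
      · intro x y h1 h2
        rw [← h.frame x y h1 h2]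
        simp
      · intro v
        simp [prevOcc, hb, h.head]
      · intro o' h1 h2 h3
        have e : o' ≠ o := by
          rintro rfl
          omega
        simp [h.next o' h1 (by omega) h3]
  · constructor
    · rfl
    · intro r hr
      simp
      iterate 2 rw [if_neg (by omega)]
    · simp
    · simp
    · exact fun _ _ _ _ => rfl
    · intro i
      simp [prevOcc, hz]
    · intro o' h1 h2
      omega
  · simp
    omega

/-! ## Propagation: closing a set of variables under rules with thresholds -/

theorem prevOcc_spec {P : ℕ → Prop} [DecidablePred P] {b : ℕ} (h : prevOcc P b ≠ 0) :
    P (prevOcc P b) ∧ prevOcc P b < b ∧ ∀ o, prevOcc P b < o → o < b → ¬ P o := by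
  induction b with
  | zero => exact absurd rfl h
  | succ b ih =>
    rw [prevOcc] at h ⊢
    split_ifs at h ⊢ with hc
    · exact ⟨hc.2, by omega, fun o h1 h2 => by omega⟩
    · obtain ⟨h1, h2, h3⟩ := ih h
      refine ⟨h1, by omega, fun o h4 h5 hP => ?_⟩
      rcases Nat.lt_succ_iff_lt_or_eq.1 h5 with h5 | rfl
      · exact h3 o h4 h5 hP
      · exact hc ⟨by omega, hP⟩

theorem prevOcc_eq_zero {P : ℕ → Prop} [DecidablePred P] {b : ℕ} (h : prevOcc P b = 0) :
    ∀ o, 1 ≤ o → o < b → ¬ P o := by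
  induction b with
  | zero => intro o h1 h2; omega
  | succ b ih =>
    rw [prevOcc] at h
    split_ifs at h with hc
    · exact absurd h hc.1
    · intro o h1 h2 hP
      rcases Nat.lt_succ_iff_lt_or_eq.1 h2 with h2 | rfl
      · exact ih h o h1 h2 hP
      · exact hc ⟨by omega, hP⟩

/-- Adds the variables at the addresses from register 20 to register 21 to the queue. -/
def addRange : Prog :=
  .loop (.lt 20 21)
    (.seq (block [.load 22 15 20, .load 23 21 22])
    (.seq (.ite (.eq 23 0) (block [.store 21 22 16, .store 22 11 22, .succ 11]) (block []))
      (block [.succ 20])))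

/-- The queue holds `Q`; the variables in `Q` and those that satisfy `M` are marked. -/
structure Queue (M : ℕ → Prop) (Q : List ℕ) (σ : State) : Prop where
  len : σ.reg 11 = Q.length
  get : ∀ i v, Q[i]? = some v → σ.arr 22 i = v
  nodup : Q.Nodup
  disj : ∀ v ∈ Q, ¬ M v
  mark : ∀ v, σ.arr 21 v = 0 ↔ ¬ M v ∧ v ∉ Q

theorem Queue.congr {M : ℕ → Prop} {Q : List ℕ} {σ τ : State} (h : Queue M Q σ)
    (h1 : τ.reg 11 = σ.reg 11) (h2 : τ.arr 22 = σ.arr 22) (h3 : τ.arr 21 = σ.arr 21) :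
    Queue M Q τ :=
  ⟨h1.trans h.len, by rw [h2]; exact h.get, h.nodup, h.disj, by rw [h3]; exact h.mark⟩

/-- `R` lists the newly queued numbers. That there are at most as many as scanned addresses is what
pays for their later processing. -/
structure AddRange (M : ℕ → Prop) (Q : List ℕ) (s e : ℕ) (σ₀ : State) (i : ℕ) (σ : State) (R : List ℕ) :
    Prop where
  queue : Queue M (Q ++ R) σ
  sound : ∀ v ∈ R, ∃ o, s ≤ o ∧ o < i ∧ v = σ₀.arr 15 o
  complete : ∀ o, s ≤ o → o < i → M (σ₀.arr 15 o) ∨ σ₀.arr 15 o ∈ Q ++ R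
  length : R.length + s ≤ i
  regs : ∀ r, r ≠ 11 → r ≠ 20 → r ≠ 22 → r ≠ 23 → σ.reg r = σ₀.reg r
  idx : σ.reg 20 = i
  frame : ∀ x y, x ≠ 21 → x ≠ 22 → σ.arr x y = σ₀.arr x y
  out : σ.out = σ₀.out

theorem run_addRange {M : ℕ → Prop} {Q : List ℕ} {σ : State} (h0 : σ.reg 0 = 0)
    (h16 : σ.reg 16 = 1) (hle : σ.reg 20 ≤ σ.reg 21) (hQ : Queue M Q σ) :
    Run addRange σ fun t τ => (∃ R, AddRange M Q (σ.reg 20) (σ.reg 21) σ (σ.reg 21) τ R) ∧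
      t ≤ 12 * (σ.reg 21 - σ.reg 20) + 1 := by
  refine Run.for_const (fun i τ => ∃ R, AddRange M Q (σ.reg 20) (σ.reg 21) σ i τ R) (σ.reg 21) 11
    ?_ ?_ hle ?_
  · rintro i τ ⟨R, h⟩
    exact ⟨h.idx, h.regs 21 (by omega) (by omega) (by omega) (by omega)⟩
  · rintro i τ hi1 hi2 ⟨R, h⟩
    have e15 : τ.arr 15 i = σ.arr 15 i := h.frame _ _ (by omega) (by omega)
    have r16 : τ.reg 16 = 1 := (h.regs 16 (by omega) (by omega) (by omega) (by omega)).trans h16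
    have r0 : τ.reg 0 = 0 := (h.regs 0 (by omega) (by omega) (by omega) (by omega)).trans h0
    have hlen := h.length
    refine Run.seq (Run.block ?_)
    refine Run.seq (Run.ite (fun hb => Run.block (Run.block ?_)) fun hb => Run.block (Run.block ?_))
    · simp [Test.Holds, h.idx, e15, r0] at hb
      simp [h.idx, e15, r16]
      rw [h.queue.mark] at hb
      refine ⟨R ++ [σ.arr 15 i], ?_⟩
      constructor
      · constructor
        · simp [h.queue.len]; omega
        · intro j v hj
          rw [← List.append_assoc, List.getElem?_append] at hj
          split_ifs at hj with hjl
          · have : j ≠ (Q ++ R).length := by omega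
            rw [← h.queue.len] at this
            simp [this, h.queue.get j v hj]
          · rw [List.getElem?_singleton] at hj
            split_ifs at hj with hj0
            have : j = (Q ++ R).length := by omega
            rw [← h.queue.len] at this
            simp [this, Option.some.inj hj]
        · rw [← List.append_assoc]
          exact List.nodup_append_comm.1 (List.nodup_cons.2 ⟨hb.2, h.queue.nodup⟩)
        · intro v hv
          rw [← List.append_assoc, List.mem_append, List.mem_singleton] at hv
          rcases hv with hv | rfl
          exacts [h.queue.disj v hv, hb.1]
        · intro v
          have := h.queue.mark v
          by_cases e : v = σ.arr 15 i
          · simp [e]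
          · simp [e, this]
      · intro v hv
        rw [List.mem_append, List.mem_singleton] at hv
        rcases hv with hv | rfl
        · obtain ⟨o, h1, h2, h3⟩ := h.sound v hv
          exact ⟨o, h1, by omega, h3⟩
        · exact ⟨i, hi1, by omega, rfl⟩
      · intro o h1 h2
        rcases Nat.lt_succ_iff_lt_or_eq.1 h2 with h2 | rfl
        · rcases h.complete o h1 h2 with h | h
          · exact Or.inl h
          · exact Or.inr (by rw [← List.append_assoc]; exact List.mem_append_left _ h)
        · exact Or.inr (by simp)
      · simp; omega
      · intro r h1 h2 h3 h4
        rw [← h.regs r h1 h2 h3 h4]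
        simp [*]
      · simp
      · intro x y h1 h2
        rw [← h.frame x y h1 h2]
        simp [*]
      · simp [h.out]
    · simp [Test.Holds, h.idx, e15, r0] at hb
      simp [h.idx, e15]
      rw [h.queue.mark] at hb
      refine ⟨R, ?_⟩
      constructor
      · exact h.queue.congr (by simp) rfl rfl
      · intro v hv
        obtain ⟨o, h1, h2, h3⟩ := h.sound v hv
        exact ⟨o, h1, by omega, h3⟩
      · intro o h1 h2
        rcases Nat.lt_succ_iff_lt_or_eq.1 h2 with h2 | rfl
        · exact h.complete o h1 h2
        · tauto
      · omega
      · intro r h1 h2 h3 h4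
        rw [← h.regs r h1 h2 h3 h4]
        simp [*]
      · simp
      · intro x y h1 h2
        rw [← h.frame x y h1 h2]
        simp
      · simp [h.out]
  · refine ⟨[], ?_⟩
    constructor
    · simpa using hQ
    · simp
    · intro o h1 h2; omega
    · simp
    · exact fun _ _ _ _ _ => rfl
    · rfl
    · exact fun _ _ _ _ => rfl
    · rfl

/-- The addresses from `1` to `N` are divided among the atoms `0, …, n - 1`. -/
structure Env (A : ℕ → ℕ → ℕ) (n N : ℕ) : Prop where
  atom_lt : ∀ o, 1 ≤ o → o < N → A 5 o < n ∧ A 10 (A 5 o) ≤ o ∧ o < A 12 (A 5 o)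
  range : ∀ a, a < n → 1 ≤ A 10 a ∧ A 10 a < A 12 a ∧ A 12 a ≤ N
  sum : ∑ a ∈ Finset.range n, (A 12 a - A 10 a) ≤ N

/-- The addresses with key flag at least `thr` are linked by `hd` and `nx`. -/
structure Links (A : ℕ → ℕ → ℕ) (hd nx thr N : ℕ) : Prop where
  head : ∀ v, A hd v = prevOcc (fun o => thr ≤ A 6 o ∧ A 15 o = v) N
  next : ∀ o, 1 ≤ o → o < N → thr ≤ A 6 o →
    A nx o = prevOcc (fun o' => thr ≤ A 6 o' ∧ A 15 o' = A 15 o) o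

/-- The counting algorithm: take a number from the queue, walk through the list of its addresses and
lower the counter of the atom at each of them. When a counter drops to `0`, the atom fires and all
its variables are queued. A counter that is `0` already belongs to an atom that has fired or was
disabled from the start. -/
def propagate (hd nx : ℕ) : Prog :=
  .loop (.lt 10 11)
    (.seq (block [.load 12 22 10, .succ 10, .load 13 hd 12])
      (.loop (.ne 13 0)
        (.seq (block [.load 14 5 13, .load 15 20 14])
        (.seq (.ite (.ne 15 0)
            (.seq (block [.pred 15, .store 20 14 15])
              (.ite (.eq 15 0) (.seq (block [.load 20 10 14, .load 21 12 14]) addRange) (block [])))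
            (block []))
          (block [.load 13 nx 13])))))

/-- The addresses that have triggered: those of the variables in `Q`, and those of `v` from `b` on. -/
def visited (A : ℕ → ℕ → ℕ) (thr N : ℕ) (Q : List ℕ) (v b : ℕ) : Finset ℕ :=
  (Finset.Ico 1 N).filter fun o => thr ≤ A 6 o ∧ (A 15 o ∈ Q ∨ (A 15 o = v ∧ b ≤ o))

/-- The number of addresses of atom `a` in `W`. -/
def trigCount (A : ℕ → ℕ → ℕ) (W : Finset ℕ) (a : ℕ) : ℕ := (W.filter fun o => A 5 o = a).card

theorem trigCount_mono {A : ℕ → ℕ → ℕ} {W W' : Finset ℕ} (h : W ⊆ W') (a : ℕ) :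
    trigCount A W a ≤ trigCount A W' a :=
  Finset.card_le_card (Finset.filter_subset_filter _ h)

theorem trigCount_insert {A : ℕ → ℕ → ℕ} {W : Finset ℕ} {o : ℕ} (h : o ∉ W) (a : ℕ) :
    trigCount A (insert o W) a = trigCount A W a + if A 5 o = a then 1 else 0 := by
  unfold trigCount
  rw [Finset.filter_insert]
  split_ifs with hc
  · rw [Finset.card_insert_of_notMem (by simp [h])]
  · rfl

open Classical in
/-- `c` are the thresholds; every atom whose threshold is positive and reached by triggers in `G`
has its variables in `G`, up to those that satisfy `M`. -/
def ClosedUnder (A : ℕ → ℕ → ℕ) (n N thr : ℕ) (c : ℕ → ℕ) (M : ℕ → Prop) (G : ℕ → Prop) : Prop :=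
  ∀ a, a < n → 0 < c a →
    c a ≤ trigCount A ((Finset.Ico 1 N).filter fun o => thr ≤ A 6 o ∧ G (A 15 o)) a →
    ∀ o, A 10 a ≤ o → o < A 12 a → M (A 15 o) ∨ G (A 15 o)

/-- The sum of the lengths of the atoms that have not fired. -/
def unfired (A : ℕ → ℕ → ℕ) (n : ℕ) (cnt : ℕ → ℕ) : ℕ :=
  ∑ a ∈ Finset.range n, if cnt a = 0 then 0 else A 12 a - A 10 a

/-- `Qp` is the processed part of the queue, and `v` is the number in progress, whose addresses from
`b` on have triggered. The field `pot` is the amortised cost: `20` for each address that may still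
trigger, `30` for each cell of an unfired atom, `10` for each number waiting in the queue. Every
action is paid for by a drop of this potential. -/
structure PropInv (A : ℕ → ℕ → ℕ) (n N thr : ℕ) (c : ℕ → ℕ) (M G : ℕ → Prop) (Q₀ : List ℕ)
    (σ₀ : State) (Q Qp : List ℕ) (v b k : ℕ) (σ : State) : Prop where
  queue : Queue M Q σ
  init : Q₀ ⊆ Q
  good : ∀ v ∈ Q, G v
  cnt : ∀ a, a < n → σ.arr 20 a = c a - trigCount A (visited A thr N Qp v b) a
  fired : ∀ a, a < n → 0 < c a → σ.arr 20 a = 0 → ∀ o, A 10 a ≤ o → o < A 12 a →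
    M (A 15 o) ∨ A 15 o ∈ Q
  regs : ∀ r, r < 10 → σ.reg r = σ₀.reg r
  one : σ.reg 16 = 1
  frame : ∀ x y, x < 20 ∨ 22 < x → σ.arr x y = A x y
  out : σ.out = σ₀.out
  pot : 20 * (N - (visited A thr N Qp v b).card) + 30 * unfired A n (σ.arr 20) +
    10 * (Q.length - Qp.length) ≤ k

theorem visited_subset (A : ℕ → ℕ → ℕ) (thr N : ℕ) (Q : List ℕ) (v b : ℕ) :
    visited A thr N Q v b ⊆ Finset.Ico 1 N := Finset.filter_subset _ _

theorem card_visited_le (A : ℕ → ℕ → ℕ) (thr N : ℕ) (Q : List ℕ) (v b : ℕ) :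
    (visited A thr N Q v b).card ≤ N := by
  have := Finset.card_le_card (visited_subset A thr N Q v b)
  rw [Nat.card_Ico] at this
  omega

theorem visited_end (A : ℕ → ℕ → ℕ) (thr N : ℕ) (Q : List ℕ) (v v' : ℕ) :
    visited A thr N Q v N = visited A thr N Q v' N := by
  refine Finset.filter_congr fun o ho => ?_
  rw [Finset.mem_Ico] at ho
  have : ¬ N ≤ o := by omega
  simp [this]

theorem visited_step {A : ℕ → ℕ → ℕ} {thr N : ℕ} {Q : List ℕ} {v b p : ℕ} (hb : b ≤ N)
    (hv : v ∉ Q) (hp : p = prevOcc (fun o => thr ≤ A 6 o ∧ A 15 o = v) b) (h0 : p ≠ 0) :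
    p ∉ visited A thr N Q v b ∧ visited A thr N Q v p = insert p (visited A thr N Q v b) ∧
      1 ≤ p ∧ p < N ∧ A 15 p = v ∧ thr ≤ A 6 p := by
  rw [hp] at h0
  obtain ⟨⟨h1, h2⟩, h3, h4⟩ := prevOcc_spec h0
  rw [← hp] at h1 h2 h3 h4 h0
  have hpN : p < N := by omega
  have hp1 : 1 ≤ p := by omega
  refine ⟨?_, ?_, hp1, hpN, h2, h1⟩
  · simp [visited, h2, hv]
    omega
  · ext o
    simp only [visited, Finset.mem_filter, Finset.mem_Ico, Finset.mem_insert]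
    constructor
    · rintro ⟨ho, ht, h | ⟨h, h'⟩⟩
      · exact Or.inr ⟨ho, ht, Or.inl h⟩
      · by_cases e : o = p
        · exact Or.inl e
        · refine Or.inr ⟨ho, ht, Or.inr ⟨h, ?_⟩⟩
          by_contra hlt
          exact h4 o (by omega) (by omega) ⟨ht, h⟩
    · rintro (rfl | ⟨ho, ht, h | ⟨h, h'⟩⟩)
      · exact ⟨⟨hp1, hpN⟩, h1, Or.inr ⟨h2, le_rfl⟩⟩
      · exact ⟨ho, ht, Or.inl h⟩
      · exact ⟨ho, ht, Or.inr ⟨h, by omega⟩⟩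

theorem visited_finish {A : ℕ → ℕ → ℕ} {thr N : ℕ} {Q : List ℕ} {v b v' : ℕ}
    (h0 : prevOcc (fun o => thr ≤ A 6 o ∧ A 15 o = v) b = 0) :
    visited A thr N Q v b = visited A thr N (Q ++ [v]) v' N := by
  refine Finset.filter_congr fun o ho => ?_
  rw [Finset.mem_Ico] at ho
  have hN : ¬ N ≤ o := by omega
  have := prevOcc_eq_zero h0 o ho.1
  simp [hN]
  intro ht
  constructor
  · tauto
  · rintro (h | h)
    · exact Or.inl h
    · refine Or.inr ⟨h, ?_⟩
      by_contra hlt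
      exact this (by omega) ⟨ht, h⟩

theorem unfired_fire {A : ℕ → ℕ → ℕ} {n : ℕ} {cnt cnt' : ℕ → ℕ} {a : ℕ} (ha : a < n)
    (h : cnt a ≠ 0) (h' : cnt' a = 0) (hne : ∀ b, b ≠ a → cnt' b = cnt b) :
    unfired A n cnt' + (A 12 a - A 10 a) = unfired A n cnt := by
  unfold unfired
  rw [← Finset.add_sum_erase _ _ (Finset.mem_range.2 ha),
    ← Finset.add_sum_erase _ _ (Finset.mem_range.2 ha), if_pos h', if_neg h, zero_add, add_comm]
  congr 1
  refine Finset.sum_congr rfl fun b hb => ?_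
  rw [hne b (Finset.ne_of_mem_erase hb)]

theorem unfired_congr {A : ℕ → ℕ → ℕ} {n : ℕ} {cnt cnt' : ℕ → ℕ}
    (h : ∀ b, cnt' b = 0 ↔ cnt b = 0) : unfired A n cnt' = unfired A n cnt := by
  simp only [unfired, h]

theorem unfired_le {A : ℕ → ℕ → ℕ} {n N : ℕ} (h : Env A n N) (cnt : ℕ → ℕ) :
    unfired A n cnt ≤ N := by
  refine le_trans (Finset.sum_le_sum fun a _ => ?_) h.sum
  split_ifs <;> omega

/-- Soundness of firing: all addresses that have triggered hold elements of `G`, so the closedness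
of `G` applies to the atom that fires. -/
theorem trigCount_good {A : ℕ → ℕ → ℕ} {n N thr : ℕ} {c : ℕ → ℕ} {M G : ℕ → Prop}
    (hG : ClosedUnder A n N thr c M G) {Q Qp : List ℕ} {v b a : ℕ} (hgood : ∀ v ∈ Q, G v)
    (hpre : Qp ++ [v] <+: Q) (ha : a < n) (hc : 0 < c a)
    (hle : c a ≤ trigCount A (visited A thr N Qp v b) a) :
    ∀ o, A 10 a ≤ o → o < A 12 a → M (A 15 o) ∨ G (A 15 o) := by
  classical
  refine hG a ha hc (hle.trans (trigCount_mono (fun o ho => ?_) a))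
  simp only [visited, Finset.mem_filter] at ho ⊢
  refine ⟨ho.1, ho.2.1, hgood _ (hpre.subset ?_)⟩
  rcases ho.2.2 with h | h
  · exact List.mem_append_left _ h
  · simp [h.1]

/-- One address triggers. Its atom fires, or has its counter lowered to a positive value, or had
counter `0` before. -/
theorem run_trigger {A : ℕ → ℕ → ℕ} {n N thr hd nx : ℕ} {c : ℕ → ℕ} {M G : ℕ → Prop}
    {Q₀ : List ℕ} {σ₀ : State} (hE : Env A n N) (hL : Links A hd nx thr N)
    (hnx : nx < 20) (hG : ClosedUnder A n N thr c M G) (h0 : σ₀.reg 0 = 0) {Qp : List ℕ} {v : ℕ}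
    {k : ℕ} {σ : State} {Q : List ℕ} {b : ℕ}
    (h : PropInv A n N thr c M G Q₀ σ₀ Q Qp v b k σ) (h10 : σ.reg 10 = Qp.length + 1)
    (h13 : σ.reg 13 = prevOcc (fun o => thr ≤ A 6 o ∧ A 15 o = v) b) (hbN : b ≤ N)
    (hpre : Qp ++ [v] <+: Q) (hne : σ.reg 13 ≠ 0) :
    Run (.seq (block [.load 14 5 13, .load 15 20 14])
        (.seq (.ite (.ne 15 0)
            (.seq (block [.pred 15, .store 20 14 15])
              (.ite (.eq 15 0) (.seq (block [.load 20 10 14, .load 21 12 14]) addRange) (block [])))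
            (block []))
          (block [.load 13 nx 13]))) σ fun t τ => ∃ k', (∃ Q' b',
      PropInv A n N thr c M G Q₀ σ₀ Q' Qp v b' k' τ ∧ τ.reg 10 = Qp.length + 1 ∧
      τ.reg 13 = prevOcc (fun o => thr ≤ A 6 o ∧ A 15 o = v) b' ∧ b' ≤ N ∧ Qp ++ [v] <+: Q') ∧
      k' + t + 1 ≤ k := by
  obtain ⟨p, hp⟩ : ∃ p, p = σ.reg 13 := ⟨_, rfl⟩
  have hvQ : v ∉ Qp := by
    have := hpre.sublist.nodup h.queue.nodup
    rw [List.nodup_append_comm] at this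
    exact (List.nodup_cons.1 this).1
  obtain ⟨hpv, hvis, hp1, hpN, hpv', hpt⟩ := visited_step hbN hvQ (hp.trans h13) (hp ▸ hne)
  obtain ⟨ha, ha1, ha2⟩ := hE.atom_lt p hp1 hpN
  set a := A 5 p with hadef
  have hr0 : σ.reg 0 = 0 := (h.regs 0 (by omega)).trans h0
  have e5 : σ.arr 5 p = a := h.frame _ _ (by omega)
  have hnext : A nx p = prevOcc (fun o => thr ≤ A 6 o ∧ A 15 o = v) p := by
    rw [hL.next p hp1 hpN hpt]
    simp only [hpv']
  have hcnt := h.cnt a ha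
  have hins := trigCount_insert (A := A) hpv
  have hcard : (visited A thr N Qp v p).card = (visited A thr N Qp v b).card + 1 := by
    rw [hvis, Finset.card_insert_of_notMem hpv]
  have hcardN := card_visited_le A thr N Qp v p
  have hpot := h.pot
  obtain ⟨f1, f2, f3⟩ := hE.range a ha
  refine Run.seq (Run.block ?_)
  refine Run.seq (Run.ite (fun hb => ?_) fun hb => ?_)
  · simp [Test.Holds, ← hp, e5, hr0] at hb
    refine Run.seq (Run.block (Run.ite (fun hz => ?_) fun hz => ?_))
    · simp [Test.Holds, ← hp, e5, hr0] at hz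
      refine Run.seq (Run.block ?_)
      set σ₁ := List.foldl Instr.exec (List.foldl Instr.exec (List.foldl Instr.exec σ _) _) _
        with hσ₁
      have e10 : σ.arr 10 a = A 10 a := h.frame _ _ (by omega)
      have e12 : σ.arr 12 a = A 12 a := h.frame _ _ (by omega)
      simp [← hp, e5, e10, e12] at hσ₁
      have hr20 : σ₁.reg 20 = A 10 a := by simp [hσ₁]
      have hr21 : σ₁.reg 21 = A 12 a := by simp [hσ₁]
      have hA15 : ∀ o, σ₁.arr 15 o = A 15 o := fun o => by
        rw [← h.frame 15 o (by omega), hσ₁]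
        simp
      have hle : c a ≤ trigCount A (visited A thr N Qp v p) a := by
        rw [hvis, hins, if_pos rfl]
        omega
      have hheads := trigCount_good hG h.good hpre ha (by omega) hle
      refine (run_addRange (σ := σ₁) (M := M) (Q := Q) (by simp [hσ₁, hr0]) (by simp [hσ₁, h.one])
        (by omega) (h.queue.congr (by simp [hσ₁]) (by funext y; simp [hσ₁])
          (by funext y; simp [hσ₁]))).mono ?_
      rintro t τ ⟨⟨R, hR⟩, ht⟩
      rw [hr20, hr21] at ht hR
      have hRlen := hR.length
      have hRr : ∀ r, r ≠ 11 → r < 20 → τ.reg r = σ₁.reg r := fun r h1 h2 =>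
        hR.regs r h1 (by omega) (by omega) (by omega)
      have hτ13 : τ.reg 13 = p := by
        rw [hRr 13 (by omega) (by omega), hσ₁]
        simp [← hp]
      have hτf : ∀ x y, x < 20 ∨ 22 < x → τ.arr x y = A x y := fun x y hx => by
        rw [hR.frame x y (by omega) (by omega), ← h.frame x y hx, hσ₁]
        simp
        omega
      have hτ20 : ∀ y, τ.arr 20 y = if y = a then σ.arr 20 a - 1 else σ.arr 20 y := fun y => by
        rw [hR.frame 20 y (by omega) (by omega), hσ₁]
        simp
      have hunf := unfired_fire (A := A) ha hb (cnt' := τ.arr 20) (by rw [hτ20]; simp; omega)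
        (fun b hb => by rw [hτ20, if_neg hb])
      refine Run.block ?_
      simp [hτ13, hτf nx p (Or.inl hnx), hnext]
      -- The potential loses `20` for the address and `30` per cell of the fired atom, and gains at
      -- most `10` per cell for new queue entries; this covers `12` steps per cell and the overhead.
      refine ⟨k - 12 * (A 12 a - A 10 a) - 17, ⟨Q ++ R, p, ?_, ?_, ?_, by omega,
        hpre.trans (List.prefix_append _ _)⟩, ?_⟩
      · constructor
        · exact hR.queue.congr (by simp) rfl rfl
        · exact List.subset_append_of_subset_left _ h.init
        · intro w hw
          rcases List.mem_append.1 hw with hw' | hw'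
          · exact h.good w hw'
          · obtain ⟨o, o1, o2, rfl⟩ := hR.sound w hw'
            rw [hA15] at hw ⊢
            rcases hheads o o1 o2 with hh | hh
            · exact absurd hh (hR.queue.disj _ hw)
            · exact hh
        · intro a' ha'
          rw [setReg_arr, hτ20, hvis, hins, ← hadef]
          by_cases e : a' = a
          · subst e
            rw [if_pos rfl, if_pos rfl]
            omega
          · rw [if_neg e, if_neg (Ne.symm e), h.cnt a' ha', Nat.add_zero]
        · intro a' ha' hc' hz' o o1 o2
          rw [setReg_arr, hτ20] at hz'
          by_cases e : a' = a
          · subst e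
            have := hR.complete o o1 o2
            rwa [hA15] at this
          · rw [if_neg e] at hz'
            rcases h.fired a' ha' hc' hz' o o1 o2 with hh | hh
            · exact Or.inl hh
            · exact Or.inr (List.mem_append_left _ hh)
        · intro r hr
          rw [← h.regs r hr, setReg_reg, if_neg (by omega), hRr r (by omega) (by omega), hσ₁]
          simp
          repeat rw [if_neg (by omega)]
        · rw [← h.one, setReg_reg, if_neg (by omega), hRr 16 (by omega) (by omega), hσ₁]
          simp
        · exact hτf
        · simp [hR.out, hσ₁, h.out]
        · rw [setReg_arr, List.length_append, hcard]
          omega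
      · rw [hRr 10 (by omega) (by omega), ← h10, hσ₁]
        simp
      · simp
      · omega
    · simp [Test.Holds, ← hp, e5, hr0] at hz
      refine Run.block (Run.block ?_)
      have enx : σ.arr nx p = A nx p := h.frame _ _ (by omega)
      have hnx20 : nx ≠ 20 := by omega
      simp [← hp, e5, enx, hnext, hnx20]
      refine ⟨k - 15, ⟨Q, p, ?_, ?_, ?_, by omega, hpre⟩, ?_⟩
      · have h20 : ∀ y, σ.arr 20 y - 0 = σ.arr 20 y := fun _ => rfl
        constructor
        · exact h.queue.congr (by simp) (by funext y; simp) (by funext y; simp)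
        · exact h.init
        · exact h.good
        · intro a' ha'
          rw [hvis, hins, ← hadef]
          by_cases e : a' = a
          · subst e
            simp
            omega
          · simp [e, Ne.symm e, h.cnt a' ha']
        · intro a' ha' hc' hz' o o1 o2
          by_cases e : a' = a
          · subst e
            simp at hz'
            omega
          · simp [e] at hz'
            exact h.fired a' ha' hc' hz' o o1 o2
        · intro r hr
          rw [← h.regs r hr]
          simp
          repeat rw [if_neg (by omega)]
        · simp [h.one]
        · intro x y hx
          rw [← h.frame x y hx]
          simp
          omega
        · simp [h.out]
        · rw [hcard, unfired_congr (cnt := σ.arr 20)]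
          · omega
          · intro y
            by_cases e : y = a
            · subst e
              simp
              omega
            · simp [e]
      · simp [h10]
      · simp
      · omega
  · simp [Test.Holds, ← hp, e5, hr0] at hb
    refine Run.block (Run.block ?_)
    have enx : σ.arr nx p = A nx p := h.frame _ _ (by omega)
    simp [← hp, e5, enx, hnext]
    refine ⟨k - 10, ⟨Q, p, ?_, ?_, ?_, by omega, hpre⟩, ?_⟩
    · constructor
      · exact h.queue.congr (by simp) rfl rfl
      · exact h.init
      · exact h.good
      · intro a' ha'
        rw [hvis, hins, ← hadef]
        by_cases e : a' = a
        · subst e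
          simp
          omega
        · simp [Ne.symm e, h.cnt a' ha']
      · exact h.fired
      · intro r hr
        rw [← h.regs r hr]
        simp
        repeat rw [if_neg (by omega)]
      · simp [h.one]
      · intro x y hx
        rw [← h.frame x y hx]
        simp
      · simp [h.out]
      · simp only [setReg_arr]
        rw [hcard]
        omega
    · simp [h10]
    · simp
    · omega

/-- The final queue is closed and contained in every closed set `G` that contains the initial queue:
it is the least closed set. Applications choose `G` as the intended answer. -/
theorem run_propagate {A : ℕ → ℕ → ℕ} {n N thr hd nx : ℕ} {c : ℕ → ℕ} {M G : ℕ → Prop}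
    {Q₀ : List ℕ} {σ₀ : State} (hE : Env A n N) (hL : Links A hd nx thr N) (hhd : hd < 20)
    (hnx : nx < 20) (hG : ClosedUnder A n N thr c M G) (h0 : σ₀.reg 0 = 0)
    (h1 : σ₀.reg 16 = 1) (h10 : σ₀.reg 10 = 0) (hQ : Queue M Q₀ σ₀) (hlen : Q₀.length ≤ N)
    (hgood : ∀ v ∈ Q₀, G v) (hcnt : ∀ a, a < n → σ₀.arr 20 a = c a)
    (hframe : ∀ x y, x < 20 ∨ 22 < x → σ₀.arr x y = A x y) :
    Run (propagate hd nx) σ₀ fun t τ => (∃ Q, Queue M Q τ ∧ Q₀ ⊆ Q ∧ (∀ v ∈ Q, G v) ∧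
      ClosedUnder A n N thr c M (· ∈ Q)) ∧ (∀ r, r < 10 → τ.reg r = σ₀.reg r) ∧ τ.reg 16 = 1 ∧
      (∀ x y, x < 20 ∨ 22 < x → τ.arr x y = A x y) ∧ τ.out = σ₀.out ∧ t ≤ 60 * N + 1 := by
  have hc0 : ∀ b a, trigCount A (visited A thr N [] b N) a = 0 := by
    intro b a
    have : visited A thr N [] b N = ∅ := by
      ext o
      simp [visited]
      omega
    simp [trigCount, this]
  refine (Run.loop (fun k τ => ∃ Q Qp, PropInv A n N thr c M G Q₀ σ₀ Q Qp 0 N k τ ∧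
    τ.reg 10 = Qp.length ∧ Qp <+: Q) ?_ (k := 60 * N) ⟨Q₀, [], ?_, h10, List.nil_prefix⟩).mono ?_
  · rintro k σ ⟨Q, Qp, h, hq10, hpre⟩ hb
    simp only [Test.Holds, hq10, h.queue.len] at hb
    have hget : Q[Qp.length]? = some Q[Qp.length] := List.getElem?_eq_getElem hb
    have e22 : σ.arr 22 Qp.length = Q[Qp.length] := h.queue.get _ _ hget
    set v := Q[Qp.length] with hv
    have ehd : ∀ w, σ.arr hd w = A hd w := fun w => h.frame _ _ (by omega)
    have hpre' : Qp ++ [v] <+: Q := by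
      obtain ⟨S, rfl⟩ := hpre
      cases S with
      | nil => simp at hb
      | cons s S =>
        have : v = s := by simp [hv]
        exact ⟨S, by simp [this]⟩
    refine Run.seq (Run.block ?_)
    simp [hq10, e22, ehd]
    refine (Run.loop (fun k' τ => ∃ Q' b', PropInv A n N thr c M G Q₀ σ₀ Q' Qp v b' k' τ ∧
      τ.reg 10 = Qp.length + 1 ∧
      τ.reg 13 = prevOcc (fun o => thr ≤ A 6 o ∧ A 15 o = v) b' ∧ b' ≤ N ∧ Qp ++ [v] <+: Q')
      ?_ (k := k) ⟨Q, N, ?_, ?_, ?_, le_rfl, hpre'⟩).mono ?_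
    · rintro k' τ ⟨Q', b', g, g1, g2, g3, g4⟩ hne
      simp only [Test.Holds, (g.regs 0 (by omega)).trans h0] at hne
      exact run_trigger hE hL hnx hG h0 g g1 g2 g3 g4 hne
    · constructor
      · exact h.queue.congr (by simp) rfl rfl
      · exact h.init
      · exact h.good
      · intro a ha
        rw [visited_end A thr N Qp v 0]
        exact h.cnt a ha
      · exact h.fired
      · intro r hr
        rw [← h.regs r hr]
        simp
        repeat rw [if_neg (by omega)]
      · simp [h.one]
      · exact h.frame
      · simp [h.out]
      · rw [visited_end A thr N Qp v 0]
        exact h.pot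
    · simp
    · simp [hL.head]
    · rintro t τ ⟨k', ⟨Q', b', g, g1, g2, g3, g4⟩, hne, ht⟩
      simp only [Test.Holds, (g.regs 0 (by omega)).trans h0, ne_eq, not_not] at hne
      have hfin := visited_finish (A := A) (v' := 0) (N := N) (Q := Qp) (g2.symm.trans hne)
      have hl := g4.length_le
      rw [List.length_append, List.length_singleton] at hl
      have hpot := g.pot
      -- The `10` units of the processed queue entry pay for fetching it and for entering and
      -- leaving the inner loop.
      refine ⟨k' - 10, ⟨Q', Qp ++ [v], ?_, by simp [g1], g4⟩, ?_⟩
      · refine ⟨g.queue, g.init, g.good, ?_, g.fired, g.regs, g.one, g.frame, g.out, ?_⟩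
        · rw [← hfin]
          exact g.cnt
        · rw [← hfin, List.length_append, List.length_singleton]
          omega
      · omega
  · have := unfired_le hE (σ₀.arr 20)
    refine ⟨hQ, fun _ h => h, hgood, ?_, ?_, fun _ _ => rfl, h1, hframe, rfl, ?_⟩
    · intro a ha
      rw [hc0, hcnt a ha, Nat.sub_zero]
    · intro a ha hc hz
      rw [hcnt a ha] at hz
      omega
    · rw [List.length_nil]
      omega
  · rintro t τ ⟨k', ⟨Q, Qp, h, hq10, hpre⟩, hb, ht⟩
    simp only [Test.Holds, hq10, h.queue.len, not_lt] at hb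
    obtain rfl : Qp = Q := hpre.eq_of_length_le hb
    refine ⟨⟨Qp, h.queue, h.init, h.good, fun a ha hc hle => ?_⟩, h.regs, h.one, h.frame, h.out,
      by omega⟩
    refine h.fired a ha hc ?_
    rw [h.cnt a ha]
    refine Nat.sub_eq_zero_of_le (hle.trans (trigCount_mono (fun o ho => ?_) a))
    simp only [visited, Finset.mem_filter] at ho ⊢
    exact ⟨ho.1, ho.2.1, Or.inl ho.2.2⟩

/-! ## The variables of the atoms and their addresses -/

def Term.var? : Term → Option Var
  | .var x => some x
  | .const _ => none

theorem exists_start_le {l : List Atom} : ∀ {n o : ℕ}, n ≤ l.length → 1 ≤ o → o < start l n →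
    ∃ a, a < n ∧ start l a ≤ o ∧ o < start l (a + 1)
  | 0, o, _, h1, h2 => by
    rw [start_zero] at h2
    omega
  | n + 1, o, hn, h1, h2 => by
    by_cases h : start l n ≤ o
    · exact ⟨n, by omega, h, h2⟩
    · obtain ⟨a, h3, h4⟩ := exists_start_le (by omega) h1 (not_le.1 h)
      exact ⟨a, by omega, h4⟩

theorem Layout.cell {l : List Atom} {A : ℕ → ℕ → ℕ} (h : Layout l A) {a : ℕ} {F : Atom}
    (hF : l[a]? = some F) {o : ℕ} (h1 : start l a ≤ o) (h2 : o < start l (a + 1)) :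
    A 5 o = a ∧ A 6 o = (if o < start l a + 1 + F.rel.keyLen then 1 else 0) ∧
      varAt A o = if o = start l a then none else (F.args[o - start l a - 1]?).bind Term.var? := by
  have hA := h a F hF
  rw [start_succ hF] at h2
  by_cases e : o = start l a
  · subst e
    refine ⟨hA.headAtom, ?_, ?_⟩
    · rw [hA.headKey, if_pos (by omega)]
    · simp [varAt, hA.headTag]
  · obtain ⟨j, rfl⟩ : ∃ j, o = start l a + 1 + j := ⟨o - start l a - 1, by omega⟩
    have hj : j < F.args.length := by omega
    have hjc : j < F.rel.cols.length := F.args_length ▸ hj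
    have hcell : F.cells[j]? = some (F.rel.cols[j], F.args[j]) := by
      simp [Atom.cells, hj, hjc]
    obtain ⟨c1, c2, c3, c4, c5, c6⟩ := hA.cell j _ hcell
    refine ⟨c5, ?_, ?_⟩
    · rw [c6]
      simp
    · rw [if_neg e, show start l a + 1 + j - start l a - 1 = j by omega,
        List.getElem?_eq_getElem hj, Option.bind_some, varAt, c2, c3]
      rcases F.args[j] with ⟨⟨b, i⟩⟩ | (x | s)
      · cases b <;> simp [Term.tag, Term.fst, Term.var?]
      · simp [Term.tag, Term.var?]
      · simp [Term.tag, Term.var?]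

theorem mem_vars_term {x : Var} {t : Term} : x ∈ t.vars ↔ t.var? = some x := by
  cases t with
  | var y => simp [Term.vars, Term.var?, eq_comm]
  | const c => simp [Term.vars, Term.var?]

theorem Layout.mem_vars_iff {l : List Atom} {A : ℕ → ℕ → ℕ} (h : Layout l A) {a : ℕ} {F : Atom}
    (hF : l[a]? = some F) {x : Var} :
    x ∈ F.vars ↔ ∃ o, start l a ≤ o ∧ o < start l (a + 1) ∧ varAt A o = some x := by
  have hs := start_succ hF
  rw [Atom.vars, mem_varsOf]
  constructor
  · rintro ⟨t, ht, hx⟩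
    obtain ⟨j, hj, rfl⟩ := List.getElem_of_mem ht
    refine ⟨start l a + 1 + j, by omega, by omega, ?_⟩
    rw [(h.cell hF (by omega) (by omega)).2.2, if_neg (by omega),
      show start l a + 1 + j - start l a - 1 = j by omega, List.getElem?_eq_getElem hj]
    exact mem_vars_term.1 hx
  · rintro ⟨o, h1, h2, h3⟩
    rw [(h.cell hF h1 h2).2.2] at h3
    split_ifs at h3
    obtain ⟨t, ht, hx⟩ := Option.bind_eq_some_iff.1 h3
    exact ⟨t, List.mem_of_getElem? ht, mem_vars_term.2 hx⟩

theorem Layout.mem_key_iff {l : List Atom} {A : ℕ → ℕ → ℕ} (h : Layout l A) {a : ℕ} {F : Atom}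
    (hF : l[a]? = some F) {x : Var} : x ∈ F.key ↔ ∃ o, start l a ≤ o ∧
      o < start l a + 1 + F.rel.keyLen ∧ varAt A o = some x := by
  have hs := start_succ hF
  have hk : F.rel.keyLen ≤ F.args.length := F.args_length ▸ F.rel.keyLen_le
  rw [Atom.key, mem_varsOf]
  constructor
  · rintro ⟨t, ht, hx⟩
    obtain ⟨j, hj, rfl⟩ := List.getElem_of_mem ht
    rw [List.length_take] at hj
    refine ⟨start l a + 1 + j, by omega, by omega, ?_⟩
    rw [(h.cell hF (by omega) (by omega)).2.2, if_neg (by omega),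
      show start l a + 1 + j - start l a - 1 = j by omega,
      List.getElem?_eq_getElem (by omega)]
    rw [List.getElem_take] at hx
    exact mem_vars_term.1 hx
  · rintro ⟨o, h1, h2, h3⟩
    rw [(h.cell hF h1 (by omega)).2.2] at h3
    split_ifs at h3
    obtain ⟨t, ht, hx⟩ := Option.bind_eq_some_iff.1 h3
    refine ⟨t, ?_, mem_vars_term.2 hx⟩
    rw [List.mem_iff_getElem?]
    exact ⟨o - start l a - 1, by rw [List.getElem?_take, if_pos (by omega), ht]⟩

theorem Layout.env {l : List Atom} {A : ℕ → ℕ → ℕ} (h : Layout l A) :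
    Env A l.length (start l l.length) := by
  have hget : ∀ a, a < l.length → ∃ F, l[a]? = some F := fun a ha =>
    ⟨l[a], List.getElem?_eq_getElem ha⟩
  have hfin : ∀ a F, l[a]? = some F → A 12 a = start l (a + 1) := fun a F hF => by
    rw [(h a F hF).fin, start_succ hF]
  constructor
  · intro o h1 h2
    obtain ⟨a, ha, h3, h4⟩ := exists_start_le le_rfl h1 h2
    obtain ⟨F, hF⟩ := hget a ha
    rw [(h.cell hF h3 h4).1, (h a F hF).beg, hfin a F hF]
    exact ⟨ha, h3, h4⟩
  · intro a ha
    obtain ⟨F, hF⟩ := hget a ha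
    have h1 := start_mono l (Nat.zero_le a)
    have h2 := start_mono l (show a + 1 ≤ l.length by omega)
    have h3 := start_succ hF
    rw [start_zero] at h1
    rw [(h a F hF).beg, hfin a F hF]
    omega
  · have : ∑ a ∈ Finset.range l.length, (A 12 a - A 10 a)
        = ∑ a ∈ Finset.Ico 0 l.length, (1 * (start l (a + 1) - start l a) + 0) := by
      rw [Finset.range_eq_Ico]
      refine Finset.sum_congr rfl fun a ha => ?_
      obtain ⟨F, hF⟩ := hget a (Finset.mem_Ico.1 ha).2
      rw [(h a F hF).beg, hfin a F hF]
      omega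
    rw [this, sum_start]
    omega

/-! ## Preparation -/

structure Prepared (q : SJFBCQ) (σ : State) : Prop where
  parsed : Parsed q.atoms σ
  num : ∀ o, 1 ≤ o → o < start q.atoms q.atoms.length → σ.arr 15 o = vid σ.arr o
  keyLinks : Links σ.arr 16 17 1 (start q.atoms q.atoms.length)
  allLinks : Links σ.arr 18 19 0 (start q.atoms q.atoms.length)

theorem Links.congr {A B : ℕ → ℕ → ℕ} {hd nx thr N : ℕ} (h : Links A hd nx thr N)
    (h6 : B 6 = A 6) (h15 : B 15 = A 15) (hhd : B hd = A hd) (hnx : B nx = A nx) :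
    Links B hd nx thr N := by
  constructor
  · rw [hhd, h6, h15]
    exact h.head
  · rw [hnx, h6, h15]
    exact h.next

theorem Parsed.congr {l : List Atom} {σ τ : State} (h : Parsed l σ) (hout : τ.out = σ.out)
    (hreg : ∀ r, r < 4 → τ.reg r = σ.reg r) (harr : ∀ x y, 1 ≤ x → x ≤ 12 → τ.arr x y = σ.arr x y) :
    Parsed l τ := by
  refine ⟨hout.trans h.out, (hreg 0 (by omega)).trans h.zero, (hreg 1 (by omega)).trans h.len,
    (hreg 2 (by omega)).trans h.pos, ?_, h.layout.congr harr⟩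
  rw [hreg 3 (by omega)]
  exact h.fst_le

theorem Prepared.congr {q : SJFBCQ} {σ τ : State} (h : Prepared q σ) (hout : τ.out = σ.out)
    (hreg : ∀ r, r < 4 → τ.reg r = σ.reg r) (harr : ∀ x y, x < 20 → τ.arr x y = σ.arr x y) :
    Prepared q τ := by
  have e : ∀ x, x < 20 → τ.arr x = σ.arr x := fun x hx => funext fun y => harr x y hx
  refine ⟨h.parsed.congr hout hreg fun x y _ hx => harr x y (by omega), ?_, ?_, ?_⟩
  · rw [e 15 (by omega), vid_congr fun x y _ hx => harr x y (by omega)]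
    exact h.num
  · exact h.keyLinks.congr (e _ (by omega)) (e _ (by omega)) (e _ (by omega)) (e _ (by omega))
  · exact h.allLinks.congr (e _ (by omega)) (e _ (by omega)) (e _ (by omega)) (e _ (by omega))

def prepare : Prog :=
  .seq parse (.seq numberVars (.seq (linkOccs 16 17 1) (linkOccs 18 19 0)))

theorem run_prepare (q : SJFBCQ) : Run prepare (State.init q.encode) fun t τ =>
    Prepared q τ ∧ (∀ x y, 20 ≤ x → τ.arr x y = 0) ∧
      t ≤ 100 * start q.atoms q.atoms.length := by
  have hN := length_lt_start q.atoms
  refine Run.comp (run_parse q) ?_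
  rintro t₁ σ₁ ⟨h1, hz1, ht1⟩
  have hp1 : σ₁.reg 2 = start q.atoms q.atoms.length := h1.pos
  refine Run.comp (run_numberVars h1.zero (by omega) hz1) ?_
  rintro t₂ σ₂ ⟨h2, ht2⟩
  have hp2 : σ₂.reg 2 = start q.atoms q.atoms.length := (h2.regs 2 (by omega)).trans hp1
  refine Run.comp (run_linkOccs (by omega) (by omega) (by omega) (by omega) (fun y => ?_)) ?_
  · rw [h2.frame _ _ (by omega), hz1 _ _ (by omega)]
  rintro t₃ σ₃ ⟨h3, ht3⟩
  have hp3 : σ₃.reg 2 = start q.atoms q.atoms.length := (h3.regs 2 (by omega)).trans hp2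
  refine (run_linkOccs (by omega) (by omega) (by omega) (by omega) (fun y => ?_)).mono ?_
  · rw [h3.frame _ _ (by omega) (by omega), h2.frame _ _ (by omega), hz1 _ _ (by omega)]
  rintro t₄ σ₄ ⟨h4, ht4⟩
  have f4 : ∀ x, x ≠ 18 → x ≠ 19 → σ₄.arr x = σ₃.arr x := fun x e1 e2 =>
    funext fun y => h4.frame x y e1 e2
  have f3 : ∀ x, x ≠ 16 → x ≠ 17 → σ₃.arr x = σ₂.arr x := fun x e1 e2 =>
    funext fun y => h3.frame x y e1 e2
  have f2 : ∀ x, x < 13 ∨ 15 < x → σ₂.arr x = σ₁.arr x := fun x e => funext fun y => h2.frame x y e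
  have f41 : ∀ x, x < 13 → σ₄.arr x = σ₁.arr x := fun x e => by
    rw [f4 x (by omega) (by omega), f3 x (by omega) (by omega), f2 x (by omega)]
  refine ⟨⟨h1.congr ?_ ?_ ?_, ?_, ?_, ?_⟩, ?_, ?_⟩
  · rw [h4.out, h3.out, h2.out]
  · intro r hr
    rw [h4.regs r (by omega), h3.regs r (by omega), h2.regs r (by omega)]
  · intro x y e1 e2
    rw [f41 x (by omega)]
  · intro o e1 e2
    rw [f4 15 (by omega) (by omega), f3 15 (by omega) (by omega), h2.num o e1 (hp1 ▸ e2)]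
    rw [vid_congr (A := σ₁.arr) (B := σ₄.arr) fun x y _ e => by rw [f41 x (by omega)]]
  · have : Links σ₃.arr 16 17 1 (start q.atoms q.atoms.length) := by
      constructor
      · rw [f3 6 (by omega) (by omega), f3 15 (by omega) (by omega), ← hp2]
        exact h3.head
      · rw [f3 6 (by omega) (by omega), f3 15 (by omega) (by omega), ← hp2]
        exact h3.next
    exact this.congr (f4 _ (by omega) (by omega)) (f4 _ (by omega) (by omega))
      (f4 _ (by omega) (by omega)) (f4 _ (by omega) (by omega))
  · constructor
    · rw [f4 6 (by omega) (by omega), f4 15 (by omega) (by omega), ← hp3]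
      exact h4.head
    · rw [f4 6 (by omega) (by omega), f4 15 (by omega) (by omega), ← hp3]
      exact h4.next
  · intro x y hx
    rw [f4 x (by omega) (by omega), f3 x (by omega) (by omega), f2 x (by omega),
      hz1 x y (by omega)]
  · omega

/-! ## Closures and attacked variables by propagation -/

section Analysis

variable {q : SJFBCQ} {A : ℕ → ℕ → ℕ}

theorem addr_lt {a o : ℕ} (ha : a < q.atoms.length) (h1 : start q.atoms a ≤ o)
    (h2 : o < start q.atoms (a + 1)) : 1 ≤ o ∧ o < start q.atoms q.atoms.length := by
  have := start_mono q.atoms (Nat.zero_le a)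
  have := start_mono q.atoms (show a + 1 ≤ q.atoms.length by omega)
  rw [start_zero] at *
  omega

/-- The variable `v` of the flat representation is a variable in `C`, or none. -/
def NumIn (q : SJFBCQ) (A : ℕ → ℕ → ℕ) (C : Set Var) (v : ℕ) : Prop :=
  v < start q.atoms q.atoms.length ∧
    ∀ o x, 1 ≤ o → o < start q.atoms q.atoms.length → A 15 o = v → varAt A o = some x → x ∈ C

theorem numIn_iff (hnum : ∀ o, 1 ≤ o → o < start q.atoms q.atoms.length → A 15 o = vid A o) {C : Set Var} {o : ℕ}
    (h1 : 1 ≤ o) (h2 : o < start q.atoms q.atoms.length) :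
    NumIn q A C (A 15 o) ↔ ∀ x, varAt A o = some x → x ∈ C := by
  refine ⟨fun h x hx => h.2 o x h1 h2 rfl hx, fun h => ⟨?_, fun o' x h1' h2' e hx => h x ?_⟩⟩
  · rw [hnum o h1 h2]
    exact vid_lt h2
  rw [hnum o h1 h2, hnum o' h1' h2', vid_eq_iff (by omega) (by omega)] at e
  rw [← e, hx]

theorem atom_ne {a f : ℕ} {F G : Atom} (hF : q.atoms[f]? = some F) (hG : q.atoms[a]? = some G)
    (h : a ≠ f) : G ≠ F := by
  rintro rfl
  obtain ⟨h1, e1⟩ := List.getElem?_eq_some_iff.1 hF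
  obtain ⟨h2, e2⟩ := List.getElem?_eq_some_iff.1 hG
  exact h ((q.atoms_nodup.getElem_inj_iff).1 (e2.trans e1.symm))

/-! ### The closure of a key as a closure under thresholds. -/

/-- The thresholds that compute the closure of the key of atom `f`. -/
def keyThreshold (q : SJFBCQ) (f a : ℕ) : ℕ :=
  if a = f then 0 else match q.atoms[a]? with
    | some G => G.rel.keyLen + 1
    | none => 0

theorem keyLen_le_args (F : Atom) : F.rel.keyLen ≤ F.args.length :=
  F.args_length ▸ F.rel.keyLen_le

-- The head and the key arguments are exactly `keyLen + 1` addresses with key flag `1`, so the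
-- threshold is reached only if every one of them has triggered.
open Classical in
theorem keyThreshold_le_iff (hl : Layout q.atoms A) {a : ℕ} {G : Atom}
    (hG : q.atoms[a]? = some G) (P : ℕ → Prop) :
    G.rel.keyLen + 1 ≤ trigCount A ((Finset.Ico 1 (start q.atoms q.atoms.length)).filter fun o => 1 ≤ A 6 o ∧ P o) a ↔
      ∀ o, start q.atoms a ≤ o → o < start q.atoms a + 1 + G.rel.keyLen → P o := by
  have ha := (List.getElem?_eq_some_iff.1 hG).1
  have hs := start_succ hG
  have hk := keyLen_le_args G
  have hcard : (Finset.Ico (start q.atoms a) (start q.atoms a + 1 + G.rel.keyLen)).card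
      = G.rel.keyLen + 1 := by
    rw [Nat.card_Ico]
    omega
  have hsub : (((Finset.Ico 1 (start q.atoms q.atoms.length)).filter fun o => 1 ≤ A 6 o ∧ P o).filter fun o => A 5 o = a)
      ⊆ Finset.Ico (start q.atoms a) (start q.atoms a + 1 + G.rel.keyLen) := by
    intro o ho
    simp only [Finset.mem_filter, Finset.mem_Ico] at ho ⊢
    obtain ⟨⟨⟨h1, h2⟩, h3, -⟩, h4⟩ := ho
    obtain ⟨b, hb, h5, h6⟩ := exists_start_le le_rfl h1 h2
    have hc := hl.cell (List.getElem?_eq_getElem hb) h5 h6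
    obtain rfl : b = a := hc.1.symm.trans h4
    have hGe : q.atoms[b] = G := by simpa [List.getElem?_eq_getElem hb] using hG
    rw [hc.2.1, hGe] at h3
    split_ifs at h3 with h7
    · exact ⟨h5, h7⟩
    · omega
  unfold trigCount
  constructor
  · intro h o h1 h2
    have := Finset.eq_of_subset_of_card_le hsub (hcard ▸ h)
    have ho : o ∈ Finset.Ico (start q.atoms a) (start q.atoms a + 1 + G.rel.keyLen) :=
      Finset.mem_Ico.2 ⟨h1, h2⟩
    rw [← this] at ho
    exact (Finset.mem_filter.1 (Finset.mem_filter.1 ho).1).2.2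
  · intro h
    rw [← hcard]
    refine Finset.card_le_card fun o ho => ?_
    rw [Finset.mem_Ico] at ho
    have hc := hl.cell hG ho.1 (by omega)
    have hlt := addr_lt ha ho.1 (by omega)
    simp only [Finset.mem_filter, Finset.mem_Ico]
    exact ⟨⟨hlt, by rw [hc.2.1, if_pos ho.2], h o ho.1 ho.2⟩, hc.1⟩

/-- Soundness: an atom fires when its whole key is in the closure, and then its dependency applies.
Atom `f` has threshold `0` and never fires, as its own dependency must not be used. -/
theorem closedUnder_keycl (hl : Layout q.atoms A)
    (hnum : ∀ o, 1 ≤ o → o < start q.atoms q.atoms.length → A 15 o = vid A o) {f : ℕ} {F : Atom}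
    (hF : q.atoms[f]? = some F) :
    ClosedUnder A q.atoms.length (start q.atoms q.atoms.length) 1 (keyThreshold q f) (fun _ => False)
      (NumIn q A (q.keycl F)) := by
  classical
  intro a ha hc hle o h1 h2
  have hG := List.getElem?_eq_getElem ha
  set G := q.atoms[a]
  have haf : a ≠ f := by
    rintro rfl
    simp [keyThreshold] at hc
  have hs := start_succ hG
  have hk := keyLen_le_args G
  rw [keyThreshold, if_neg haf, hG] at hle
  have hle' := (keyThreshold_le_iff hl hG _).1 hle
  rw [(hl a G hG).beg] at h1
  rw [(hl a G hG).fin, ← hs] at h2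
  have hlt := addr_lt ha h1 h2
  refine Or.inr ((numIn_iff hnum hlt.1 hlt.2).2 fun x hx => ?_)
  refine SJFBCQ.keycl_closed (List.mem_of_getElem? hG) (atom_ne hF hG haf) (fun y hy => ?_) x
    ((hl.mem_vars_iff hG).2 ⟨o, h1, h2, hx⟩)
  obtain ⟨o', e1, e2, e3⟩ := (hl.mem_key_iff hG).1 hy
  have hlt' := addr_lt ha e1 (by omega)
  exact (numIn_iff hnum hlt'.1 hlt'.2).1 (hle' o' e1 e2) y e3

/-- Completeness: the variables whose numbers are in `Q` contain the key and are closed under the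
dependencies, so they exhaust the closure. -/
theorem keycl_of_closedUnder (hl : Layout q.atoms A)
    (hnum : ∀ o, 1 ≤ o → o < start q.atoms q.atoms.length → A 15 o = vid A o) {f : ℕ} {F : Atom}
    (hF : q.atoms[f]? = some F) {Q : List ℕ}
    (hinit : ∀ o, start q.atoms f ≤ o → o < start q.atoms f + 1 + F.rel.keyLen → A 15 o ∈ Q)
    (hgood : ∀ v ∈ Q, NumIn q A (q.keycl F) v)
    (hcl : ClosedUnder A q.atoms.length (start q.atoms q.atoms.length) 1 (keyThreshold q f) (fun _ => False) (· ∈ Q)) {o : ℕ}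
    (h1 : 1 ≤ o) (h2 : o < start q.atoms q.atoms.length) : A 15 o ∈ Q ↔ ∀ x, varAt A o = some x → x ∈ q.keycl F := by
  classical
  have hf := (List.getElem?_eq_some_iff.1 hF).1
  have hsF := start_succ hF
  have hkF := keyLen_le_args F
  have hvid : ∀ o o', 1 ≤ o → o < start q.atoms q.atoms.length → 1 ≤ o' → o' < start q.atoms q.atoms.length → varAt A o = varAt A o' →
      A 15 o = A 15 o' := fun o o' h1 h2 h3 h4 e => by
    rw [hnum o h1 h2, hnum o' h3 h4, vid_eq_iff (by omega) (by omega), e]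
  -- The head of `F` puts the common number of all non-variables into the queue; hence heads and
  -- constants in keys count as triggered.
  have hnone : ∀ o, 1 ≤ o → o < start q.atoms q.atoms.length → varAt A o = none → A 15 o ∈ Q := by
    intro o h1 h2 hv
    have hlt := addr_lt hf le_rfl (by omega)
    have := hinit (start q.atoms f) le_rfl (by omega)
    rwa [hvid o _ h1 h2 hlt.1 hlt.2 (by
      rw [hv, (hl.cell hF le_rfl (by omega)).2.2, if_pos rfl])]
  refine ⟨fun h x hx => (hgood _ h).2 o x h1 h2 rfl hx, fun h => ?_⟩
  cases hv : varAt A o with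
  | none => exact hnone o h1 h2 hv
  | some x =>
    refine SJFBCQ.mem_of_mem_keycl
      (S := {y | ∀ o, 1 ≤ o → o < start q.atoms q.atoms.length → varAt A o = some y → A 15 o ∈ Q})
      (fun y hy o e1 e2 e3 => ?_) (fun G hG hGF hk y hy o e1 e2 e3 => ?_) (h x hv) o h1 h2 hv
    · obtain ⟨o', g1, g2, g3⟩ := (hl.mem_key_iff hF).1 hy
      have hlt := addr_lt hf g1 (by omega)
      rw [hvid o o' e1 e2 hlt.1 hlt.2 (e3.trans g3.symm)]
      exact hinit o' g1 g2
    · obtain ⟨a, ha, hGa⟩ := List.getElem_of_mem hG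
      have hGa' : q.atoms[a]? = some G := by rw [List.getElem?_eq_getElem ha, hGa]
      have haf : a ≠ f := by
        rintro rfl
        rw [hF, Option.some.injEq] at hGa'
        exact hGF hGa'.symm
      have hsG := start_succ hGa'
      have hkG := keyLen_le_args G
      obtain ⟨o', g1, g2, g3⟩ := (hl.mem_vars_iff hGa').1 hy
      have hlt := addr_lt ha g1 g2
      rw [hvid o o' e1 e2 hlt.1 hlt.2 (e3.trans g3.symm)]
      have := hcl a ha (by simp [keyThreshold, haf, hGa']) (by
        rw [keyThreshold, if_neg haf, hGa']
        refine (keyThreshold_le_iff hl hGa' _).2 fun o'' k1 k2 => ?_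
        have hlt' := addr_lt ha k1 (by omega)
        cases hv' : varAt A o'' with
        | none => exact hnone _ hlt'.1 hlt'.2 hv'
        | some z =>
          exact hk z ((hl.mem_key_iff hGa').2 ⟨o'', k1, k2, hv'⟩) o'' hlt'.1 hlt'.2 hv') o'
        (by rwa [(hl a G hGa').beg]) (by rwa [(hl a G hGa').fin, ← hsG])
      exact this.resolve_left id

/-! ### Attacked variables as a closure under thresholds. -/

/-- The variable `v` of the flat representation is a variable in `C`. -/
def NumOf (q : SJFBCQ) (A : ℕ → ℕ → ℕ) (C : Set Var) (v : ℕ) : Prop :=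
  ∃ o x, 1 ≤ o ∧ o < start q.atoms q.atoms.length ∧ A 15 o = v ∧ varAt A o = some x ∧ x ∈ C

theorem numOf_iff (hnum : ∀ o, 1 ≤ o → o < start q.atoms q.atoms.length → A 15 o = vid A o) {C : Set Var} {o : ℕ}
    (h1 : 1 ≤ o) (h2 : o < start q.atoms q.atoms.length) :
    NumOf q A C (A 15 o) ↔ ∃ x, varAt A o = some x ∧ x ∈ C := by
  constructor
  · rintro ⟨o', x, e1, e2, e3, e4, e5⟩
    rw [hnum o h1 h2, hnum o' e1 e2, vid_eq_iff (by omega) (by omega)] at e3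
    exact ⟨x, e3 ▸ e4, e5⟩
  · rintro ⟨x, hx, hC⟩
    exact ⟨o, x, h1, h2, rfl, hx, hC⟩

open Classical in
theorem one_le_trigCount_iff (hl : Layout q.atoms A) {a : ℕ} {G : Atom}
    (hG : q.atoms[a]? = some G) (P : ℕ → Prop) :
    1 ≤ trigCount A ((Finset.Ico 1 (start q.atoms q.atoms.length)).filter fun o => 0 ≤ A 6 o ∧ P o) a ↔
      ∃ o, start q.atoms a ≤ o ∧ o < start q.atoms (a + 1) ∧ P o := by
  have ha := (List.getElem?_eq_some_iff.1 hG).1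
  rw [trigCount, Nat.succ_le_iff, Finset.card_pos]
  constructor
  · rintro ⟨o, ho⟩
    simp only [Finset.mem_filter, Finset.mem_Ico] at ho
    obtain ⟨⟨⟨h1, h2⟩, -, h3⟩, h4⟩ := ho
    obtain ⟨b, hb, h5, h6⟩ := exists_start_le le_rfl h1 h2
    have hc := hl.cell (List.getElem?_eq_getElem hb) h5 h6
    obtain rfl : b = a := hc.1.symm.trans h4
    exact ⟨o, h5, h6, h3⟩
  · rintro ⟨o, h1, h2, h3⟩
    refine ⟨o, ?_⟩
    simp only [Finset.mem_filter, Finset.mem_Ico]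
    exact ⟨⟨addr_lt ha h1 h2, Nat.zero_le _, h3⟩, (hl.cell hG h1 h2).1⟩

/-- With threshold `1` an atom fires as soon as one of its variables is attacked, and then all its
variables outside the closure are attacked. The marks `M` of the closure, and of the non-variables,
act as a barrier. -/
theorem closedUnder_attacked (hl : Layout q.atoms A)
    (hnum : ∀ o, 1 ≤ o → o < start q.atoms q.atoms.length → A 15 o = vid A o) {F : Atom} {M : ℕ → Prop}
    (hM : ∀ o, 1 ≤ o → o < start q.atoms q.atoms.length → (M (A 15 o) ↔ ∀ x, varAt A o = some x → x ∈ q.keycl F)) :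
    ClosedUnder A q.atoms.length (start q.atoms q.atoms.length) 0 (fun _ => 1) M (NumOf q A (q.attacked F)) := by
  classical
  intro a ha _ hle o h1 h2
  have hG := List.getElem?_eq_getElem ha
  set G := q.atoms[a]
  have hs := start_succ hG
  rw [(hl a G hG).beg] at h1
  rw [(hl a G hG).fin, ← hs] at h2
  have hlt := addr_lt ha h1 h2
  obtain ⟨o', e1, e2, e3⟩ := (one_le_trigCount_iff hl hG _).1 hle
  have hlt' := addr_lt ha e1 e2
  obtain ⟨y, hy, hya⟩ := (numOf_iff hnum hlt'.1 hlt'.2).1 e3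
  rw [hM o hlt.1 hlt.2, numOf_iff hnum hlt.1 hlt.2]
  by_contra hcon
  push Not at hcon
  obtain ⟨⟨x, hx, hxc⟩, hn⟩ := hcon
  exact hn x hx (SJFBCQ.AttacksVar.step (F := F) hya ⟨G, List.mem_of_getElem? hG,
    (hl.mem_vars_iff hG).2 ⟨o', e1, e2, hy⟩, (hl.mem_vars_iff hG).2 ⟨o, h1, h2, hx⟩⟩ hxc)

/-- Completeness by induction along an attack path: each step stays within one atom, which has fired
because it contains the preceding variable. -/
theorem attacked_of_closedUnder (hl : Layout q.atoms A)
    (hnum : ∀ o, 1 ≤ o → o < start q.atoms q.atoms.length → A 15 o = vid A o) {f : ℕ} {F : Atom}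
    (hF : q.atoms[f]? = some F) {M : ℕ → Prop}
    (hM : ∀ o, 1 ≤ o → o < start q.atoms q.atoms.length → (M (A 15 o) ↔ ∀ x, varAt A o = some x → x ∈ q.keycl F))
    {Q : List ℕ}
    (hinit : ∀ o, start q.atoms f ≤ o → o < start q.atoms (f + 1) → M (A 15 o) ∨ A 15 o ∈ Q)
    (hgood : ∀ v ∈ Q, NumOf q A (q.attacked F) v)
    (hcl : ClosedUnder A q.atoms.length (start q.atoms q.atoms.length) 0 (fun _ => 1) M (· ∈ Q)) (v : ℕ) :
    v ∈ Q ↔ NumOf q A (q.attacked F) v := by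
  classical
  have hf := (List.getElem?_eq_some_iff.1 hF).1
  refine ⟨hgood v, ?_⟩
  rintro ⟨o, x, h1, h2, rfl, hx, hxa⟩
  have hvid : ∀ o o', 1 ≤ o → o < start q.atoms q.atoms.length → 1 ≤ o' → o' < start q.atoms q.atoms.length → varAt A o = varAt A o' →
      A 15 o = A 15 o' := fun o o' h1 h2 h3 h4 e => by
    rw [hnum o h1 h2, hnum o' h3 h4, vid_eq_iff (by omega) (by omega), e]
  obtain ⟨x₁, e1, e2, e3⟩ := SJFBCQ.attacksVar_iff.1 hxa
  clear hxa
  induction e3 generalizing o with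
  | refl =>
    obtain ⟨o', g1, g2, g3⟩ := (hl.mem_vars_iff hF).1 (Finset.mem_sdiff.1 e1).1
    have hlt := addr_lt hf g1 g2
    rw [hvid o o' h1 h2 hlt.1 hlt.2 (hx.trans g3.symm)]
    refine (hinit o' g1 g2).resolve_left fun hm => ?_
    exact e2 ((hM o' hlt.1 hlt.2).1 hm _ g3)
  | tail _ hbc ih =>
    obtain ⟨⟨G, hG, hyG, hzG⟩, hz⟩ := hbc
    obtain ⟨a, ha, hGa⟩ := List.getElem_of_mem hG
    have hGa' : q.atoms[a]? = some G := by rw [List.getElem?_eq_getElem ha, hGa]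
    have hsG := start_succ hGa'
    obtain ⟨o', g1, g2, g3⟩ := (hl.mem_vars_iff hGa').1 hyG
    obtain ⟨o'', k1, k2, k3⟩ := (hl.mem_vars_iff hGa').1 hzG
    have hlt := addr_lt ha g1 g2
    have hlt' := addr_lt ha k1 k2
    rw [hvid o o'' h1 h2 hlt'.1 hlt'.2 (hx.trans k3.symm)]
    refine (hcl a ha Nat.one_pos ((one_le_trigCount_iff hl hGa' _).2
      ⟨o', g1, g2, ih o' hlt.1 hlt.2 g3⟩) o'' (by rwa [(hl a G hGa').beg])
      (by rwa [(hl a G hGa').fin, ← hsG])).resolve_left fun hm => ?_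
    exact hz ((hM o'' hlt'.1 hlt'.2).1 hm _ k3)

open Classical in
/-- The number of variables that `F` attacks. -/
noncomputable def attackCount (q : SJFBCQ) (A : ℕ → ℕ → ℕ) (F : Atom) : ℕ :=
  ((Finset.range (start q.atoms q.atoms.length)).filter (NumOf q A (q.attacked F))).card

theorem attackCount_le (F : Atom) : attackCount q A F ≤ start q.atoms q.atoms.length := by
  classical exact (Finset.card_filter_le _ _).trans (Finset.card_range _).le

theorem NumOf.lt (hnum : ∀ o, 1 ≤ o → o < start q.atoms q.atoms.length → A 15 o = vid A o)
    {C : Set Var} {v : ℕ} (h : NumOf q A C v) : v < start q.atoms q.atoms.length := by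
  obtain ⟨o, x, h1, h2, rfl, -⟩ := h
  rw [hnum o h1 h2]
  exact vid_lt h2

/-- Proper inclusion of the attacked sets becomes a strict inequality of counts; the extra variable
has a number because attacked variables occur in the query. -/
theorem attackCount_lt_of_attacks (hl : Layout q.atoms A)
    (hnum : ∀ o, 1 ≤ o → o < start q.atoms q.atoms.length → A 15 o = vid A o)
    (hac : q.AcyclicAttackGraph) {F G : Atom} (h : q.Attacks F G) :
    attackCount q A G < attackCount q A F := by
  classical
  obtain ⟨hsub, hne⟩ := SJFBCQ.attacked_ssubset h (hac.asymm h)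
  obtain ⟨x, hxF, hxG⟩ := Set.not_subset.1 hne
  have hxv : ∃ H ∈ q.atoms, x ∈ H.vars := by
    obtain ⟨x₁, e1, e2, e3⟩ := SJFBCQ.attacksVar_iff.1 hxF
    rcases Relation.ReflTransGen.cases_tail e3 with rfl | ⟨y, -, ⟨H, hH, -, hx⟩, -⟩
    · exact ⟨F, h.1, (Finset.mem_sdiff.1 e1).1⟩
    · exact ⟨H, hH, hx⟩
  obtain ⟨H, hH, hxH⟩ := hxv
  obtain ⟨a, ha, rfl⟩ := List.getElem_of_mem hH
  obtain ⟨o, h1, h2, h3⟩ := (hl.mem_vars_iff (List.getElem?_eq_getElem ha)).1 hxH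
  have hlt := addr_lt ha h1 h2
  refine Finset.card_lt_card ((Finset.ssubset_iff_of_subset fun v hv => ?_).2 ⟨A 15 o, ?_, ?_⟩)
  · rw [Finset.mem_filter] at hv ⊢
    obtain ⟨hv, o, x, g1, g2, g3, g4, g5⟩ := hv
    exact ⟨hv, o, x, g1, g2, g3, g4, hsub g5⟩
  · have : NumOf q A (q.attacked F) (A 15 o) := ⟨o, x, hlt.1, hlt.2, rfl, h3, hxF⟩
    exact Finset.mem_filter.2 ⟨Finset.mem_range.2 (this.lt hnum), this⟩
  · rw [Finset.mem_filter, numOf_iff hnum hlt.1 hlt.2]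
    rintro ⟨-, y, hy, hyG⟩
    rw [h3, Option.some.injEq] at hy
    exact hxG (hy ▸ hyG)

theorem length_eq_attackCount
    (hnum : ∀ o, 1 ≤ o → o < start q.atoms q.atoms.length → A 15 o = vid A o)
    {F : Atom} {Q : List ℕ} (hnd : Q.Nodup)
    (hQ : ∀ v, v ∈ Q ↔ NumOf q A (q.attacked F) v) : Q.length = attackCount q A F := by
  classical
  rw [← List.toFinset_card_of_nodup hnd, attackCount]
  congr 1
  ext v
  rw [List.mem_toFinset, hQ, Finset.mem_filter, Finset.mem_range]
  exact ⟨fun h => ⟨h.lt hnum, h⟩, fun h => h.2⟩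

theorem attackCount_congr {B : ℕ → ℕ → ℕ} (h : ∀ x y, x < 20 → B x y = A x y) (F : Atom) :
    attackCount q B F = attackCount q A F := by
  have h1 := varAt_congr (A := A) (B := B) fun x y _ hx => h x y (by omega)
  have h2 : NumOf q B (q.attacked F) = NumOf q A (q.attacked F) := by
    funext v
    simp only [NumOf, h1, h 15 _ (by omega)]
  unfold attackCount
  rw [h2]

end Analysis

/-! ## Counting the attacked variables of each atom -/

/-- Fills the first entries of an array, as many as register `y` says, with register `r`. -/
def fill (ar y r : ℕ) : Prog :=
  .seq (block [.const 10 0]) (.loop (.lt 10 y) (block [.store ar 10 r, .succ 10]))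

structure Fill (ar e : ℕ) (g : ℕ → ℕ) (σ₀ : State) (i : ℕ) (σ : State) : Prop where
  regs : ∀ r, r ≠ 10 → r ≠ 11 → σ.reg r = σ₀.reg r
  idx : σ.reg 10 = i
  frame : ∀ x y, ¬ (x = ar ∧ y < e) → σ.arr x y = σ₀.arr x y
  val : ∀ y, y < i → σ.arr ar y = g y
  out : σ.out = σ₀.out

theorem run_fill {ar y r : ℕ} (hy : y ≠ 10) (hy' : y ≠ 11) (hr : r ≠ 10) (hr' : r ≠ 11) (σ : State) :
    Run (fill ar y r) σ fun t τ => Fill ar (σ.reg y) (fun _ => σ.reg r) σ (σ.reg y) τ ∧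
      t ≤ 4 * σ.reg y + 3 := by
  refine Run.seq (Run.block ?_)
  refine (Run.for_const (Fill ar (σ.reg y) (fun _ => σ.reg r) σ) (σ.reg y) 3
    (fun i τ h => ⟨h.idx, h.regs y hy hy'⟩) (fun i τ _ hi h => Run.block ?_) (Nat.zero_le _)
    ?_).mono fun t τ ⟨h, ht⟩ => ⟨h, ?_⟩
  · simp [h.idx, h.regs r hr hr']
    constructor
    · intro r h1 h2
      rw [← h.regs r h1 h2]
      simp [h1]
    · simp
    · intro x z hxz
      rw [← h.frame x z hxz]
      simp
      intro e1 e2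
      omega
    · intro z hz
      by_cases e : z = i
      · simp [e]
      · simp [e, h.val z (by omega)]
    · exact h.out
  · constructor
    · intro r h1 h2
      simp [h1]
    · simp
    · simp
    · simp
    · simp
  · simp only [List.length_cons, List.length_nil]
    omega

/-- Sets the counters to the lengths of the keys, plus one. -/
def initCounts : Prog :=
  .seq (block [.const 10 0]) (.loop (.lt 10 1)
    (block [.load 11 8 10, .succ 11, .store 20 10 11, .succ 10]))

theorem run_initCounts (σ : State) :
    Run initCounts σ fun t τ => Fill 20 (σ.reg 1) (fun a => σ.arr 8 a + 1) σ (σ.reg 1) τ ∧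
      t ≤ 6 * σ.reg 1 + 3 := by
  refine Run.seq (Run.block ?_)
  refine (Run.for_const (Fill 20 (σ.reg 1) (fun a => σ.arr 8 a + 1) σ) (σ.reg 1) 5
    (fun i τ h => ⟨h.idx, h.regs 1 (by omega) (by omega)⟩) (fun i τ _ hi h => Run.block ?_)
    (Nat.zero_le _) ?_).mono fun t τ ⟨h, ht⟩ => ⟨h, ?_⟩
  · simp [h.idx, h.frame 8]
    constructor
    · intro r h1 h2
      rw [← h.regs r h1 h2]
      simp [h1, h2]
    · simp
    · intro x z hxz
      rw [← h.frame x z hxz]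
      simp
      intro e1 e2
      omega
    · intro z hz
      by_cases e : z = i
      · simp [e]
      · simp [e, h.val z (by omega)]
    · exact h.out
  · constructor
    · intro r h1 h2
      simp [h1]
    · simp
    · simp
    · simp
    · simp
  · simp only [List.length_cons, List.length_nil]
    omega

/-- Register 5 holds the atom. Its counter is set to `0` to disable it, the others to the key length
plus one, for the head; the queue starts with the head and the key of the atom. -/
def computeClosure : Prog :=
  .seq (fill 21 2 0) (.seq initCounts
    (.seq (block [.store 20 5 0, .const 10 0, .const 11 0, .const 16 1, .load 20 10 5,
      .load 21 11 5])
    (.seq addRange (propagate 16 17))))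

/-- The marks left by the closure in array 21 are kept on purpose: what is marked can neither be
queued nor passed through. The queue starts afresh, so its final length in register 11 counts the
attacked variables. -/
def computeAttacked : Prog :=
  .seq (fill 20 1 16)
    (.seq (block [.const 10 0, .const 11 0, .load 20 10 5, .load 21 12 5])
    (.seq addRange (propagate 18 19)))

theorem run_computeClosure {q : SJFBCQ} {σ : State} (hP : Prepared q σ) {f : ℕ} {F : Atom}
    (hF : q.atoms[f]? = some F) (h5 : σ.reg 5 = f)
    (hz : ∀ v, start q.atoms q.atoms.length ≤ v → σ.arr 21 v = 0) :
    Run computeClosure σ fun t τ => (∃ Q, Queue (fun _ => False) Q τ ∧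
      (∀ v ∈ Q, v < start q.atoms q.atoms.length) ∧
      ∀ o, 1 ≤ o → o < start q.atoms q.atoms.length →
        (σ.arr 15 o ∈ Q ↔ ∀ x, varAt σ.arr o = some x → x ∈ q.keycl F)) ∧
      (∀ r, r < 10 → τ.reg r = σ.reg r) ∧ τ.reg 16 = 1 ∧
      (∀ x y, x < 20 ∨ 22 < x → τ.arr x y = σ.arr x y) ∧ τ.out = σ.out ∧
      t ≤ 100 * start q.atoms q.atoms.length := by
  have hN := length_lt_start q.atoms
  have h0 := hP.parsed.zero
  have h1 := hP.parsed.len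
  have h2 := hP.parsed.pos
  have hl := hP.parsed.layout
  have hA := hl f F hF
  have hf := (List.getElem?_eq_some_iff.1 hF).1
  have hsF := start_succ hF
  have hkF := keyLen_le_args F
  have hsm := start_mono q.atoms (show f + 1 ≤ q.atoms.length by omega)
  refine Run.comp (run_fill (by omega) (by omega) (by omega) (by omega) σ) ?_
  rintro t₁ σ₁ ⟨g1, ht1⟩
  refine Run.comp (run_initCounts σ₁) ?_
  rintro t₂ σ₂ ⟨g2, ht2⟩
  have r1 : ∀ r, r ≠ 10 → r ≠ 11 → σ₁.reg r = σ.reg r := g1.regs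
  have r2 : ∀ r, r ≠ 10 → r ≠ 11 → σ₂.reg r = σ.reg r := fun r e1 e2 =>
    (g2.regs r e1 e2).trans (r1 r e1 e2)
  have hfr : ∀ x y, x < 20 ∨ 22 < x → σ₂.arr x y = σ.arr x y := fun x y hx => by
    rw [g2.frame x y (by omega), g1.frame x y (by omega)]
  refine Run.seq (Run.block ?_)
  set σ₃ := List.foldl Instr.exec σ₂ _ with hσ₃
  simp [r2, h5, hfr, hA.beg, hA.keyEnd] at hσ₃
  have q3 : Queue (fun _ => False) [] σ₃ := by
    constructor
    · simp [hσ₃]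
    · simp
    · simp
    · simp
    · intro v
      simp only [hσ₃, setReg_arr, setArr_arr, not_false_eq_true, List.not_mem_nil, and_self, iff_true]
      rw [if_neg (by omega), g2.frame _ _ (by omega)]
      by_cases e : v < σ.reg 2
      · rw [g1.val v e, h0]
      · rw [g1.frame _ _ (by omega), hz v (by omega)]
  have e20 : σ₃.reg 20 = start q.atoms f := by simp [hσ₃]
  have e21 : σ₃.reg 21 = start q.atoms f + 1 + F.rel.keyLen := by simp [hσ₃]
  refine Run.comp (run_addRange (by simp [hσ₃, r2, h0]) (by simp [hσ₃]) (by omega) q3) ?_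
  rw [e20, e21]
  rintro t₄ σ₄ ⟨⟨R, g4⟩, ht4⟩
  have a3 : ∀ x y, x < 20 ∨ 22 < x → σ₃.arr x y = σ.arr x y := fun x y hx => by
    rw [← hfr x y hx]
    simp [hσ₃]
    intro e
    omega
  have hgood : ∀ v ∈ [] ++ R, NumIn q σ.arr (q.keycl F) v := by
    intro v hv
    obtain ⟨o, k1, k2, rfl⟩ := g4.sound v hv
    rw [a3 _ _ (by omega)]
    have hlt := addr_lt hf k1 (by omega)
    exact (numIn_iff hP.num hlt.1 hlt.2).2 fun x hx =>
      q.key_subset_keycl (List.mem_of_getElem? hF) ((hl.mem_key_iff hF).2 ⟨o, k1, k2, hx⟩)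
  have hcnt : ∀ a, a < q.atoms.length → σ₄.arr 20 a = keyThreshold q f a := by
    intro a ha
    rw [g4.frame _ _ (by omega) (by omega), hσ₃, keyThreshold]
    simp only [setReg_arr, setArr_arr, true_and]
    split_ifs
    · exact h0
    · rw [g2.val a (by rw [r1 1 (by omega) (by omega), h1]; exact ha), g1.frame _ _ (by omega),
        List.getElem?_eq_getElem ha, (hl a _ (List.getElem?_eq_getElem ha)).keyLen]
  refine (run_propagate hl.env hP.keyLinks (by omega) (by omega) (closedUnder_keycl hl hP.num hF)
    ?_ ?_ ?_ g4.queue ?_ hgood hcnt ?_).mono ?_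
  · rw [g4.regs 0 (by omega) (by omega) (by omega) (by omega)]
    simp [hσ₃, r2, h0]
  · rw [g4.regs 16 (by omega) (by omega) (by omega) (by omega)]
    simp [hσ₃]
  · rw [g4.regs 10 (by omega) (by omega) (by omega) (by omega)]
    simp [hσ₃]
  · have := g4.length
    simp only [List.nil_append]
    omega
  · intro x y hx
    rw [g4.frame _ _ (by omega) (by omega), a3 x y hx]
  rintro t₅ σ₅ ⟨⟨Q, g5, hRQ, hgQ, hcl⟩, hreg, h16, hfr5, hout, ht5⟩
  refine ⟨⟨Q, g5, fun v hv => (hgQ v hv).1, fun o k1 k2 =>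
    keycl_of_closedUnder hl hP.num hF (fun o e1 e2 => ?_) hgQ hcl k1 k2⟩, fun r hr => ?_, h16, hfr5,
    ?_, ?_⟩
  · have := g4.complete o e1 e2
    rw [a3 _ _ (by omega), false_or] at this
    exact hRQ this
  · rw [hreg r hr, g4.regs r (by omega) (by omega) (by omega) (by omega), ← r2 r (by omega) (by omega),
      hσ₃]
    simp
    repeat rw [if_neg (by omega)]
  · rw [hout, g4.out, hσ₃]
    simp [g2.out, g1.out]
  · rw [r1 1 (by omega) (by omega)] at ht2
    simp only [List.length_cons, List.length_nil]
    omega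

theorem run_computeAttacked {q : SJFBCQ} {σ : State} (hP : Prepared q σ) {f : ℕ} {F : Atom}
    (hF : q.atoms[f]? = some F) (h5 : σ.reg 5 = f) (h16 : σ.reg 16 = 1) {P : List ℕ}
    (hQ : Queue (fun _ => False) P σ) (hlt : ∀ v ∈ P, v < start q.atoms q.atoms.length)
    (hM : ∀ o, 1 ≤ o → o < start q.atoms q.atoms.length →
      (σ.arr 15 o ∈ P ↔ ∀ x, varAt σ.arr o = some x → x ∈ q.keycl F)) :
    Run computeAttacked σ fun t τ => τ.reg 11 = attackCount q σ.arr F ∧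
      (∀ v, start q.atoms q.atoms.length ≤ v → τ.arr 21 v = 0) ∧
      (∀ r, r < 10 → τ.reg r = σ.reg r) ∧
      (∀ x y, x < 20 ∨ 22 < x → τ.arr x y = σ.arr x y) ∧ τ.out = σ.out ∧
      t ≤ 100 * start q.atoms q.atoms.length := by
  have hN := length_lt_start q.atoms
  have h0 := hP.parsed.zero
  have h1 := hP.parsed.len
  have hl := hP.parsed.layout
  have hA := hl f F hF
  have hf := (List.getElem?_eq_some_iff.1 hF).1
  have hsF := start_succ hF
  have hsm := start_mono q.atoms (show f + 1 ≤ q.atoms.length by omega)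
  refine Run.comp (run_fill (by omega) (by omega) (by omega) (by omega) σ) ?_
  rintro t₁ σ₁ ⟨g1, ht1⟩
  have r1 : ∀ r, r ≠ 10 → r ≠ 11 → σ₁.reg r = σ.reg r := g1.regs
  have hfr : ∀ x y, x < 20 ∨ 20 < x → σ₁.arr x y = σ.arr x y := fun x y hx => by
    rw [g1.frame x y (by omega)]
  refine Run.seq (Run.block ?_)
  set σ₃ := List.foldl Instr.exec σ₁ _ with hσ₃
  simp [r1, h5, hfr, hA.beg, hA.fin] at hσ₃
  have q3 : Queue (· ∈ P) [] σ₃ := by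
    constructor
    · simp [hσ₃]
    · simp
    · simp
    · simp
    · intro v
      simp only [hσ₃, setReg_arr]
      rw [hfr _ _ (by omega), hQ.mark]
      simp
  have e20 : σ₃.reg 20 = start q.atoms f := by simp [hσ₃]
  have e21 : σ₃.reg 21 = start q.atoms (f + 1) := by simp [hσ₃, hsF]
  refine Run.comp (run_addRange (by simp [hσ₃, r1, h0]) (by simp [hσ₃, r1, h16]) (by omega) q3) ?_
  rw [e20, e21]
  rintro t₄ σ₄ ⟨⟨R, g4⟩, ht4⟩
  have a3 : ∀ x y, x < 20 ∨ 20 < x → σ₃.arr x y = σ.arr x y := fun x y hx => by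
    rw [← hfr x y hx]
    simp [hσ₃]
  have hgood : ∀ v ∈ [] ++ R, NumOf q σ.arr (q.attacked F) v := by
    intro v hv
    -- What is queued was unmarked, hence outside the closure; the key lies inside, so these are
    -- attacked non-key variables.
    have hnP := g4.queue.disj v hv
    obtain ⟨o, k1, k2, rfl⟩ := g4.sound v hv
    rw [a3 _ _ (by omega)] at hnP ⊢
    have hlt := addr_lt hf k1 (by omega)
    rw [hM o hlt.1 hlt.2] at hnP
    push Not at hnP
    obtain ⟨x, hx, hxc⟩ := hnP
    refine (numOf_iff hP.num hlt.1 hlt.2).2 ⟨x, hx, SJFBCQ.attacksVar_of_notKey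
      (Finset.mem_sdiff.2 ⟨(hl.mem_vars_iff hF).2 ⟨o, k1, k2, hx⟩, fun hk => hxc ?_⟩) hxc⟩
    exact q.key_subset_keycl (List.mem_of_getElem? hF) hk
  have hcnt : ∀ a, a < q.atoms.length → σ₄.arr 20 a = 1 := by
    intro a ha
    rw [g4.frame _ _ (by omega) (by omega), hσ₃]
    simp only [setReg_arr]
    rw [g1.val a (by omega), h16]
  refine (run_propagate hl.env hP.allLinks (by omega) (by omega) (closedUnder_attacked hl hP.num hM)
    ?_ ?_ ?_ g4.queue ?_ hgood hcnt ?_).mono ?_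
  · rw [g4.regs 0 (by omega) (by omega) (by omega) (by omega)]
    simp [hσ₃, r1, h0]
  · rw [g4.regs 16 (by omega) (by omega) (by omega) (by omega)]
    simp [hσ₃, r1, h16]
  · rw [g4.regs 10 (by omega) (by omega) (by omega) (by omega)]
    simp [hσ₃]
  · have := g4.length
    simp only [List.nil_append]
    omega
  · intro x y hx
    rw [g4.frame _ _ (by omega) (by omega), a3 x y (by omega)]
  rintro t₅ σ₅ ⟨⟨Q, g5, hRQ, hgQ, hcl⟩, hreg, -, hfr5, hout, ht5⟩
  refine ⟨?_, fun v hv => ?_, fun r hr => ?_, hfr5, ?_, ?_⟩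
  · rw [g5.len]
    refine length_eq_attackCount hP.num g5.nodup
      (attacked_of_closedUnder hl hP.num hF hM (fun o e1 e2 => ?_) hgQ hcl)
    have := g4.complete o e1 e2
    rw [a3 _ _ (by omega)] at this
    exact this.imp_right fun h => hRQ h
  · rw [g5.mark]
    refine ⟨fun h => ?_, fun h => ?_⟩
    · have := hlt v h
      omega
    · have := (hgQ v h).lt hP.num
      omega
  · rw [hreg r hr, g4.regs r (by omega) (by omega) (by omega) (by omega), ← r1 r (by omega) (by omega),
      hσ₃]
    simp
    repeat rw [if_neg (by omega)]
  · rw [hout, g4.out, hσ₃]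
    simp [g1.out]
  · simp only [List.length_cons, List.length_nil]
    omega

/-- A linear computation for each atom, which is quadratic in total. -/
def analyze : Prog :=
  .seq (block [.const 5 0]) (.loop (.lt 5 1)
    (.seq computeClosure (.seq computeAttacked (block [.store 23 5 11, .succ 5]))))

structure Analyzed (q : SJFBCQ) (A : ℕ → ℕ → ℕ) (f : ℕ) (σ : State) : Prop where
  prepared : Prepared q σ
  idx : σ.reg 5 = f
  marks : ∀ v, start q.atoms q.atoms.length ≤ v → σ.arr 21 v = 0
  base : ∀ x y, x < 20 → σ.arr x y = A x y
  zero : ∀ x y, 23 < x → σ.arr x y = 0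
  deg : ∀ a F, a < f → q.atoms[a]? = some F → σ.arr 23 a = attackCount q A F

theorem run_analyze {q : SJFBCQ} {σ : State} (hP : Prepared q σ)
    (hz : ∀ x y, 20 ≤ x → σ.arr x y = 0) :
    Run analyze σ fun t τ => Analyzed q σ.arr q.atoms.length τ ∧
      t ≤ 210 * start q.atoms q.atoms.length ^ 2 := by
  have hN := length_lt_start q.atoms
  refine Run.seq (Run.block ?_)
  refine (Run.for_const (Analyzed q σ.arr) q.atoms.length (205 * start q.atoms q.atoms.length)
    (fun i τ h => ⟨h.idx, h.prepared.parsed.len⟩) (fun f τ _ hf h => ?_) (Nat.zero_le _)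
    ?_).mono fun t τ ⟨h, ht⟩ => ⟨h, ?_⟩
  · have hF := List.getElem?_eq_getElem hf
    refine Run.comp (run_computeClosure h.prepared hF h.idx h.marks) ?_
    rintro t₁ σ₁ ⟨⟨P, g1, g2, g3⟩, g4, g5, g6, g7, ht1⟩
    have hP1 := h.prepared.congr g7 (fun r hr => g4 r (by omega)) fun x y hx => g6 x y (by omega)
    have e15 : σ₁.arr 15 = τ.arr 15 := funext fun y => g6 15 y (by omega)
    refine Run.comp (run_computeAttacked hP1 hF ((g4 5 (by omega)).trans h.idx) g5 g1 g2 ?_) ?_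
    · rw [e15, varAt_congr (A := τ.arr) fun x y _ hx => g6 x y (by omega)]
      exact g3
    rintro t₂ σ₂ ⟨k1, k2, k3, k4, k5, ht2⟩
    have e5 : σ₂.reg 5 = f := by rw [k3 5 (by omega), g4 5 (by omega), h.idx]
    refine Run.block ?_
    simp [k1, e5]
    refine ⟨?_, by omega⟩
    constructor
    · refine hP1.congr (by simp [k5]) (fun r hr => ?_) fun x y hx => ?_
      · rw [← k3 r (by omega)]
        simp
        omega
      · rw [← k4 x y (by omega)]
        simp
        omega
    · simp
    · simpa using k2
    · intro x y hx
      simp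
      rw [if_neg (by omega), k4 x y (by omega), g6 x y (by omega), h.base x y hx]
    · intro x y hx
      simp
      rw [if_neg (by omega), k4 x y (by omega), g6 x y (by omega), h.zero x y hx]
    · intro a G ha hG
      simp
      split_ifs with e
      · subst e
        rw [hF, Option.some.injEq] at hG
        rw [hG]
        exact attackCount_congr (fun x y hx => by rw [g6 x y (by omega), h.base x y hx]) G
      · rw [k4 _ _ (by omega), g6 _ _ (by omega), h.deg a G (by omega) hG]
  · constructor
    · exact hP.congr (by simp) (fun r hr => by simp; omega) (by simp)
    · simp
    · intro v hv
      simp [hz]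
    · simp
    · intro x y hx
      simp
      exact hz x y (by omega)
    · intro a F ha
      omega
  · have h1 := Nat.mul_le_mul_left (205 * start q.atoms q.atoms.length + 1) hN.le
    simp only [List.length_cons, List.length_nil, Nat.sub_zero] at ht ⊢
    nlinarith

/-! ## Sorting the atoms -/

/-- The elements of `range n` whose degrees are `N`, …, `N + 1 - i`, in this order. -/
def sortDesc (deg : ℕ → ℕ) (N n i : ℕ) : List ℕ :=
  (List.range i).flatMap fun j => (List.range n).filter fun a => deg a = N - j

theorem mem_sortDesc {deg : ℕ → ℕ} {N n i a : ℕ} :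
    a ∈ sortDesc deg N n i ↔ a < n ∧ ∃ j < i, deg a = N - j := by
  simp only [sortDesc, List.mem_flatMap, List.mem_range, List.mem_filter, decide_eq_true_eq]
  tauto

theorem nodup_sortDesc (deg : ℕ → ℕ) (N n : ℕ) : (sortDesc deg N n (N + 1)).Nodup := by
  refine List.nodup_flatMap.2 ⟨fun j _ => List.nodup_range.filter _, ?_⟩
  -- For `j ≤ N` the truncated differences `N - j` are distinct, so different rounds collect
  -- disjoint sets.
  refine (List.pairwise_lt_range (n := N + 1)).imp_of_mem fun {j k} hj hk hjk => ?_
  rw [List.mem_range] at hj hk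
  intro a ha ha'
  simp only [List.mem_filter, decide_eq_true_eq] at ha ha'
  omega

theorem sortDesc_perm {deg : ℕ → ℕ} {N n : ℕ} (h : ∀ a, a < n → deg a ≤ N) :
    (sortDesc deg N n (N + 1)).Perm (List.range n) := by
  rw [List.perm_ext_iff_of_nodup (nodup_sortDesc deg N n) List.nodup_range]
  intro a
  rw [mem_sortDesc, List.mem_range]
  refine ⟨fun h => h.1, fun ha => ⟨ha, N - deg a, by omega, ?_⟩⟩
  have := h a ha
  omega

theorem pairwise_sortDesc (deg : ℕ → ℕ) (N n : ℕ) :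
    (sortDesc deg N n (N + 1)).Pairwise fun a b => deg b ≤ deg a := by
  refine List.pairwise_flatMap.2 ⟨fun j _ => ?_, ?_⟩
  · refine List.Pairwise.imp_of_mem (R := fun _ _ => True) (fun ha hb _ => ?_) (by simp [List.pairwise_iff_forall_sublist])
    simp only [List.mem_filter, decide_eq_true_eq] at ha hb
    omega
  · refine (List.pairwise_lt_range (n := N + 1)).imp fun hjk a ha b hb => ?_
    simp only [List.mem_filter, decide_eq_true_eq] at ha hb
    omega

/-- Register 6 runs through the possible degrees from `N` down to `0`, and each round scans all
atoms. This naive sort is quadratic, which is all that is needed. -/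
def sortAtoms : Prog :=
  .seq (block [.copy 4 2, .succ 4, .copy 6 2, .const 5 0, .const 7 0])
    (.loop (.lt 5 4)
      (.seq (block [.const 8 0])
      (.seq (.loop (.lt 8 1)
          (.seq (block [.load 10 23 8])
          (.seq (.ite (.eq 10 6) (block [.store 24 7 8, .succ 7]) (block []))
            (block [.succ 8]))))
        (block [.pred 6, .succ 5]))))

/-- The array `24` lists `L`, and register 7 is its length. -/
structure Listing (L : List ℕ) (σ₀ σ : State) : Prop where
  len : σ.reg 7 = L.length
  get : ∀ k a, L[k]? = some a → σ.arr 24 k = a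
  regs : ∀ r, r < 5 → σ.reg r = σ₀.reg r
  frame : ∀ x y, x ≠ 24 → σ.arr x y = σ₀.arr x y
  out : σ.out = σ₀.out

theorem Listing.congr {L : List ℕ} {σ₀ σ τ : State} (h : Listing L σ₀ σ)
    (h1 : ∀ r, r < 5 ∨ r = 7 → τ.reg r = σ.reg r) (h2 : τ.arr = σ.arr) (h3 : τ.out = σ.out) :
    Listing L σ₀ τ :=
  ⟨(h1 7 (by omega)).trans h.len, by rw [h2]; exact h.get,
    fun r hr => (h1 r (by omega)).trans (h.regs r hr), by rw [h2]; exact h.frame, h3.trans h.out⟩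

theorem run_sortAtoms (σ : State) :
    Run sortAtoms σ fun t τ =>
      Listing (sortDesc (σ.arr 23) (σ.reg 2) (σ.reg 1) (σ.reg 2 + 1))
        (σ.setReg 4 (σ.reg 2 + 1)) τ ∧
      t ≤ (10 * σ.reg 1 + 10) * (σ.reg 2 + 1) + 10 := by
  refine Run.seq (Run.block ?_)
  set σ₁ := List.foldl Instr.exec σ _ with hσ₁
  simp at hσ₁
  set σ₂ := σ.setReg 4 (σ.reg 2 + 1) with hσ₂
  set deg := σ.arr 23 with hdeg
  refine (Run.for_const (fun i τ => Listing (sortDesc deg (σ.reg 2) (σ.reg 1) i) σ₂ τ ∧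
    τ.reg 5 = i ∧ τ.reg 6 = σ.reg 2 - i) (σ.reg 2 + 1) (9 * σ.reg 1 + 8) ?_ ?_ (Nat.zero_le _)
    ⟨?_, ?_, ?_⟩).mono fun t τ ⟨h, ht⟩ => ⟨h.1, ?_⟩
  · rintro i τ ⟨h, h5, -⟩
    exact ⟨h5, by simp [h.regs 4, hσ₂]⟩
  · rintro i τ - hi ⟨h, h5, h6⟩
    refine Run.seq (Run.block ?_)
    simp
    refine Run.comp (Run.for_const (s := 0) (fun a υ =>
      Listing (sortDesc deg (σ.reg 2) (σ.reg 1) i ++ (List.range a).filter fun a => deg a = σ.reg 2 - i)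
        σ₂ υ ∧ υ.reg 5 = i ∧ υ.reg 6 = σ.reg 2 - i ∧ υ.reg 8 = a) (σ.reg 1) 8 ?_ ?_ (Nat.zero_le _) ?_) ?_
    · rintro a υ ⟨g, -, -, h8⟩
      exact ⟨h8, by simp [g.regs 1, hσ₂]⟩
    · rintro a υ - ha ⟨g, g5, g6, g8⟩
      have e23 : υ.arr 23 a = deg a := g.frame _ _ (by omega)
      refine Run.seq (Run.block ?_)
      refine Run.seq (Run.ite (fun hb => Run.block (Run.block ?_)) fun hb => Run.block (Run.block ?_))
      · simp [Test.Holds, g8, e23, g6] at hb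
        simp [g8, e23, g5, g6, List.range_succ, List.filter_append, hb]
        constructor
        · simp [g.len]
          omega
        · intro k b hk
          rw [← List.append_assoc, List.getElem?_append] at hk
          have hl := g.len
          split_ifs at hk with hkl
          · have : k ≠ υ.reg 7 := by omega
            simp [this, g.get k b hk]
          · rw [List.getElem?_singleton] at hk
            split_ifs at hk with hk0
            have : k = υ.reg 7 := by omega
            simp [this, Option.some.inj hk]
        · intro r hr
          rw [← g.regs r hr]
          simp
          repeat rw [if_neg (by omega)]
        · intro x y hx
          rw [← g.frame x y hx]
          simp [hx]
        · simp [g.out]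
      · simp [Test.Holds, g8, e23, g6] at hb
        simp [g8, e23, g5, g6, List.range_succ, List.filter_append, hb]
        refine g.congr (fun r hr => ?_) rfl rfl
        simp
        repeat rw [if_neg (by omega)]
    · simp [h5, h6]
      refine h.congr (fun r hr => ?_) rfl rfl
      simp
      omega
    · rintro t υ ⟨⟨g, g5, g6, g8⟩, ht⟩
      refine Run.block ?_
      simp [g5, g6]
      refine ⟨⟨?_, by omega⟩, by omega⟩
      rw [sortDesc, List.range_succ, List.flatMap_append, List.flatMap_singleton]
      refine g.congr (fun r hr => ?_) rfl rfl
      simp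
      repeat rw [if_neg (by omega)]
  · constructor
    · simp [hσ₁, sortDesc]
    · simp [sortDesc]
    · intro r hr
      simp [hσ₁, hσ₂]
      repeat rw [if_neg (by omega)]
      split_ifs <;> rfl
    · simp [hσ₁, hσ₂]
    · simp [hσ₁, hσ₂]
  · simp [hσ₁]
  · simp [hσ₁]
  · simp only [List.length_cons, List.length_nil, Nat.sub_zero] at ht ⊢
    nlinarith

theorem filterMap_getElem?_range {α : Type*} (l : List α) :
    (List.range l.length).filterMap (fun a => l[a]?) = l := by
  have h : (List.range l.length).map (fun a => l[a]?) = l.map some := by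
    refine List.ext_getElem (by simp) fun i h1 h2 => ?_
    simp
  have := congrArg (List.filterMap id) h
  simpa [List.filterMap_map, Function.comp_def] using this

/-- Sorting by the number of attacked variables yields a topological sort. -/
theorem isTopologicalSort_sortDesc {q : SJFBCQ} {A : ℕ → ℕ → ℕ} (hl : Layout q.atoms A)
    (hnum : ∀ o, 1 ≤ o → o < start q.atoms q.atoms.length → A 15 o = vid A o)
    (hac : q.AcyclicAttackGraph) {deg : ℕ → ℕ}
    (hdeg : ∀ a F, q.atoms[a]? = some F → deg a = attackCount q A F) :
    q.IsTopologicalSort ((sortDesc deg (start q.atoms q.atoms.length) q.atoms.length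
      (start q.atoms q.atoms.length + 1)).filterMap fun a => q.atoms[a]?) := by
  constructor
  · have := (sortDesc_perm (N := start q.atoms q.atoms.length) (n := q.atoms.length) (deg := deg) fun a ha => ?_).filterMap
      fun a => q.atoms[a]?
    · rwa [filterMap_getElem?_range] at this
    · rw [hdeg a _ (List.getElem?_eq_getElem ha)]
      exact attackCount_le _
  · refine List.Pairwise.filterMap _ (fun a b hab F hF G hG hGF => ?_) (pairwise_sortDesc _ _ _)
    have := attackCount_lt_of_attacks hl hnum hac hGF
    rw [hdeg a F hF, hdeg b G hG] at hab
    omega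

/-! ## Marking the first occurrences of variables along the sorted atoms -/

/-- The variables at the addresses with entry `0` in array `25` are those outside `W`. -/
def Seen (q : SJFBCQ) (A : ℕ → ℕ → ℕ) (W : Finset Var) (σ : State) : Prop :=
  ∀ o, 1 ≤ o → o < start q.atoms q.atoms.length →
    (σ.arr 25 (A 15 o) = 0 ↔ ∃ x, varAt A o = some x ∧ x ∉ W)

/-- Array `26` tells whether argument `j` is a variable that occurs neither in `V` nor before, and
array `27` numbers the arguments from `m` on; `s` is the first address of the atom. -/
def MarkedAt (B : ℕ → ℕ → ℕ) (m s : ℕ) (V : Finset Var) (F : Atom) (j : ℕ) : Prop :=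
  B 27 (s + 1 + j) = m + j ∧ ∀ t, F.args[j]? = some t →
    (B 26 (s + 1 + j) ≠ 0 ↔ ∃ x, t = .var x ∧ x ∉ V ∪ varsOf (F.args.take j))

def markCell : Prog :=
  .seq (block [.load 10 15 7, .load 11 25 10, .store 27 7 9])
    (.seq (.ite (.eq 11 0) (block [.store 26 7 12, .store 25 10 12]) (block [.store 26 7 0]))
      (block [.succ 7, .succ 9]))

/-- Number `0` is declared seen at the outset, so constants never count as new variables. Register 9
restarts for each atom one above the maximum in register 3, so all atoms use the same fresh indices.
-/
def markNew : Prog :=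
  .seq (block [.const 12 1, .store 25 0 12, .const 5 0])
    (.loop (.lt 5 1)
      (.seq (block [.load 6 24 5, .load 7 10 6, .load 8 12 6, .succ 7, .copy 9 3, .succ 9])
        (.seq (.loop (.lt 7 8) markCell) (block [.succ 5]))))

structure MarkCells (q : SJFBCQ) (A : ℕ → ℕ → ℕ) (V : Finset Var) (F : Atom) (a : ℕ) (σ₀ : State)
    (o : ℕ) (σ : State) : Prop where
  idx : σ.reg 7 = o
  pos : σ.reg 9 + start q.atoms a = σ₀.reg 3 + o
  regs : ∀ r, r ≠ 7 → r ≠ 9 → r ≠ 10 → r ≠ 11 → σ.reg r = σ₀.reg r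
  seen : Seen q A (V ∪ varsOf (F.args.take (o - start q.atoms a - 1))) σ
  marked : ∀ j, start q.atoms a + 1 + j < o →
    MarkedAt σ.arr (σ₀.reg 3 + 1) (start q.atoms a) V F j
  frame : ∀ x y, x < 25 → σ.arr x y = σ₀.arr x y
  frame' : ∀ x y, 26 ≤ x → (y < start q.atoms a ∨ start q.atoms (a + 1) ≤ y) →
    σ.arr x y = σ₀.arr x y
  out : σ.out = σ₀.out

theorem varsOf_take_succ {l : List Term} {j : ℕ} {t : Term} (h : l[j]? = some t) :
    varsOf (l.take (j + 1)) = varsOf (l.take j) ∪ t.vars := by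
  ext x
  simp only [mem_varsOf, Finset.mem_union, List.take_add_one, h, Option.toList_some,
    List.mem_append, List.mem_singleton, or_and_right, exists_or, exists_eq_left]

theorem run_markCell {q : SJFBCQ} {A : ℕ → ℕ → ℕ} {V : Finset Var} {F : Atom} {a : ℕ} {σ₀ σ : State}
    {o : ℕ} (hl : Layout q.atoms A)
    (hnum : ∀ o, 1 ≤ o → o < start q.atoms q.atoms.length → A 15 o = vid A o)
    (hF : q.atoms[a]? = some F) (h0 : σ₀.reg 0 = 0) (h12 : σ₀.reg 12 = 1)
    (hA : ∀ y, σ₀.arr 15 y = A 15 y)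
    (h1 : start q.atoms a + 1 ≤ o) (h2 : o < start q.atoms (a + 1))
    (h : MarkCells q A V F a σ₀ o σ) :
    Run markCell σ fun t τ => MarkCells q A V F a σ₀ (o + 1) τ ∧ t ≤ 12 := by
  have ha := (List.getElem?_eq_some_iff.1 hF).1
  have hs := start_succ hF
  obtain ⟨j, rfl⟩ : ∃ j, o = start q.atoms a + 1 + j := ⟨o - start q.atoms a - 1, by omega⟩
  have hj : j < F.args.length := by omega
  have hget : F.args[j]? = some F.args[j] := List.getElem?_eq_getElem hj
  set t := F.args[j]
  have hv : varAt A (start q.atoms a + 1 + j) = t.var? := by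
    rw [(hl.cell hF (by omega) h2).2.2, if_neg (by omega),
      show start q.atoms a + 1 + j - start q.atoms a - 1 = j by omega, hget]
    rfl
  have hlt := addr_lt ha (by omega) h2
  have e15 : σ.arr 15 (start q.atoms a + 1 + j) = A 15 (start q.atoms a + 1 + j) := by
    rw [h.frame _ _ (by omega), hA]
  have r0 : σ.reg 0 = 0 := (h.regs 0 (by omega) (by omega) (by omega) (by omega)).trans h0
  have r12 : σ.reg 12 = 1 := (h.regs 12 (by omega) (by omega) (by omega) (by omega)).trans h12
  have h7 := h.idx
  have h9 := h.pos
  have hseen := h.seen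
  rw [show start q.atoms a + 1 + j - start q.atoms a - 1 = j by omega] at hseen
  have hso := hseen _ hlt.1 hlt.2
  have hW : V ∪ varsOf (F.args.take (start q.atoms a + 1 + j + 1 - start q.atoms a - 1)) =
      V ∪ varsOf (F.args.take j) ∪ t.vars := by
    rw [show start q.atoms a + 1 + j + 1 - start q.atoms a - 1 = j + 1 by omega,
      varsOf_take_succ hget, Finset.union_assoc]
  have hmo : ∀ B : ℕ → ℕ → ℕ, B 27 (start q.atoms a + 1 + j) = σ.reg 9 →
      (B 26 (start q.atoms a + 1 + j) ≠ 0 ↔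
        σ.arr 25 (A 15 (start q.atoms a + 1 + j)) = 0) →
      MarkedAt B (σ₀.reg 3 + 1) (start q.atoms a) V F j := by
    intro B e1 e2
    refine ⟨by omega, fun t' ht' => ?_⟩
    obtain rfl : t = t' := by rwa [hget, Option.some.injEq] at ht'
    rw [e2, hso, hv]
    refine exists_congr fun x => and_congr_left' ?_
    cases t <;> simp [Term.var?]
  refine Run.seq (Run.block ?_)
  refine Run.seq (Run.ite (fun hb => Run.block (Run.block ?_)) fun hb => Run.block (Run.block ?_))
  · simp [Test.Holds, h7, e15, r0] at hb
    simp [h7, e15, r12]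
    obtain ⟨x, hx, hxW⟩ := hso.1 hb
    constructor
    · simp
    · simp
      omega
    · intro r e1 e2 e3 e4
      rw [← h.regs r e1 e2 e3 e4]
      simp [*]
    · intro o e1 e2
      rw [hW]
      generalize V ∪ varsOf (List.take j F.args) = W at hseen hxW ⊢
      have hvars : t.vars = {x} := by
        have : t.var? = some x := hv.symm.trans hx
        cases ht : t with
        | var y =>
          rw [ht, Term.var?, Option.some.injEq] at this
          rw [Term.vars, this]
        | const c => simp [ht, Term.var?] at this
      rw [hvars]
      simp
      -- Marking one number as seen marks exactly the addresses of the same variable, because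
      -- numbers identify variables.
      split_ifs with e
      · have : varAt A o = some x := by
          rw [hnum o e1 e2, hnum _ hlt.1 hlt.2, vid_eq_iff (by omega) (by omega)] at e
          rw [e, hx]
        simp [this]
      · rw [hseen o e1 e2]
        refine exists_congr fun y => and_congr_right fun hy => ?_
        refine ⟨fun hyW => ⟨?_, hyW⟩, fun h => h.2⟩
        rintro rfl
        refine e ?_
        rw [hnum o e1 e2, hnum _ hlt.1 hlt.2, vid_eq_iff (by omega) (by omega), hx, hy]
    · intro i hi
      by_cases e : i = j
      · subst e
        refine hmo _ (by simp) (by simp [hb])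
      · have := h.marked i (by omega)
        simpa [MarkedAt, e] using this
    · intro x y hx
      rw [← h.frame x y hx]
      simp
      repeat rw [if_neg (by omega)]
    · intro x y hx hy
      rw [← h.frame' x y hx hy]
      simp
      repeat rw [if_neg (by omega)]
    · simp [h.out]
  · simp [Test.Holds, h7, e15, r0] at hb
    simp [h7, r0]
    have hno := fun x hx hxW => hb (hso.2 ⟨x, hx, hxW⟩)
    constructor
    · simp
    · simp
      omega
    · intro r e1 e2 e3 e4
      rw [← h.regs r e1 e2 e3 e4]
      simp [*]
    · intro o e1 e2
      rw [hW]
      generalize V ∪ varsOf (List.take j F.args) = W at hseen hno ⊢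
      simp
      rw [hseen o e1 e2]
      refine exists_congr fun y => and_congr_right fun hy => ?_
      rw [iff_self_and]
      exact fun hyW hyt => hno y (hv.trans (mem_vars_term.1 hyt)) hyW
    · intro i hi
      by_cases e : i = j
      · subst e
        refine hmo _ (by simp) (by simp [hb])
      · have := h.marked i (by omega)
        simpa [MarkedAt, e] using this
    · intro x y hx
      rw [← h.frame x y hx]
      simp
      repeat rw [if_neg (by omega)]
    · intro x y hx hy
      rw [← h.frame' x y hx hy]
      simp
      repeat rw [if_neg (by omega)]
    · simp [h.out]

structure MarkAtoms (q : SJFBCQ) (A : ℕ → ℕ → ℕ) (L : List ℕ) (l : List Atom) (σ₀ : State)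
    (k : ℕ) (σ : State) : Prop where
  idx : σ.reg 5 = k
  regs : ∀ r, r < 5 → σ.reg r = σ₀.reg r
  one : σ.reg 12 = 1
  seen : Seen q A (atomsVars (l.take k)) σ
  marked : ∀ i a F, i < k → L[i]? = some a → l[i]? = some F → ∀ j, j < F.args.length →
    MarkedAt σ.arr (σ₀.reg 3 + 1) (start q.atoms a) (atomsVars (l.take i)) F j
  frame : ∀ x y, x < 25 → σ.arr x y = σ₀.arr x y
  out : σ.out = σ₀.out

theorem getElem?_of_map_eq {q : SJFBCQ} {L : List ℕ} {l : List Atom}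
    (h : L.map (fun a => q.atoms[a]?) = l.map some) {k a : ℕ} (hk : L[k]? = some a) :
    ∃ F, q.atoms[a]? = some F ∧ l[k]? = some F := by
  have := congrArg (fun x => x[k]?) h
  simp only [List.getElem?_map, hk, Option.map_some] at this
  cases hl : l[k]? with
  | none => simp [hl] at this
  | some F => exact ⟨F, by simpa [hl] using this, rfl⟩

theorem run_markNew {q : SJFBCQ} {σ : State} (hP : Prepared q σ) {L : List ℕ} {l : List Atom}
    (hL : L.map (fun a => q.atoms[a]?) = l.map some) (hperm : L.Perm (List.range q.atoms.length))
    (hord : ∀ k a, L[k]? = some a → σ.arr 24 k = a) (hz : ∀ x y, 24 < x → σ.arr x y = 0) :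
    Run markNew σ fun t τ => MarkAtoms q σ.arr L l σ q.atoms.length τ ∧
      t ≤ 30 * start q.atoms q.atoms.length ^ 2 := by
  have hN := length_lt_start q.atoms
  have hlay := hP.parsed.layout
  have h0 := hP.parsed.zero
  have hlen : L.length = q.atoms.length := by simpa using hperm.length_eq
  have hnd : L.Nodup := hperm.nodup_iff.2 List.nodup_range
  refine Run.seq (Run.block ?_)
  refine (Run.for_const (MarkAtoms q σ.arr L l σ) q.atoms.length
    (13 * start q.atoms q.atoms.length + 10)
    (fun i τ h => ⟨h.idx, (h.regs 1 (by omega)).trans hP.parsed.len⟩) (fun k τ _ hk h => ?_)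
    (Nat.zero_le _) ?_).mono fun t τ ⟨h, ht⟩ => ⟨h, ?_⟩
  · have hLk : L[k]? = some L[k] := List.getElem?_eq_getElem (by omega)
    set a := L[k] with ha'
    obtain ⟨F, hF, hlk⟩ := getElem?_of_map_eq hL hLk
    have ha := (List.getElem?_eq_some_iff.1 hF).1
    have hs := start_succ hF
    have hsm := start_mono q.atoms (show a + 1 ≤ q.atoms.length by omega)
    have e24 : τ.arr 24 k = a := (h.frame _ _ (by omega)).trans (hord k a hLk)
    have e10 : τ.arr 10 a = start q.atoms a :=
      (h.frame _ _ (by omega)).trans (hlay a F hF).beg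
    have e12 : τ.arr 12 a = start q.atoms (a + 1) := by
      rw [h.frame _ _ (by omega), (hlay a F hF).fin, hs]
    refine Run.seq (Run.block ?_)
    simp [h.idx, e24, e10, e12]
    set τ₁ := ((((((τ.setReg 6 a).setReg 7 (start q.atoms a)).setReg 8 (start q.atoms (a + 1))).setReg 7
      (start q.atoms a + 1)).setReg 9 (τ.reg 3)).setReg 9 (τ.reg 3 + 1)) with hτ₁
    have e3 : τ₁.reg 3 = σ.reg 3 := by simp [hτ₁, h.regs 3]
    refine Run.comp (Run.for_const (MarkCells q σ.arr (atomsVars (l.take k)) F a τ₁)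
      (start q.atoms (a + 1)) 12 (fun o υ g => ⟨g.idx, ?_⟩)
      (fun o υ h1 h2 g => run_markCell hlay hP.num hF ?_ ?_ ?_ h1 h2 g)
      (s := start q.atoms a + 1) (by omega) ?_) ?_
    · rw [g.regs 8 (by omega) (by omega) (by omega) (by omega)]
      simp [hτ₁]
    · simp [hτ₁, h.regs 0, h0]
    · simp [hτ₁, h.one]
    · simp [hτ₁, h.frame]
    · constructor
      · simp [hτ₁]
      · simp [hτ₁]
        omega
      · exact fun _ _ _ _ _ => rfl
      · have := h.seen
        rw [show start q.atoms a + 1 - start q.atoms a - 1 = 0 by omega]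
        simpa [Seen, hτ₁, varsOf] using this
      · intro j hj
        omega
      · exact fun _ _ _ => rfl
      · exact fun _ _ _ _ => rfl
      · rfl
    · rintro t₂ υ ⟨g, ht₂⟩
      refine Run.block ?_
      have r5 : υ.reg 5 = k := by
        rw [g.regs 5 (by omega) (by omega) (by omega) (by omega)]
        simp [hτ₁, h.idx]
      simp [r5]
      refine ⟨?_, by omega⟩
      have hVs : atomsVars (l.take (k + 1)) = atomsVars (l.take k) ∪ F.vars := by
        ext x
        simp only [mem_atomsVars, Finset.mem_union, List.take_add_one, hlk, Option.toList_some,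
          List.mem_append, List.mem_singleton, or_and_right, exists_or, exists_eq_left]
      constructor
      · simp
      · intro r hr
        simp
        rw [if_neg (by omega), g.regs r (by omega) (by omega) (by omega) (by omega), ← h.regs r hr]
        simp [hτ₁]
        repeat rw [if_neg (by omega)]
      · simp
        rw [g.regs 12 (by omega) (by omega) (by omega) (by omega)]
        simp [hτ₁, h.one]
      · have := g.seen
        rw [hs, show start q.atoms a + 1 + F.args.length - start q.atoms a - 1 = F.args.length by omega,
          List.take_length] at this
        rw [hVs]
        exact this
      · intro i b G hi hLi hli j hj
        rcases Nat.lt_succ_iff_lt_or_eq.1 hi with hi | rfl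
        · have hm := h.marked i b G hi hLi hli j hj
          have hba : b ≠ a := by
            rintro rfl
            obtain ⟨hi', e⟩ := List.getElem?_eq_some_iff.1 hLi
            have := (hnd.getElem_inj_iff).1 (e.trans ha')
            omega
          obtain ⟨G', hG', hlG'⟩ := getElem?_of_map_eq hL hLi
          obtain rfl : G = G' := by rwa [hli, Option.some.injEq] at hlG'
          have hsb := start_succ hG'
          -- `L` has no repetitions, so the cells of atoms treated earlier lie outside the range
          -- being written.
          have hdis : start q.atoms b + 1 + j < start q.atoms a ∨
              start q.atoms (a + 1) ≤ start q.atoms b + 1 + j := by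
            rcases Nat.lt_or_gt_of_ne hba with hlt | hlt
            · have := start_mono q.atoms (show b + 1 ≤ a by omega)
              omega
            · have := start_mono q.atoms (show a + 1 ≤ b by omega)
              omega
          unfold MarkedAt at hm ⊢
          simp only [setReg_arr]
          rw [g.frame' _ _ (by omega) hdis, g.frame' _ _ (by omega) hdis]
          exact hm
        · obtain rfl : a = b := by rwa [hLk, Option.some.injEq] at hLi
          obtain rfl : F = G := by rwa [hlk, Option.some.injEq] at hli
          have := g.marked j (by omega)
          rwa [e3] at this
      · intro x y hx
        exact (g.frame x y hx).trans (h.frame x y hx)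
      · exact g.out.trans h.out
  · simp [h0]
    constructor
    · simp
    · intro r hr
      simp
      repeat rw [if_neg (by omega)]
    · simp
    · intro o h1 h2
      simp [hz, atomsVars]
      -- At the beginning only number `0` is seen, and it stands for the addresses without a
      -- variable.
      rw [hP.num o h1 h2, vid_eq_zero_iff (by omega)]
      cases varAt σ.arr o <;> simp
    · intro i a F hi
      omega
    · intro x y hx
      simp
      omega
    · simp
  · have := Nat.mul_le_mul_left (13 * start q.atoms q.atoms.length + 10 + 1) hN.le
    simp only [List.length_cons, List.length_nil, Nat.sub_zero] at ht ⊢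
    nlinarith

/-! ## Printing -/

/-- In a state with arrays `A` and registers `ρ` below `b`, the program `P` prints `l` within `c`
steps and leaves `A` and these registers unchanged. -/
def Prints (b : ℕ) (A : ℕ → ℕ → ℕ) (ρ : ℕ → ℕ) (P : Prog) (l : List ℕ) (c : ℕ) : Prop :=
  ∀ σ : State, σ.arr = A → (∀ r, r < b → σ.reg r = ρ r) → Run P σ fun t τ =>
    τ.out = σ.out ++ l ∧ τ.arr = A ∧ (∀ r, r < b → τ.reg r = ρ r) ∧ t ≤ c

section Prints

variable {b c c' : ℕ} {A : ℕ → ℕ → ℕ} {ρ : ℕ → ℕ} {P R : Prog} {l l' : List ℕ}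

theorem Prints.mono (h : Prints b A ρ P l c) (hl : l = l') (hc : c ≤ c') :
    Prints b A ρ P l' c' := by
  subst hl
  exact fun σ h1 h2 => (h σ h1 h2).mono fun t τ ⟨e1, e2, e3, e4⟩ => ⟨e1, e2, e3, e4.trans hc⟩

theorem Prints.seq (h : Prints b A ρ P l c) (h' : Prints b A ρ R l' c') :
    Prints b A ρ (.seq P R) (l ++ l') (c + c') := fun σ h1 h2 => by
  refine Run.comp (h σ h1 h2) ?_
  rintro s τ ⟨e1, e2, e3, e4⟩
  refine (h' τ e2 e3).mono fun t υ ⟨g1, g2, g3, g4⟩ => ⟨?_, g2, g3, by omega⟩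
  rw [g1, e1, List.append_assoc]

theorem Prints.init {b' : ℕ} {init : List Instr} {Φ : (ℕ → ℕ) → Prop} (hb : b ≤ b')
    (hi : ∀ σ : State, σ.arr = A → (∀ r, r < b → σ.reg r = ρ r) →
      (init.foldl Instr.exec σ).arr = A ∧ (init.foldl Instr.exec σ).out = σ.out ∧
      (∀ r, r < b → (init.foldl Instr.exec σ).reg r = ρ r) ∧ Φ (init.foldl Instr.exec σ).reg)
    (h : ∀ ρ', (∀ r, r < b → ρ' r = ρ r) → Φ ρ' → Prints b' A ρ' P l c) :
    Prints b A ρ (.seq (block init) P) l (init.length + 1 + c) := fun σ h1 h2 => by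
  obtain ⟨e1, e2, e3, e4⟩ := hi σ h1 h2
  refine Run.seq (Run.block ((h _ e3 e4 _ e1 fun _ _ => rfl).mono fun t τ ⟨g1, g2, g3, g4⟩ =>
    ⟨?_, g2, fun r hr => ?_, by omega⟩))
  · rw [g1, e2]
  · rw [g3 r (by omega), e3 r hr]

/-- A loop whose counter is register `b` and whose bound is register `b + 1`. -/
def forLoop (b : ℕ) (init : List Instr) (P : Prog) : Prog :=
  .seq (block init) (.loop (.lt b (b + 1)) (.seq P (block [.succ b])))

theorem Prints.for {init : List Instr} {s e : ℕ} {f : ℕ → List ℕ} {d : ℕ → ℕ} (hse : s ≤ e)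
    (hi : ∀ σ : State, σ.arr = A → (∀ r, r < b → σ.reg r = ρ r) →
      (init.foldl Instr.exec σ).arr = A ∧ (init.foldl Instr.exec σ).out = σ.out ∧
      (∀ r, r < b → (init.foldl Instr.exec σ).reg r = ρ r) ∧
      (init.foldl Instr.exec σ).reg b = s ∧ (init.foldl Instr.exec σ).reg (b + 1) = e)
    (h : ∀ i ρ', s ≤ i → i < e → (∀ r, r < b → ρ' r = ρ r) → ρ' b = i → ρ' (b + 1) = e →
      Prints (b + 2) A ρ' P (f i) (d i)) :
    Prints b A ρ (forLoop b init P) ((List.range' s (e - s)).flatMap f)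
      (init.length + 2 + ∑ i ∈ Finset.Ico s e, (d i + 3)) := fun σ h1 h2 => by
  obtain ⟨e1, e2, e3, e4, e5⟩ := hi σ h1 h2
  refine Run.seq (Run.block ?_)
  refine (Run.for (fun i τ => τ.out = σ.out ++ (List.range' s (i - s)).flatMap f ∧ τ.arr = A ∧
    (∀ r, r < b → τ.reg r = ρ r) ∧ τ.reg b = i ∧ τ.reg (b + 1) = e) e (fun i => d i + 2)
    (fun i τ h => ⟨h.2.2.2.1, h.2.2.2.2⟩) ?_ hse ⟨?_, e1, e3, e4, e5⟩).mono ?_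
  · rintro i τ hi1 hi2 ⟨g1, g2, g3, g4, g5⟩
    refine Run.comp (h i τ.reg hi1 hi2 g3 g4 g5 τ g2 fun _ _ => rfl) ?_
    rintro t υ ⟨k1, k2, k3, k4⟩
    refine Run.block ⟨⟨?_, ?_, ?_, ?_, ?_⟩, ?_⟩
    · simp [k1, g1, Nat.succ_sub hi1, List.range'_concat, Nat.add_sub_cancel' hi1]
    · simpa using k2
    · intro r hr
      have : r ≠ b := by omega
      simp [this, k3 r (by omega), g3 r hr]
    · simp [k3 b (by omega), g4]
    · simp [k3 (b + 1) (by omega), g5]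
    · simp only [List.length_cons, List.length_nil]
      omega
  · simp [e2]
  · rintro t τ ⟨⟨g1, g2, g3, -⟩, ht⟩
    simp only [Nat.add_assoc, Nat.reduceAdd] at ht ⊢
    exact ⟨g1, g2, g3, by omega⟩

/-- A printed symbol: a literal, or an entry of an array. -/
inductive Field where
  | lit (c : ℕ)
  | arr (x : ℕ)

def Field.code (r : ℕ) : Field → List Instr
  | .lit c => [.const 11 c, .print 11]
  | .arr x => [.load 11 x r, .print 11]

def Field.val (A : ℕ → ℕ → ℕ) (i : ℕ) : Field → ℕ
  | .lit c => c
  | .arr x => A x i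

/-- Prints the given fields for the index in register `r`. -/
def printFields (r : ℕ) (fs : List Field) : Prog := block (fs.flatMap (Field.code r))

theorem prints_fields {r : ℕ} (hr : r < b) (hb : b ≤ 11) (fs : List Field) :
    Prints b A ρ (printFields r fs) (fs.map (Field.val A (ρ r))) (2 * fs.length + 1) :=
    fun σ h1 h2 => by
  refine Run.block ?_
  have hlen : (fs.flatMap (Field.code r)).length = 2 * fs.length := by
    induction fs with
    | nil => rfl
    | cons f fs ih =>
      rw [List.flatMap_cons, List.length_append, ih, List.length_cons]
      cases f <;> simp [Field.code] <;> omega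
  rw [hlen]
  suffices H : (List.foldl Instr.exec σ (fs.flatMap (Field.code r))).out
      = σ.out ++ fs.map (Field.val A (ρ r)) ∧
      (List.foldl Instr.exec σ (fs.flatMap (Field.code r))).arr = A ∧
      ∀ s, s < b → (List.foldl Instr.exec σ (fs.flatMap (Field.code r))).reg s = ρ s from
    ⟨H.1, H.2.1, H.2.2, le_rfl⟩
  clear hlen
  induction fs generalizing σ with
  | nil => simpa using ⟨h1, h2⟩
  | cons f fs ih =>
    rw [List.flatMap_cons, List.foldl_append]
    have hs : (List.foldl Instr.exec σ (Field.code r f)).out = σ.out ++ [Field.val A (ρ r) f] ∧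
        (List.foldl Instr.exec σ (Field.code r f)).arr = A ∧
        ∀ s, s < b → (List.foldl Instr.exec σ (Field.code r f)).reg s = ρ s := by
      have hne : ∀ s, s < b → s ≠ 11 := fun s hs => by omega
      cases f with
      | lit c =>
        refine ⟨by simp [Field.code, Field.val], by simpa [Field.code] using h1, fun s hs => ?_⟩
        simp [Field.code, hne s hs, h2 s hs]
      | arr x =>
        refine ⟨by simp [Field.code, Field.val, h1, h2 r hr], by simpa [Field.code] using h1,
          fun s hs => ?_⟩
        simp [Field.code, hne s hs, h2 s hs]
    obtain ⟨g1, g2, g3⟩ := ih _ hs.2.1 hs.2.2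
    refine ⟨?_, g2, g3⟩
    rw [g1, hs.1, List.map_cons, List.append_assoc, List.singleton_append]

/-- Prints the fields for all addresses in a range. -/
def printCells (init : List Instr) (fs : List Field) : Prog := forLoop 9 init (printFields 9 fs)

/-- Prints a quantifier for each address in a range that holds a new variable. -/
def printNew (init : List Instr) : Prog :=
  forLoop 9 init (.seq (block [.load 11 26 9])
    (.ite (.eq 11 0) (block []) (printFields 9 [.lit 8, .arr 2, .arr 3])))

def allCells : List Instr := [.load 9 10 8, .succ 9, .load 10 12 8]

def keyCells : List Instr := [.load 9 10 8, .succ 9, .load 10 11 8]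

def restCells : List Instr := [.load 9 11 8, .load 10 12 8]

/-- The instructions `init` set the counter and the bound to `s` and `e`. -/
def Sets (A : ℕ → ℕ → ℕ) (ρ : ℕ → ℕ) (init : List Instr) (s e : ℕ) : Prop :=
  s ≤ e ∧ init.length ≤ 3 ∧ ∀ σ : State, σ.arr = A → (∀ r, r < 9 → σ.reg r = ρ r) →
    (init.foldl Instr.exec σ).arr = A ∧ (init.foldl Instr.exec σ).out = σ.out ∧
    (∀ r, r < 9 → (init.foldl Instr.exec σ).reg r = ρ r) ∧
    (init.foldl Instr.exec σ).reg 9 = s ∧ (init.foldl Instr.exec σ).reg (9 + 1) = e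

theorem prints_cells {init : List Instr} {s e : ℕ} (h : Sets A ρ init s e) (fs : List Field) :
    Prints 9 A ρ (printCells init fs)
      ((List.range' s (e - s)).flatMap fun o => fs.map (Field.val A o))
      (5 + (e - s) * (2 * fs.length + 4)) := by
  obtain ⟨h1, h2, h3⟩ := h
  refine (Prints.for (d := fun _ => 2 * fs.length + 1) h1 h3 fun i ρ' _ _ _ hi _ =>
    (prints_fields (by omega) (by omega) fs).mono ?_ le_rfl).mono rfl ?_
  · rw [hi]
  · simp only [Finset.sum_const, Nat.card_Ico, smul_eq_mul, Nat.add_assoc, Nat.reduceAdd]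
    omega

theorem prints_new {init : List Instr} {s e : ℕ} (h : Sets A ρ init s e) (h0 : ρ 0 = 0) :
    Prints 9 A ρ (printNew init)
      ((List.range' s (e - s)).flatMap fun o => if A 26 o = 0 then [] else [8, A 2 o, A 3 o])
      (5 + (e - s) * 13) := by
  obtain ⟨h1, h2, h3⟩ := h
  refine (Prints.for (d := fun _ => 10) h1 h3 fun i ρ' _ _ hlt hi _ => ?_).mono rfl ?_
  · intro σ g1 g2
    have e9 : σ.reg 9 = i := (g2 9 (by omega)).trans hi
    have e0 : σ.reg 0 = 0 := by rw [g2 0 (by omega), hlt 0 (by omega), h0]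
    refine Run.seq (Run.block ?_)
    simp only [List.foldl_cons, List.foldl_nil, exec_load, e9, g1, List.length_cons,
      List.length_nil]
    have hreg : ∀ r, r < 11 → (σ.setReg 11 (A 26 i)).reg r = ρ' r := fun r hr => by
      rw [setReg_reg, if_neg (by omega), g2 r (by omega)]
    refine Run.ite (fun hb => Run.block ?_) fun hb => ?_
    · simp only [Test.Holds, setReg_reg] at hb
      rw [if_pos trivial, if_neg (by omega), e0] at hb
      refine ⟨by simp [hb], g1, hreg, by simp⟩
    · simp only [Test.Holds, setReg_reg] at hb
      rw [if_pos trivial, if_neg (by omega), e0] at hb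
      refine ((prints_fields (b := 11) (r := 9) (by omega) le_rfl _) (σ.setReg 11 (A 26 i)) g1
        hreg).mono ?_
      rintro t τ ⟨k1, k2, k3, k4⟩
      refine ⟨?_, k2, k3, ?_⟩
      · rw [k1, hi, if_neg hb]
        rfl
      · simp only [List.length_cons, List.length_nil] at k4
        omega
  · simp only [Finset.sum_const, Nat.card_Ico, smul_eq_mul]
    omega

end Prints

/-! ## Printing the rewriting -/

theorem flatMap_range'_eq {α : Type*} {g : α → List ℕ} {f : ℕ → List ℕ} : ∀ {l : List α} {s : ℕ},
    (∀ j x, l[j]? = some x → f (s + j) = g x) → (List.range' s l.length).flatMap f = l.flatMap g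
  | [], _, _ => rfl
  | x :: l, s, h => by
    rw [List.length_cons, List.range'_succ, List.flatMap_cons, List.flatMap_cons,
      flatMap_range'_eq (l := l) (s := s + 1) fun j y hy => by
        rw [show s + 1 + j = s + (j + 1) by omega]
        exact h (j + 1) y (by simpa using hy)]
    congr 1
    exact h 0 x rfl

-- `V` is generalised because `newVars` enlarges it along the list, whereas the marks refer to the
-- original `V` and to the terms read so far.
open Classical in
theorem flatMap_newVars {g : Var → List ℕ} {f : ℕ → List ℕ} : ∀ {ts : List Term} {V : Finset Var}
    {s : ℕ}, (∀ j t, ts[j]? = some t → f (s + j) =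
      if ∃ x, t = .var x ∧ x ∉ V ∪ varsOf (ts.take j) then t.var?.elim [] g else []) →
    (List.range' s ts.length).flatMap f = (newVars V ts).flatMap g
  | [], _, _, _ => rfl
  | t :: ts, V, s, h => by
    have h0 := h 0 t rfl
    have hs : ∀ j t', ts[j]? = some t' → f (s + 1 + j) =
        if ∃ x, t' = .var x ∧ x ∉ V ∪ t.vars ∪ varsOf (ts.take j) then t'.var?.elim [] g else [] := by
      intro j t' ht'
      rw [show s + 1 + j = s + (j + 1) by omega, h (j + 1) t' (by simpa using ht'),
        Finset.union_assoc]
      rfl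
    rw [List.length_cons, List.range'_succ, List.flatMap_cons]
    rw [Nat.add_zero] at h0
    cases t with
    | const c =>
      rw [newVars, h0, if_neg (by simp), List.nil_append]
      refine flatMap_newVars fun j t' ht' => ?_
      rw [hs j t' ht']
      simp [Term.vars]
    | var x =>
      rw [newVars, h0]
      by_cases hx : x ∈ V
      · rw [if_neg (by simp [hx]), if_pos hx, List.nil_append]
        refine flatMap_newVars fun j t' ht' => ?_
        rw [hs j t' ht', Term.vars, Finset.union_eq_left.2 (Finset.singleton_subset_iff.2 hx)]
      · rw [if_pos ⟨x, rfl, by simpa [varsOf] using hx⟩, if_neg hx, List.flatMap_cons]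
        congr 1
        refine flatMap_newVars fun j t' ht' => ?_
        rw [hs j t' ht', Term.vars, Finset.union_comm V, ← Finset.insert_eq]

theorem encode_exs (φ : Formula) : ∀ l : List Var,
    (exs l φ).encode = l.flatMap (fun x => 8 :: x.encode) ++ φ.encode
  | [] => rfl
  | x :: l => by simp [exs, Formula.encode, encode_exs φ l]

theorem encode_alls (φ : Formula) : ∀ l : List Var,
    (alls l φ).encode = l.flatMap (fun x => 7 :: x.encode) ++ φ.encode
  | [] => rfl
  | x :: l => by simp [alls, Formula.encode, encode_alls φ l]

theorem encode_eqs (φ : Formula) : ∀ (zs : List Var) (ts : List Term), (eqs zs ts φ).encode =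
    (List.zip zs ts).flatMap (fun p => 4 :: 2 :: ((Term.var p.1).encode ++ p.2.encode)) ++ φ.encode
  | [], _ => rfl
  | _ :: _, [] => rfl
  | z :: zs, t :: ts => by simp [eqs, Formula.encode, encode_eqs φ zs ts]

def freshCols (m : ℕ) (F : Atom) : List Var :=
  freshVars (m + F.rel.keyLen) (F.rel.cols.drop F.rel.keyLen)

/-- The encoding of `blockFormula m V F χ` up to `χ`. -/
def blockPrefix (m : ℕ) (V : Finset Var) (F : Atom) : List ℕ :=
  4 :: 1 :: F.encode ++ (freshCols m F).flatMap (fun z => 7 :: z.encode) ++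
    (6 :: 1 :: (blockAtom m F).encode) ++
    (newVars (V ∪ F.key) (F.args.drop F.rel.keyLen)).flatMap (fun x => 8 :: x.encode) ++
    (List.zip (freshCols m F) (F.args.drop F.rel.keyLen)).flatMap
      (fun p => 4 :: 2 :: ((Term.var p.1).encode ++ p.2.encode))

theorem encode_blockFormula (m : ℕ) (V : Finset Var) (F : Atom) (χ : Formula) :
    (blockFormula m V F χ).encode = blockPrefix m V F ++ χ.encode := by
  simp [blockFormula, Formula.encode, encode_alls, encode_exs, encode_eqs, blockPrefix, freshCols]

theorem freshVars_getElem? : ∀ (m : ℕ) (bs : List Bool) (j : ℕ),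
    (freshVars m bs)[j]? = bs[j]?.map fun b => ⟨b, m + j⟩
  | _, [], _ => rfl
  | m, b :: bs, 0 => rfl
  | m, b :: bs, j + 1 => by
    rw [freshVars, List.getElem?_cons_succ, List.getElem?_cons_succ, freshVars_getElem?]
    congr 2
    rw [Nat.add_right_comm, Nat.add_assoc]

/-- Prints the prefix of `blockFormula` for the atom in register 8. -/
def printBlock : Prog :=
  .seq (printFields 8 [.lit 4, .lit 1, .arr 7, .arr 8, .arr 9])
  (.seq (printCells allCells [.arr 1, .arr 2, .arr 3, .arr 4])
  (.seq (printCells restCells [.lit 7, .arr 1, .arr 27])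
  (.seq (printFields 8 [.lit 6, .lit 1, .arr 7, .arr 8, .arr 9])
  (.seq (printCells keyCells [.arr 1, .arr 2, .arr 3, .arr 4])
  (.seq (printCells restCells [.arr 1, .arr 1, .arr 27, .lit 0])
  (.seq (printNew restCells)
    (printCells restCells [.lit 4, .lit 2, .arr 1, .arr 27, .lit 0, .arr 2, .arr 3, .arr 4])))))))

/-! ### The memory cells and the symbols printed for one atom. -/

section Block

variable {A : ℕ → ℕ → ℕ} {ρ : ℕ → ℕ} {a s m : ℕ} {F : Atom} {V : Finset Var}

theorem sets_allCells (hA : AtomAt A a s F) (h8 : ρ 8 = a) :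
    Sets A ρ allCells (s + 1) (s + 1 + F.args.length) := by
  refine ⟨by omega, le_rfl, fun σ h1 h2 => ?_⟩
  have e8 : σ.reg 8 = a := (h2 8 (by omega)).trans h8
  simp [allCells, h1, e8, hA.beg, hA.fin]
  intro r hr
  rw [← h2 r hr]
  repeat rw [if_neg (by omega)]

theorem sets_keyCells (hA : AtomAt A a s F) (h8 : ρ 8 = a) :
    Sets A ρ keyCells (s + 1) (s + 1 + F.rel.keyLen) := by
  refine ⟨by omega, le_rfl, fun σ h1 h2 => ?_⟩
  have e8 : σ.reg 8 = a := (h2 8 (by omega)).trans h8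
  simp [keyCells, h1, e8, hA.beg, hA.keyEnd]
  intro r hr
  rw [← h2 r hr]
  repeat rw [if_neg (by omega)]

theorem sets_restCells (hA : AtomAt A a s F) (h8 : ρ 8 = a) :
    Sets A ρ restCells (s + 1 + F.rel.keyLen) (s + 1 + F.args.length) := by
  have := keyLen_le_args F
  refine ⟨by omega, by simp [restCells], fun σ h1 h2 => ?_⟩
  have e8 : σ.reg 8 = a := (h2 8 (by omega)).trans h8
  simp [restCells, h1, e8, hA.keyEnd, hA.fin]
  intro r hr
  rw [← h2 r hr]
  repeat rw [if_neg (by omega)]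

theorem Atom.cells_getElem? (F : Atom) {j : ℕ} {b : Bool} {t : Term} :
    F.cells[j]? = some (b, t) ↔ F.rel.cols[j]? = some b ∧ F.args[j]? = some t := by
  rw [Atom.cells, List.getElem?_zip_eq_some]

theorem cols_getElem? (F : Atom) {j : ℕ} {t : Term} (h : F.args[j]? = some t) :
    ∃ b, F.rel.cols[j]? = some b :=
  ⟨_, List.getElem?_eq_getElem (F.args_length ▸ (List.getElem?_eq_some_iff.1 h).1)⟩

theorem args_getElem? (F : Atom) {j : ℕ} {b : Bool} (h : F.rel.cols[j]? = some b) :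
    ∃ t, F.args[j]? = some t :=
  ⟨_, List.getElem?_eq_getElem (F.args_length.symm ▸ (List.getElem?_eq_some_iff.1 h).1)⟩

theorem cells_flatMap (hA : AtomAt A a s F) :
    (List.range' (s + 1) F.args.length).flatMap
      (fun o => [Field.arr 1, .arr 2, .arr 3, .arr 4].map (Field.val A o)) =
      F.cells.flatMap encArg := by
  rw [← F.cells_length]
  refine flatMap_range'_eq fun j p hp => ?_
  obtain ⟨c1, c2, c3, c4, -⟩ := hA.cell j p hp
  simp [Field.val, encArg, c1, c2, c3, c4]

theorem freshCols_getElem? (m : ℕ) (F : Atom) (j : ℕ) : (freshCols m F)[j]? =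
    F.rel.cols[F.rel.keyLen + j]?.map fun b => ⟨b, m + F.rel.keyLen + j⟩ := by
  rw [freshCols, freshVars_getElem?, List.getElem?_drop]

theorem freshCols_length (m : ℕ) (F : Atom) :
    (freshCols m F).length = F.args.length - F.rel.keyLen := by
  rw [freshCols, freshVars_length, List.length_drop, F.args_length]

theorem rest_cell (hA : AtomAt A a s F)
    (hM : ∀ j, j < F.args.length → MarkedAt A m s V F j) {j : ℕ} {z : Var}
    (hz : (freshCols m F)[j]? = some z) : ∃ t, F.args[F.rel.keyLen + j]? = some t ∧
      A 1 (s + 1 + F.rel.keyLen + j) = (if z.numerical then 1 else 0) ∧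
      A 27 (s + 1 + F.rel.keyLen + j) = z.idx ∧ A 2 (s + 1 + F.rel.keyLen + j) = t.tag ∧
      A 3 (s + 1 + F.rel.keyLen + j) = t.fst ∧ A 4 (s + 1 + F.rel.keyLen + j) = t.snd := by
  rw [freshCols_getElem?, Option.map_eq_some_iff] at hz
  obtain ⟨b, hb, rfl⟩ := hz
  obtain ⟨t, ht⟩ := args_getElem? F hb
  obtain ⟨c1, c2, c3, c4, -⟩ := hA.cell _ _ (F.cells_getElem?.2 ⟨hb, ht⟩)
  obtain ⟨m1, -⟩ := hM _ (List.getElem?_eq_some_iff.1 ht).1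
  rw [← Nat.add_assoc] at c1 c2 c3 c4 m1
  exact ⟨t, ht, c1, by rw [m1, Nat.add_assoc], c2, c3, c4⟩

theorem Var.encode_eq (x : Var) : x.encode = [if x.numerical then 1 else 0, x.idx] := rfl

theorem fresh_flatMap (hA : AtomAt A a s F)
    (hM : ∀ j, j < F.args.length → MarkedAt A m s V F j) :
    (List.range' (s + 1 + F.rel.keyLen) (F.args.length - F.rel.keyLen)).flatMap
      (fun o => [Field.lit 7, .arr 1, .arr 27].map (Field.val A o)) =
      (freshCols m F).flatMap fun z => 7 :: z.encode := by
  rw [← freshCols_length m F]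
  refine flatMap_range'_eq fun j z hz => ?_
  obtain ⟨t, -, h1, h2, -⟩ := rest_cell hA hM hz
  simp [Field.val, h1, h2, Var.encode_eq]

theorem eqs_flatMap (hA : AtomAt A a s F)
    (hM : ∀ j, j < F.args.length → MarkedAt A m s V F j) :
    (List.range' (s + 1 + F.rel.keyLen) (F.args.length - F.rel.keyLen)).flatMap
      (fun o => [Field.lit 4, .lit 2, .arr 1, .arr 27, .lit 0, .arr 2, .arr 3, .arr 4].map
        (Field.val A o)) =
      (List.zip (freshCols m F) (F.args.drop F.rel.keyLen)).flatMap
        fun p => 4 :: 2 :: ((Term.var p.1).encode ++ p.2.encode) := by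
  have hlen : (List.zip (freshCols m F) (F.args.drop F.rel.keyLen)).length
      = F.args.length - F.rel.keyLen := by
    rw [List.length_zip, freshCols_length, List.length_drop, Nat.min_self]
  rw [← hlen]
  refine flatMap_range'_eq fun j p hp => ?_
  obtain ⟨z, t⟩ := p
  obtain ⟨hz, ht⟩ := List.getElem?_zip_eq_some.1 hp
  obtain ⟨t', ht', h1, h2, h3, h4, h5⟩ := rest_cell hA hM hz
  rw [List.getElem?_drop, ht', Option.some.injEq] at ht
  subst ht
  have hz' : (Term.var z).encode = [if z.numerical then 1 else 0, z.idx, 0] := rfl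
  simp [Field.val, h1, h2, h3, h4, h5, Term.encode_eq t', hz']

/-- The key part is copied from memory. In the remaining part the column flag is printed twice,
since it is also the tag of the fresh variable, whose index `m + j` is in array 27. -/
theorem blockAtom_flatMap (hA : AtomAt A a s F)
    (hM : ∀ j, j < F.args.length → MarkedAt A m s V F j) :
    (List.range' (s + 1) F.rel.keyLen).flatMap
      (fun o => [Field.arr 1, .arr 2, .arr 3, .arr 4].map (Field.val A o)) ++
    (List.range' (s + 1 + F.rel.keyLen) (F.args.length - F.rel.keyLen)).flatMap
      (fun o => [Field.arr 1, .arr 1, .arr 27, .lit 0].map (Field.val A o)) =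
      (blockAtom m F).cells.flatMap encArg := by
  have hk := keyLen_le_args F
  have hcells : (blockAtom m F).cells = F.cells.take F.rel.keyLen ++
      (freshCols m F).map fun z => (z.numerical, Term.var z) := by
    have hkc := F.rel.keyLen_le
    refine List.ext_getElem? fun j => ?_
    unfold Atom.cells
    simp only [blockAtom]
    rw [List.zip_eq_zipWith (l₁ := F.rel.cols) (l₂ := F.args), List.take_zipWith, ← List.zip_eq_zipWith, ← freshCols]
    have e1 : F.rel.cols = F.rel.cols.take F.rel.keyLen ++ F.rel.cols.drop F.rel.keyLen := by simp
    conv_lhs => rw [e1]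
    rw [List.zip_append (by simp; omega)]
    congr 2
    refine List.ext_getElem? fun i => ?_
    rw [List.getElem?_map, freshCols_getElem?]
    cases hb : F.rel.cols[F.rel.keyLen + i]? with
    | none =>
      rw [Option.map_none, Option.map_none, List.getElem?_eq_none_iff, List.length_zip,
        List.length_drop]
      rw [List.getElem?_eq_none_iff] at hb
      omega
    | some b =>
      rw [Option.map_some, Option.map_some, List.getElem?_zip_eq_some, List.getElem?_drop,
        List.getElem?_map, freshCols_getElem?, hb]
      simp
  rw [hcells, List.flatMap_append]
  congr 1
  · have hlen : (F.cells.take F.rel.keyLen).length = F.rel.keyLen := by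
      rw [List.length_take, F.cells_length]
      omega
    conv_lhs => rw [← hlen]
    refine flatMap_range'_eq fun j p hp => ?_
    rw [List.getElem?_take] at hp
    split_ifs at hp
    obtain ⟨c1, c2, c3, c4, -⟩ := hA.cell j p hp
    simp [Field.val, encArg, c1, c2, c3, c4]
  · rw [List.flatMap_map, ← freshCols_length m F]
    refine flatMap_range'_eq fun j z hz => ?_
    obtain ⟨t, -, h1, h2, -⟩ := rest_cell hA hM hz
    simp [Field.val, encArg, h1, h2, flagNat, Term.tag, Term.fst, Term.snd]

theorem var_cell (hA : AtomAt A a s F) {j : ℕ} {x : Var} (h : F.args[j]? = some (.var x)) :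
    [8, A 2 (s + 1 + j), A 3 (s + 1 + j)] = 8 :: x.encode := by
  obtain ⟨b, hb⟩ := cols_getElem? F h
  obtain ⟨-, c2, c3, -⟩ := hA.cell _ _ (F.cells_getElem?.2 ⟨hb, h⟩)
  simp [c2, c3, Term.tag, Term.fst, Var.encode_eq]

open Classical in
theorem new_cell (hA : AtomAt A a s F) (hM : ∀ j, j < F.args.length → MarkedAt A m s V F j)
    {j : ℕ} {t : Term} (ht : F.args[j]? = some t) :
    (if A 26 (s + 1 + j) = 0 then [] else [8, A 2 (s + 1 + j), A 3 (s + 1 + j)]) =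
      if ∃ x, t = .var x ∧ x ∉ V ∪ varsOf (F.args.take j) then
        t.var?.elim [] (fun x => 8 :: x.encode) else [] := by
  have hm := (hM j (List.getElem?_eq_some_iff.1 ht).1).2 t ht
  split_ifs with h1 h2 h2
  · exact absurd h1 (hm.2 h2)
  · rfl
  · obtain ⟨x, rfl, -⟩ := h2
    exact var_cell hA ht
  · exact absurd (hm.1 h1) h2

theorem newArgs_flatMap (hA : AtomAt A a s F)
    (hM : ∀ j, j < F.args.length → MarkedAt A m s V F j) :
    (List.range' (s + 1) F.args.length).flatMap
      (fun o => if A 26 o = 0 then [] else [8, A 2 o, A 3 o]) =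
      (newVars V F.args).flatMap fun x => 8 :: x.encode :=
  flatMap_newVars fun _ _ ht => new_cell hA hM ht

/-- The same marks serve both quantifier prefixes: beyond the key, being new after `V` and the
preceding arguments already excludes the key variables. -/
theorem newRest_flatMap (hA : AtomAt A a s F)
    (hM : ∀ j, j < F.args.length → MarkedAt A m s V F j) :
    (List.range' (s + 1 + F.rel.keyLen) (F.args.length - F.rel.keyLen)).flatMap
      (fun o => if A 26 o = 0 then [] else [8, A 2 o, A 3 o]) =
      (newVars (V ∪ F.key) (F.args.drop F.rel.keyLen)).flatMap fun x => 8 :: x.encode := by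
  rw [← List.length_drop]
  refine flatMap_newVars fun j t ht => ?_
  rw [List.getElem?_drop] at ht
  rw [Nat.add_assoc, new_cell hA hM ht]
  have : V ∪ F.key ∪ varsOf ((F.args.drop F.rel.keyLen).take j)
      = V ∪ varsOf (F.args.take (F.rel.keyLen + j)) := by
    rw [Finset.union_assoc, Atom.key, List.take_add]
    congr 1
    ext x
    simp [mem_varsOf, or_and_right, exists_or]
  rw [this]

theorem prints_block (hA : AtomAt A a s F)
    (hM : ∀ j, j < F.args.length → MarkedAt A m s V F j) (h0 : ρ 0 = 0) (h8 : ρ 8 = a) :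
    Prints 9 A ρ printBlock (blockPrefix m V F) (100 * (1 + F.args.length)) := by
  have hk := keyLen_le_args F
  have e1 : s + 1 + F.args.length - (s + 1) = F.args.length := by omega
  have e2 : s + 1 + F.rel.keyLen - (s + 1) = F.rel.keyLen := by omega
  have e3 : s + 1 + F.args.length - (s + 1 + F.rel.keyLen) = F.args.length - F.rel.keyLen := by omega
  have p1 := prints_cells (sets_allCells hA h8) [.arr 1, .arr 2, .arr 3, .arr 4]
  have p2 := prints_cells (sets_restCells hA h8) [.lit 7, .arr 1, .arr 27]
  have p3 := prints_cells (sets_keyCells hA h8) [.arr 1, .arr 2, .arr 3, .arr 4]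
  have p4 := prints_cells (sets_restCells hA h8) [.arr 1, .arr 1, .arr 27, .lit 0]
  have p5 := prints_new (sets_restCells hA h8) h0
  have p6 := prints_cells (sets_restCells hA h8)
    [.lit 4, .lit 2, .arr 1, .arr 27, .lit 0, .arr 2, .arr 3, .arr 4]
  rw [e1, cells_flatMap hA] at p1
  rw [e3, fresh_flatMap hA hM] at p2
  rw [e2] at p3
  rw [e3] at p4
  rw [e3, newRest_flatMap hA hM] at p5
  rw [e3, eqs_flatMap hA hM] at p6
  refine (((prints_fields (by omega) (by omega) _).seq (p1.seq (p2.seq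
    ((prints_fields (by omega) (by omega) _).seq (p3.seq (p4.seq (p5.seq p6))))))).mono ?_ ?_)
  · rw [blockPrefix, Atom.encode_eq (blockAtom m F), ← blockAtom_flatMap hA hM, Atom.encode_eq F]
    simp [Field.val, h8, hA.id, hA.keyLen, hA.arity, blockAtom]
  · simp only [List.length_cons, List.length_nil]
    omega

end Block

/-- The value of `g` for the variables of the first `j` atoms and the next atom. -/
def atStep (g : Finset Var → Atom → List ℕ) (l : List Atom) (j : ℕ) : List ℕ :=
  l[j]?.elim [] (g (atomsVars (l.take j)))

/-- The encoding of the quantifiers and of the block formula of an atom in `certainFormula`. -/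
def certainPrefix (m : ℕ) (V : Finset Var) (F : Atom) : List ℕ :=
  (newVars V F.args).flatMap (fun x => 8 :: x.encode) ++ blockPrefix m V F

theorem atomsVars_take_succ {l : List Atom} {k : ℕ} {F : Atom} (h : l[k]? = some F) :
    atomsVars (l.take (k + 1)) = atomsVars (l.take k) ∪ F.vars := by
  ext x
  simp only [mem_atomsVars, Finset.mem_union, List.take_add_one, h, Option.toList_some,
    List.mem_append, List.mem_singleton, or_and_right, exists_or, exists_eq_left]

theorem drop_eq_cons {l : List Atom} {k : ℕ} {F : Atom} (h : l[k]? = some F) :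
    l.drop k = F :: l.drop (k + 1) := by
  obtain ⟨hk, rfl⟩ := List.getElem?_eq_some_iff.1 h
  exact List.drop_eq_getElem_cons hk

/-- In Polish notation the nested formula is a sequence of prefixes followed by the single symbol of
`tru`, so no stack is needed. The prefix of an atom depends only on its position, not on where the
recursion began; marks computed once therefore serve all conjuncts. -/
theorem encode_certainFormula (m : ℕ) (l : List Atom) : ∀ {d k : ℕ}, k + d = l.length →
    (certainFormula m (atomsVars (l.take k)) (l.drop k)).encode =
      (List.range' k d).flatMap (atStep (certainPrefix m) l) ++ [0]
  | 0, k, h => by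
    rw [List.drop_of_length_le (by omega)]
    rfl
  | d + 1, k, h => by
    have hF := List.getElem?_eq_getElem (show k < l.length by omega)
    rw [drop_eq_cons hF, certainFormula, ← atomsVars_take_succ hF, encode_exs, encode_blockFormula,
      encode_certainFormula m l (d := d) (by omega), List.range'_succ, List.flatMap_cons]
    simp [atStep, hF, certainPrefix]

/-- The encoding of the `k`-th conjunct of `alongFormula`. -/
def conjunct (m : ℕ) (l : List Atom) (k : ℕ) : List ℕ :=
  [4] ++ (atStep (blockPrefix m) l k ++
    ((List.range' (k + 1) (l.length - (k + 1))).flatMap (atStep (certainPrefix m) l) ++ [0]))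

theorem encode_alongFormula (m : ℕ) (l : List Atom) : ∀ {d k : ℕ}, k + d = l.length →
    (alongFormula m (atomsVars (l.take k)) (l.drop k)).encode =
      (List.range' k d).flatMap (conjunct m l) ++ [0]
  | 0, k, h => by
    rw [List.drop_of_length_le (by omega)]
    rfl
  | d + 1, k, h => by
    have hF := List.getElem?_eq_getElem (show k < l.length by omega)
    rw [drop_eq_cons hF, alongFormula, ← atomsVars_take_succ hF, Formula.encode,
      encode_blockFormula, encode_certainFormula m l (d := l.length - (k + 1)) (by omega),
      encode_alongFormula m l (d := d) (by omega), List.range'_succ, List.flatMap_cons]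
    simp [atStep, hF, conjunct]

/-- Runs `P` with the number of the atom at the position in register `r` in register 8. -/
def withAtom (r : ℕ) (P : Prog) : Prog := .seq (block [.load 8 24 r]) P

def printCertain : Prog :=
  forLoop 6 [.copy 6 4, .succ 6, .copy 7 1] (withAtom 6 (.seq (printNew allCells) printBlock))

/-- Loop counters and bounds sit in registers 4 and 5, 6 and 7, 9 and 10, from the outermost to the
innermost loop; register 8 holds the current atom. -/
def printRewriting : Prog :=
  .seq (forLoop 4 [.const 4 0, .copy 5 1]
    (.seq (printFields 0 [.lit 4])
    (.seq (withAtom 4 printBlock)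
    (.seq printCertain (printFields 0 [.lit 0])))))
    (printFields 0 [.lit 0])

/-- The arrays `A` hold the sorted list `l` of atoms with marks. -/
def Marked (A : ℕ → ℕ → ℕ) (m : ℕ) (l : List Atom) : Prop :=
  ∀ j F, l[j]? = some F → ∃ s, AtomAt A (A 24 j) s F ∧
    ∀ i, i < F.args.length → MarkedAt A m s (atomsVars (l.take j)) F i

/-- The number of cells of the atom at position `j`, including its head. -/
def weight (l : List Atom) (j : ℕ) : ℕ := l[j]?.elim 0 fun F => 1 + F.args.length

theorem sum_weight (l : List Atom) :
    ∑ j ∈ Finset.range l.length, weight l j = (l.map fun F => 1 + F.args.length).sum := by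
  induction l with
  | nil => rfl
  | cons F l ih =>
    rw [List.length_cons, Finset.sum_range_succ', List.map_cons, List.sum_cons, ← ih, add_comm]
    rfl

section

variable {A : ℕ → ℕ → ℕ} {ρ : ℕ → ℕ} {m : ℕ} {l : List Atom}

theorem prints_withAtom {b r c : ℕ} {P : Prog} {out : List ℕ} (hr : r < b) (hb : b ≤ 8)
    (h : ∀ ρ', (∀ r, r < b → ρ' r = ρ r) → ρ' 8 = A 24 (ρ r) → Prints 9 A ρ' P out c) :
    Prints b A ρ (withAtom r P) out (2 + c) := by
  refine (Prints.init (Φ := fun ρ' => ρ' 8 = A 24 (ρ r)) (b' := 9) (by omega) (fun σ h1 h2 => ?_)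
    h).mono rfl (by simp)
  simp [h1, h2 r hr]
  intro s hs
  rw [if_neg (by omega), h2 s hs]

theorem prints_certain (hA : Marked A m l) (h0 : ρ 0 = 0) (h1 : ρ 1 = l.length)
    (h4 : ρ 4 + 1 ≤ l.length) :
    Prints 6 A ρ printCertain ((List.range' (ρ 4 + 1) (l.length - (ρ 4 + 1))).flatMap
      (atStep (certainPrefix m) l))
      (5 + 123 * (l.map fun F => 1 + F.args.length).sum) := by
  refine (Prints.for (d := fun j => 120 * weight l j) h4 (fun σ g1 g2 => ?_)
    (fun j ρ' hj1 hj2 hρ h6 _ => ?_)).mono rfl ?_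
  · simp [g1, g2 4, g2 1, h1]
    intro r hr
    rw [← g2 r hr]
    repeat rw [if_neg (by omega)]
  · have hF := List.getElem?_eq_getElem hj2
    obtain ⟨s, hs, hM⟩ := hA j _ hF
    refine (prints_withAtom (c := 5 + l[j].args.length * 13 + 100 * (1 + l[j].args.length))
      (by omega) (by omega) fun ρ'' hρ' h8 => ?_).mono rfl ?_
    · rw [h6] at h8
      have e0 : ρ'' 0 = 0 := by rw [hρ' 0 (by omega), hρ 0 (by omega), h0]
      have p := prints_new (sets_allCells hs h8) e0
      rw [Nat.add_sub_cancel_left, newArgs_flatMap hs hM] at p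
      refine (p.seq (prints_block hs hM e0 h8)).mono ?_ le_rfl
      simp [atStep, hF, certainPrefix]
    · simp only [weight, hF, Option.elim_some]
      omega
  · rw [← sum_weight, Finset.mul_sum]
    refine Nat.add_le_add_left ?_ _
    refine (Finset.sum_le_sum fun j hj => ?_).trans (Finset.sum_le_sum_of_subset
      (f := fun j => 123 * weight l j) fun j hj => Finset.mem_range.2 (Finset.mem_Ico.1 hj).2)
    simp only [weight, List.getElem?_eq_getElem (Finset.mem_Ico.1 hj).2, Option.elim_some]
    omega

/-- Each of the `n` conjuncts takes time linear in the number `W` of cells, and `n ≤ W` because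
every atom has a head. -/
theorem prints_rewriting (hA : Marked A m l) (h0 : ρ 0 = 0) (h1 : ρ 1 = l.length) :
    Prints 4 A ρ printRewriting (alongFormula m ∅ l).encode
      (300 * (1 + (l.map fun F => 1 + F.args.length).sum) ^ 2) := by
  set W := (l.map fun F => 1 + F.args.length).sum with hW
  have hn : l.length ≤ W := by
    rw [hW]
    clear hW h1 hA
    clear_value W
    induction l with
    | nil => simp
    | cons F l ih =>
      rw [List.length_cons, List.map_cons, List.sum_cons]
      omega
  refine ((Prints.for (s := 0) (e := l.length) (f := conjunct m l) (d := fun _ => 250 * (1 + W))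
    (Nat.zero_le _) (fun σ g1 g2 => ?_) (fun k ρ' _ hk hρ h4 _ => ?_)).seq
      (prints_fields (by omega) (by omega) _)).mono ?_ ?_
  · simp [g1, g2 1, h1]
    intro r hr
    rw [← g2 r hr]
    repeat rw [if_neg (by omega)]
  · have hF := List.getElem?_eq_getElem hk
    obtain ⟨s, hs, hM⟩ := hA k _ hF
    have e0 : ρ' 0 = 0 := (hρ 0 (by omega)).trans h0
    have p := prints_certain (ρ := ρ') hA e0 ((hρ 1 (by omega)).trans h1) (by omega)
    rw [h4] at p
    refine (((prints_fields (by omega) (by omega) _).seq ((prints_withAtom (by omega) (by omega)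
      (out := atStep (blockPrefix m) l k) (c := 100 * (1 + l[k].args.length)) fun ρ'' hρ' h8 => ?_).seq
      (p.seq (prints_fields (by omega) (by omega) _)))).mono (by simp [Field.val, conjunct]) ?_)
    · rw [h4] at h8
      refine (prints_block hs hM ((hρ' 0 (by omega)).trans e0) h8).mono ?_ le_rfl
      simp [atStep, hF]
    · have : weight l k ≤ W := by
        rw [hW, ← sum_weight]
        exact Finset.single_le_sum (f := weight l) (fun _ _ => Nat.zero_le _)
          (Finset.mem_range.2 hk)
      simp only [weight, hF, Option.elim_some] at this
      simp only [List.length_cons, List.length_nil, ← hW]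
      omega
  · have := encode_alongFormula m l (d := l.length) (k := 0) (by omega)
    simp only [List.take_zero, List.drop_zero] at this
    rw [Nat.sub_zero, show (∅ : Finset Var) = atomsVars [] from rfl, this]
    simp [Field.val]
  · have := Nat.mul_le_mul_right (250 * (1 + W) + 3) hn
    simp only [Finset.sum_const, Nat.card_Ico, smul_eq_mul, List.length_cons, List.length_nil,
      Nat.sub_zero]
    nlinarith

end

/-! ## The algorithm -/

def rewriteQuery : Prog := .seq prepare (.seq analyze (.seq sortAtoms (.seq markNew printRewriting)))

theorem idx_lt_of_parsed {q : SJFBCQ} {σ : State} (h : Parsed q.atoms σ) {x : Var}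
    (hx : x ∈ q.vars) : x.idx < σ.reg 3 + 1 := by
  obtain ⟨F, hF, hxF⟩ := mem_atomsVars.1 hx
  obtain ⟨t, ht, hxt⟩ := mem_varsOf.1 hxF
  obtain ⟨j, hj, rfl⟩ := List.getElem_of_mem ht
  have hget := List.getElem?_eq_getElem hj
  obtain ⟨b, hb⟩ := cols_getElem? F hget
  have := h.fst_le F hF _ (List.mem_of_getElem? (F.cells_getElem?.2 ⟨hb, hget⟩))
  rw [mem_vars_term] at hxt
  cases ht : F.args[j] with
  | var y =>
    rw [ht, Term.var?, Option.some.injEq] at hxt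
    rw [ht, hxt, Term.fst] at this
    omega
  | const c => simp [ht, Term.var?] at hxt

theorem map_filterMap_getElem? {q : SJFBCQ} {L : List ℕ} (h : ∀ a ∈ L, a < q.atoms.length) :
    L.map (fun a => q.atoms[a]?) = (L.filterMap fun a => q.atoms[a]?).map some := by
  induction L with
  | nil => rfl
  | cons a L ih =>
    have ha := List.getElem?_eq_getElem (h a (by simp))
    rw [List.map_cons, List.filterMap_cons_some ha, List.map_cons, ha,
      ih fun b hb => h b (by simp [hb])]

theorem run_rewriteQuery {q : SJFBCQ} (hac : q.AcyclicAttackGraph) :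
    Run rewriteQuery (State.init q.encode) fun t τ => ∃ m l, (∀ x ∈ q.vars, x.idx < m) ∧
      q.IsTopologicalSort l ∧ τ.out = (alongFormula m ∅ l).encode ∧ t ≤ 1000 * q.size ^ 2 := by
  have hN := length_lt_start q.atoms
  have hsize := start_le_size q
  refine Run.comp (run_prepare q) ?_
  rintro t₁ σ₁ ⟨h1, hz1, ht1⟩
  refine Run.comp (run_analyze h1 hz1) ?_
  rintro t₂ σ₂ ⟨h2, ht2⟩
  refine Run.comp (run_sortAtoms σ₂) ?_
  rintro t₃ σ₃ ⟨h3, ht3⟩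
  have hP2 := h2.prepared
  have hl2 := hP2.parsed.layout
  rw [hP2.parsed.len, hP2.parsed.pos] at h3 ht3
  set N := start q.atoms q.atoms.length with hNdef
  set n := q.atoms.length
  have r3 : ∀ r, r < 4 → σ₃.reg r = σ₂.reg r := fun r hr => by
    rw [h3.regs r (by omega), setReg_reg, if_neg (by omega)]
  have hdeg : ∀ a F, q.atoms[a]? = some F → σ₂.arr 23 a = attackCount q σ₂.arr F := by
    intro a F hF
    rw [h2.deg a F (List.getElem?_eq_some_iff.1 hF).1 hF, attackCount_congr h2.base]
  have hsort := isTopologicalSort_sortDesc hl2 hP2.num hac hdeg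
  have hperm : (sortDesc (σ₂.arr 23) N n (N + 1)).Perm (List.range n) := sortDesc_perm fun a ha => by
    rw [hdeg a _ (List.getElem?_eq_getElem ha)]
    exact attackCount_le _
  rw [← hNdef] at hsort
  set L := sortDesc (σ₂.arr 23) N n (N + 1) with hL
  set l := L.filterMap fun a => q.atoms[a]? with hl
  have hLl : L.map (fun a => q.atoms[a]?) = l.map some :=
    map_filterMap_getElem? fun a ha => List.mem_range.1 (hperm.subset ha)
  have hP3 : Prepared q σ₃ := hP2.congr h3.out r3 fun x y hx => h3.frame x y (by omega)
  refine Run.comp (run_markNew hP3 hLl hperm h3.get fun x y hx => ?_) ?_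
  · rw [h3.frame x y (by omega)]
    exact h2.zero x y (by omega)
  rintro t₄ σ₄ ⟨h4, ht4⟩
  have hmark : Marked σ₄.arr (σ₃.reg 3 + 1) l := by
    intro j F hF
    have hlen : L.length = l.length := by simpa using congrArg List.length hLl
    have hj := (List.getElem?_eq_some_iff.1 hF).1
    have hLj := List.getElem?_eq_getElem (hlen ▸ hj)
    obtain ⟨F', hF', hlF'⟩ := getElem?_of_map_eq hLl hLj
    obtain rfl : F = F' := by rwa [hF, Option.some.injEq] at hlF'
    rw [h4.frame 24 j (by omega), h3.get _ _ hLj]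
    have hlay : Layout q.atoms σ₄.arr :=
      hP3.parsed.layout.congr fun x y _ hx => h4.frame x y (by omega)
    refine ⟨_, hlay _ F hF', h4.marked j _ F ?_ hLj hF⟩
    have := hperm.length_eq
    rw [List.length_range] at this
    omega
  have hll : l.length = n := hsort.1.length_eq
  have e0 : σ₄.reg 0 = 0 := by rw [h4.regs 0 (by omega), hP3.parsed.zero]
  have e1 : σ₄.reg 1 = l.length := by rw [h4.regs 1 (by omega), hP3.parsed.len, hll]
  refine (prints_rewriting hmark e0 e1 σ₄ rfl fun _ _ => rfl).mono ?_
  rintro t₅ σ₅ ⟨g1, -, -, g4⟩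
  refine ⟨σ₃.reg 3 + 1, l, fun x hx => idx_lt_of_parsed hP3.parsed hx, hsort, ?_, ?_⟩
  · rw [g1, h4.out, hP3.parsed.out, List.nil_append]
  · have hW : 1 + (l.map fun F => 1 + F.args.length).sum = N := by
      rw [hNdef, start, List.take_length, (hsort.1.map _).sum_eq]
    rw [hW] at g4
    rw [← hNdef] at ht4
    -- Sorting in terms of `N` alone: `n < N` gives `10 n + 10 ≤ 10 N`, and `N + 1 ≤ 2 N`.
    have hn : (10 * n + 10) * (N + 1) ≤ (10 * N) * (2 * N) := Nat.mul_le_mul (by omega) (by omega)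
    have hsq : N ^ 2 ≤ q.size ^ 2 := Nat.pow_le_pow_left hsize 2
    have hNN : N ≤ N ^ 2 := by nlinarith
    have : (10 * N) * (2 * N) = 20 * N ^ 2 := by ring
    omega

end CQA

theorem mainTheorem12 :
    ∃ (P : CQA.Prog) (C : ℕ), ∀ q : CQA.SJFBCQ, q.AcyclicAttackGraph →
      ∃ (φ : CQA.Formula) (t : ℕ),
        P.Computes q.encode φ.encode t ∧ t ≤ C * q.size ^ 2 ∧
        φ.freeVars = q.vars ∧
        ∀ l : List CQA.Atom, q.IsTopologicalSort l →
          ∀ (db : CQA.Database) (θ : CQA.Valuation), θ.dom = q.vars →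
            (CQA.Models db θ φ ↔ CQA.IsForallEmbedding l db θ) := by
  refine ⟨CQA.rewriteQuery, 1000, fun q hac => ?_⟩
  obtain ⟨t, τ, h1, m, l, hm, hl, hout, ht⟩ := CQA.run_rewriteQuery hac
  obtain ⟨h2, h3⟩ := CQA.alongFormula_correct hm hl
  exact ⟨_, t, ⟨τ, h1, hout⟩, ht, h2, h3⟩
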